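/- Let $\mathcal H,\mathcal H_1$ be complex Hilbert spaces and let $H$ be a selfadjoint operator on $\mathcal H$ with resolvent $R_H(z)=(H-z)^{-1}$, $z\in\mathbb C\setminus\mathbb R$, and $\Im R_H(z)=(2i)^{-1}(R_H(z)-R_H(\bar z))$. A closed, densely defined operator $A$ from $\mathcal H$ to $\mathcal H_1$ is called $H$-*smooth* with constant $a\in\mathbb R$ if there is $\epsilon_0>0$ such that for all $\epsilon,\lambda\in\mathbb R$ with $0<|\epsilon|<\epsilon_0$ $$|(\Im R_H(\lambda+i\epsilon)A^*v,A^*v)_{\mathcal H}|\le a\|v\|_{\mathcal H_1}^2,\qquad v\in D(A^*),$$ and $H$-*supersmooth* with constant $a$ if there is $\epsilon_0>0$ such that for the same $\epsilon,\lambda$ $$|(R_H(\lambda+i\epsilon)A^*v,A^*v)_{\mathcal H}|\le a\|v\|_{\mathcal H_1}^2,\qquad v\in D(A^*).$$ A step function $h:\mathbb R\to\mathcal H_1$ is a measurable function of bounded support taking finitely many values. Products of unbounded operators carry their natural domains, functions of $H+\nu$ are defined by the spectral theorem, and $L^2\mathcal H_1=L^2(\mathbb R;\mathcal H_1)$. **Theorem.**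 Let $\nu\in\mathbb R$ with $H+\nu\ge0$ and $H+\nu$ injective, and let $A$ and $A(H+\nu)^{-1/4}$ be closed operators with dense domain from $\mathcal H$ to $\mathcal H_1$. Let $a\in\mathbb R$ and $C=(\pi+3)a$. (i) If $A$ is $H$-smooth with constant $a$, then $A(H+\nu)^{-1/4}$ is $\sqrt{H+\nu}$-smooth with constant $C$. In particular, for every $v\in D((H+\nu)^{1/4})$ one has $e^{-it\sqrt{H+\nu}}v\in D(A)$ for almost every $t\in\mathbb R$, the function $t\mapsto Ae^{-it\sqrt{H+\nu}}v$ is strongly measurable (a.e.), and $$\|Ae^{-it\sqrt{H+\nu}}v\|_{L^2\mathcal H_1}\le 2C^{1/2}\|(H+\nu)^{1/4}v\|_{\mathcal H}.$$ (ii) If $A$ is $H$-supersmooth with constant $a$, then $A(H+\nu)^{-1/4}$ is $\sqrt{H+\nu}$-supersmooth with constant $C$. In particular, for every step function $h:\mathbb R\to D((H+\nu)^{-1/4}A^*)\subset\mathcal H_1$ and every $t\in\mathbb R$, the vector $Ae^{-i(t-s)\sqrt{H+\nu}}(H+\nu)^{-1/2}A^*h(s)$ is defined for almost every $s\in\mathbb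 R$ and is Bochner integrable in $s$ between $0$ and $t$, its integral over $[0,t]$ is strongly measurable (a.e.) in $t$, and $$\Big\|\int_0^tAe^{-i(t-s)\sqrt{H+\nu}}(H+\nu)^{-1/2}A^*h(s)\,ds\Big\|_{L^2\mathcal H_1}\le 2(\pi+3)a\,\|h\|_{L^2\mathcal H_1}.$$ -/

import Mathlib

open MeasureTheory
open scoped InnerProductSpace LinearPMap ENNReal

noncomputable section

namespace KatoSmoothing

/-! ### Partially defined operators -/

/-- The product `g f` of two partially defined operators, with its natural domain
`{x ∈ D(f) | f x ∈ D(g)}`. -/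
def pcomp {E F G : Type*} [AddCommGroup E] [Module ℂ E] [AddCommGroup F] [Module ℂ F]
    [AddCommGroup G] [Module ℂ G] (g : F →ₗ.[ℂ] G) (f : E →ₗ.[ℂ] F) : E →ₗ.[ℂ] G :=
  g.comp (f.domRestrict ((g.domain.comap f.toFun).map f.domain.subtype)) (by
    rintro ⟨x, hx⟩
    obtain ⟨⟨y, hy, hyx⟩, hxf⟩ := hx
    have h : (f.domRestrict ((g.domain.comap f.toFun).map f.domain.subtype))
        ⟨x, ⟨⟨y, hy, hyx⟩, hxf⟩⟩ = f y := LinearPMap.domRestrict_apply hyx.symm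
    rw [h]
    exact hy)

infixr:80 " ∘ₚ " => pcomp

theorem mem_pcomp_domain {E F G : Type*} [AddCommGroup E] [Module ℂ E] [AddCommGroup F]
    [Module ℂ F] [AddCommGroup G] [Module ℂ G] (g : F →ₗ.[ℂ] G) (f : E →ₗ.[ℂ] F) (x : E) :
    x ∈ (g ∘ₚ f).domain ↔ ∃ hx : x ∈ f.domain, f ⟨x, hx⟩ ∈ g.domain := by
  constructor
  · rintro ⟨⟨y, hy, rfl⟩, hxf⟩
    exact ⟨hxf, hy⟩
  · rintro ⟨hx, h⟩
    exact ⟨⟨⟨x, hx⟩, h, rfl⟩, hx⟩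

theorem pcomp_apply {E F G : Type*} [AddCommGroup E] [Module ℂ E] [AddCommGroup F]
    [Module ℂ F] [AddCommGroup G] [Module ℂ G] (g : F →ₗ.[ℂ] G) (f : E →ₗ.[ℂ] F)
    (x : (g ∘ₚ f).domain) (hx : (x : E) ∈ f.domain) (h : f ⟨x, hx⟩ ∈ g.domain) :
    (g ∘ₚ f) x = g ⟨f ⟨x, hx⟩, h⟩ := by
  rfl

open scoped Classical in
/-- The value of a partially defined operator at an arbitrary vector, with the value `0` outside
the domain. -/
def pval {E F : Type*} [AddCommGroup E] [Module ℂ E] [AddCommGroup F] [Module ℂ F]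
    (f : E →ₗ.[ℂ] F) (x : E) : F :=
  if hx : x ∈ f.domain then f ⟨x, hx⟩ else 0

/-- The operator `H + ν`, with domain `D(H)`. -/
def shift {E : Type*} [AddCommGroup E] [Module ℂ E] (H : E →ₗ.[ℂ] E) (ν : ℝ) : E →ₗ.[ℂ] E :=
  ((ν : ℂ) • (LinearMap.id : E →ₗ[ℂ] E)) +ᵥ H

/-- `T ≥ 0` in the sense of quadratic forms. -/
def IsNonneg {E : Type*} [NormedAddCommGroup E] [InnerProductSpace ℂ E] (T : E →ₗ.[ℂ] E) : Prop :=
  ∀ x : T.domain, 0 ≤ (⟪(x : E), T x⟫_ℂ).re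

/-! ### Resolvents -/

/-- The bounded operator `R` is the two-sided inverse of `T - z : D(T) → E`. -/
def IsResolvent {E : Type*} [NormedAddCommGroup E] [NormedSpace ℂ E] (T : E →ₗ.[ℂ] E) (z : ℂ)
    (R : E →L[ℂ] E) : Prop :=
  (∀ x : E, ∃ hx : R x ∈ T.domain, T ⟨R x, hx⟩ - z • R x = x) ∧
    ∀ y : T.domain, R (T y - z • (y : E)) = y

open scoped Classical in
/-- The resolvent `(T - z)⁻¹` as a bounded operator (`0` if `z` is in the spectrum of `T`). -/
def res {E : Type*} [NormedAddCommGroup E] [NormedSpace ℂ E] (T : E →ₗ.[ℂ] E) (z : ℂ) :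
    E →L[ℂ] E :=
  if h : ∃ R, IsResolvent T z R then h.choose else 0

theorem IsResolvent.res_eq {E : Type*} [NormedAddCommGroup E] [NormedSpace ℂ E]
    {T : E →ₗ.[ℂ] E} {z : ℂ} {R : E →L[ℂ] E} (hR : IsResolvent T z R) : res T z = R := by
  have h : ∃ R, IsResolvent T z R := ⟨R, hR⟩
  have h' : IsResolvent T z (res T z) := by
    unfold res
    rw [dif_pos h]
    exact h.choose_spec
  ext x
  obtain ⟨hx, e⟩ := hR.1 x
  have := h'.2 ⟨R x, hx⟩
  change res T z (T ⟨R x, hx⟩ - z • R x) = R x at this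
  rwa [e] at this

/-- Criterion for `res T z` to be the genuine inverse of `T - z`. -/
theorem isResolvent_res {E : Type*} [NormedAddCommGroup E] [InnerProductSpace ℂ E] [CompleteSpace E]
    {T : E →ₗ.[ℂ] E} (hT : IsSelfAdjoint T) {z : ℂ} {c : ℝ} (hc : 0 < c)
    (h : ∀ y : T.domain, c * ‖(y : E)‖ ≤ ‖T y - z • (y : E)‖)
    (h' : ∀ y : T.domain, T y = starRingEnd ℂ z • (y : E) → y = 0) :
    IsResolvent T z (res T z) := by
  have hd := hT.dense_domain
  have hcl := hT.isClosed
  have hadj : T† = T := hT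
  let S : T.domain →ₗ[ℂ] E := T.toFun - z • T.domain.subtype
  have hS : ∀ y, S y = T y - z • (y : E) := fun y => rfl
  have hSinj : ∀ y, S y = 0 → y = 0 := by
    intro y hy
    have := h y
    rw [← hS, hy, norm_zero] at this
    have : ‖(y:E)‖ ≤ 0 := by nlinarith [norm_nonneg (y:E)]
    simpa using this
  have hcr : IsClosed (LinearMap.range S : Set E) := by
    rw [← isSeqClosed_iff_isClosed]
    intro u x hu hux
    choose w hw using hu
    have hcau : CauchySeq (fun n => (w n : E)) := by
      have hcu := hux.cauchySeq
      rw [Metric.cauchySeq_iff] at hcu ⊢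
      intro ε hε
      obtain ⟨N, hN⟩ := hcu (c * ε) (by positivity)
      refine ⟨N, fun m hm n hn => ?_⟩
      have h1 := hN m hm n hn
      have h2 := h (w m - w n)
      rw [← hS, map_sub, hw, hw, ← dist_eq_norm] at h2
      have h3 : ‖((w m - w n : T.domain) : E)‖ = dist (w m : E) (w n) := by
        rw [dist_eq_norm]; rfl
      rw [h3] at h2
      nlinarith
    obtain ⟨y, hy⟩ := cauchySeq_tendsto_of_complete hcau
    have hTw : Filter.Tendsto (fun n => T (w n)) Filter.atTop (nhds (x + z • y)) := by
      have := hux.add (hy.const_smul z)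
      refine this.congr fun n => ?_
      rw [← hw n, hS]; simp
    have hg : (y, x + z • y) ∈ T.graph := by
      have := hcl.mem_of_tendsto (hy.prodMk_nhds hTw)
        (Filter.Eventually.of_forall fun n => T.mem_graph (w n))
      exact this
    rw [LinearPMap.mem_graph_iff] at hg
    obtain ⟨y', h1, h2⟩ := hg
    refine ⟨y', ?_⟩
    rw [hS, h2]
    simp only at h1
    rw [h1]; simp
  have hperp : (LinearMap.range S)ᗮ = ⊥ := by
    rw [Submodule.eq_bot_iff]
    intro y hy
    have key : ∀ x : T.domain, ⟪starRingEnd ℂ z • y, (x:E)⟫_ℂ = ⟪y, T x⟫_ℂ := by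
      intro x
      have := (Submodule.mem_orthogonal' _ _).1 hy (S x) ⟨x, rfl⟩
      rw [hS, inner_sub_right, inner_smul_right, sub_eq_zero] at this
      rw [inner_smul_left, this]; simp
    have hm : y ∈ T†.domain := LinearPMap.mem_adjoint_domain_of_exists y ⟨_, key⟩
    have hv := LinearPMap.adjoint_apply_eq hd ⟨y, hm⟩ key
    have hg : (y, starRingEnd ℂ z • y) ∈ T†.graph := by
      rw [← hv]; exact T†.mem_graph ⟨y, hm⟩
    rw [hadj, LinearPMap.mem_graph_iff] at hg
    obtain ⟨y', h1, h2⟩ := hg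
    simp only at h1 h2
    rw [← h1] at h2 ⊢
    rw [h' y' h2]; rfl
  have hr : LinearMap.range S = ⊤ := by
    have : CompleteSpace (LinearMap.range S) := hcr.completeSpace_coe
    exact (Submodule.orthogonal_eq_bot_iff).1 hperp
  let e : T.domain ≃ₗ[ℂ] E := LinearEquiv.ofBijective S
    ⟨(injective_iff_map_eq_zero S).2 hSinj, LinearMap.range_eq_top.1 hr⟩
  have he : ∀ y, e y = T y - z • (y : E) := fun y => rfl
  let R : E →L[ℂ] E := LinearMap.mkContinuous (T.domain.subtype ∘ₗ e.symm.toLinearMap) c⁻¹ (by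
    intro x
    have := h (e.symm x)
    rw [← he, e.apply_symm_apply] at this
    rw [inv_mul_eq_div, le_div_iff₀ hc, mul_comm]
    exact this)
  have hR : IsResolvent T z R := by
    refine ⟨fun x => ⟨(e.symm x).2, ?_⟩, fun y => ?_⟩
    · exact (he (e.symm x)).symm.trans (e.apply_symm_apply x)
    · change ((e.symm (T y - z • (y : E)) : T.domain) : E) = y
      rw [← he, e.symm_apply_apply]
  rw [hR.res_eq]; exact hR

/-- For self-adjoint `T` and `Im z ≠ 0`, `res T z` is the genuine inverse of `T - z`. -/
theorem isResolvent_res_of_im_ne_zero {E : Type*} [NormedAddCommGroup E] [InnerProductSpace ℂ E]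
    [CompleteSpace E] {T : E →ₗ.[ℂ] E} (hT : IsSelfAdjoint T) {z : ℂ} (hz : z.im ≠ 0) :
    IsResolvent T z (res T z) := by
  have hadj : T† = T := hT
  have key : ∀ y : T.domain, (⟪(y : E), T y⟫_ℂ).im = 0 := by
    intro y
    have h1 := LinearPMap.adjoint_isFormalAdjoint hT.dense_domain
    rw [hadj] at h1
    have h2 := h1 y y
    rw [← inner_conj_symm] at h2
    exact Complex.conj_eq_iff_im.1 h2
  have low : ∀ (w : ℂ) (y : T.domain), |w.im| * ‖(y : E)‖ ≤ ‖T y - w • (y : E)‖ := by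
    intro w y
    have h1 : |(⟪(y : E), T y - w • (y : E)⟫_ℂ).im| = |w.im| * ‖(y : E)‖ ^ 2 := by
      rw [inner_sub_right, inner_smul_right, inner_self_eq_norm_sq_to_K, Complex.sub_im, key]
      have : (w * ((‖(y : E)‖ : ℂ)) ^ 2).im = w.im * ‖(y : E)‖ ^ 2 := by
        rw [← Complex.ofReal_pow, Complex.im_mul_ofReal]
      rw [zero_sub, abs_neg]
      exact (congrArg abs this).trans (by rw [abs_mul, abs_of_nonneg (sq_nonneg ‖(y : E)‖)])
    have h2 := (Complex.abs_im_le_norm _).trans (norm_inner_le_norm (𝕜 := ℂ) (y : E)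
      (T y - w • (y : E)))
    rw [h1] at h2
    rcases (norm_nonneg (y : E)).eq_or_lt with h0 | h0
    · rw [← h0, mul_zero]
      exact norm_nonneg _
    · exact le_of_mul_le_mul_left (by nlinarith) h0
  refine isResolvent_res hT (abs_pos.2 hz) (low z) fun y hy => ?_
  have := low (starRingEnd ℂ z) y
  rw [hy, sub_self, norm_zero, Complex.conj_im, abs_neg] at this
  have h3 : ‖(y : E)‖ ≤ 0 := by nlinarith [abs_pos.2 hz, norm_nonneg (y : E)]
  exact Subtype.ext (norm_le_zero_iff.1 h3)

/-- For self-adjoint `T ≥ 0`, `res T (-1)` is the genuine inverse of `T + 1`. -/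
theorem isResolvent_res_neg_one {E : Type*} [NormedAddCommGroup E] [InnerProductSpace ℂ E]
    [CompleteSpace E] {T : E →ₗ.[ℂ] E} (hT : IsSelfAdjoint T) (hpos : IsNonneg T) :
    IsResolvent T (-1) (res T (-1)) := by
  have low : ∀ y : T.domain, 1 * ‖(y : E)‖ ≤ ‖T y - (-1 : ℂ) • (y : E)‖ := by
    intro y
    have h1 : (⟪(y : E), T y - (-1 : ℂ) • (y : E)⟫_ℂ).re =
        (⟪(y : E), T y⟫_ℂ).re + ‖(y : E)‖ ^ 2 := by
      rw [neg_one_smul, sub_neg_eq_add, inner_add_right, Complex.add_re]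
      congr 1
      exact inner_self_eq_norm_sq (𝕜 := ℂ) (y : E)
    have h2 := (Complex.re_le_norm _).trans (norm_inner_le_norm (𝕜 := ℂ) (y : E)
      (T y - (-1 : ℂ) • (y : E)))
    rw [h1] at h2
    have h3 := hpos y
    rcases (norm_nonneg (y : E)).eq_or_lt with h0 | h0
    · rw [← h0, mul_zero]
      exact norm_nonneg _
    · exact le_of_mul_le_mul_left (by nlinarith) h0
  refine isResolvent_res hT one_pos low fun y hy => ?_
  have := low y
  have hc : starRingEnd ℂ (-1 : ℂ) = -1 := by simp
  rw [hy, hc, sub_self, norm_zero] at this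
  exact Subtype.ext (norm_le_zero_iff.1 (by linarith))

/-- `Im R(z) = (2i)⁻¹ (R(z) - R(z̄))`. -/
def imRes {E : Type*} [NormedAddCommGroup E] [NormedSpace ℂ E] (T : E →ₗ.[ℂ] E) (z : ℂ) :
    E →L[ℂ] E :=
  (2 * Complex.I)⁻¹ • (res T z - res T (starRingEnd ℂ z))

/-! ### Smooth and supersmooth operators -/

/-- `A` is `H`-smooth with constant `a`. -/
structure IsSmooth {E F : Type*}
    [NormedAddCommGroup E] [InnerProductSpace ℂ E] [CompleteSpace E]
    [NormedAddCommGroup F] [InnerProductSpace ℂ F] [CompleteSpace F]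
    (H : E →ₗ.[ℂ] E) (A : E →ₗ.[ℂ] F) (a : ℝ) : Prop where
  closed : A.IsClosed
  dense : Dense (A.domain : Set E)
  bound : ∃ ε₀ : ℝ, 0 < ε₀ ∧ ∀ ε l : ℝ, 0 < |ε| → |ε| < ε₀ → ∀ v : A†.domain,
    ‖⟪A† v, imRes H (l + ε * Complex.I) (A† v)⟫_ℂ‖ ≤ a * ‖(v : F)‖ ^ 2

/-- `A` is `H`-supersmooth with constant `a`. -/
structure IsSupersmooth {E F : Type*}
    [NormedAddCommGroup E] [InnerProductSpace ℂ E] [CompleteSpace E]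
    [NormedAddCommGroup F] [InnerProductSpace ℂ F] [CompleteSpace F]
    (H : E →ₗ.[ℂ] E) (A : E →ₗ.[ℂ] F) (a : ℝ) : Prop where
  closed : A.IsClosed
  dense : Dense (A.domain : Set E)
  bound : ∃ ε₀ : ℝ, 0 < ε₀ ∧ ∀ ε l : ℝ, 0 < |ε| → |ε| < ε₀ → ∀ v : A†.domain,
    ‖⟪A† v, res H (l + ε * Complex.I) (A† v)⟫_ℂ‖ ≤ a * ‖(v : F)‖ ^ 2

/-! ### Functional calculus of an injective nonnegative self-adjoint operator

For `T` self-adjoint, nonnegative and injective let `Q = (T + 1)⁻¹`, a bounded self-adjoint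
operator with spectrum in `[0, 1]`. A function `φ` on `(0, ∞)` is expressed through `Q` by the
substitution `μ = (1 - x) / x`. The regularizer `x (1 - x)` (that is, `μ / (1 + μ)²`) gives the
injective bounded operator `Q (1 - Q)`. If `φ` is continuous on `(0, ∞)` and
`μ / (1 + μ)² * φ μ` tends to `0` at `0` and at `∞`, then `x (1 - x) φ ((1 - x) / x)` is
continuous on `[0, 1]`, and
`φ(T) = (Q (1 - Q))⁻¹ (x (1 - x) φ ((1 - x) / x))(Q)`
with its natural domain. This is the closed operator `∫ φ(μ) dE(μ)` of the spectral theorem, with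
domain `{f | ∫ |φ(μ)|² d(E(μ)f, f) < ∞}`, since multiplication by `μ / (1 + μ)²` is injective.
The functions used below, `μ ^ s` with `|s| < 1` and `exp (-i t √μ)`, are of this kind. -/

/-- `φ(T)` for `T` self-adjoint, nonnegative and injective. -/
def funCalc {E : Type*} [NormedAddCommGroup E] [InnerProductSpace ℂ E] [CompleteSpace E]
    (T : E →ₗ.[ℂ] E) (φ : ℝ → ℂ) : E →ₗ.[ℂ] E :=
  ((((res T (-1) * (1 - res T (-1)) : E →L[ℂ] E) : E →ₗ[ℂ] E).toPMap ⊤).inverse) ∘ₚ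
    ((cfc (fun z : ℂ => (z.re : ℂ) * (1 - z.re) * φ ((1 - z.re) / z.re)) (res T (-1)) :
      E →L[ℂ] E) : E →ₗ[ℂ] E).toPMap ⊤

/-- For `T ≥ 0` self-adjoint and injective, `g = φ(T) f` means
`Q (1 - Q) g = (x (1 - x) φ ((1 - x) / x))(Q) f`. -/
theorem mem_funCalc_graph {E : Type*} [NormedAddCommGroup E] [InnerProductSpace ℂ E]
    [CompleteSpace E] {T : E →ₗ.[ℂ] E} (hT : IsSelfAdjoint T) (hpos : IsNonneg T)
    (hinj : Function.Injective T) (φ : ℝ → ℂ) (f g : E) :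
    (f, g) ∈ (funCalc T φ).graph ↔
      (res T (-1) * (1 - res T (-1))) g =
        cfc (fun z : ℂ => (z.re : ℂ) * (1 - z.re) * φ ((1 - z.re) / z.re)) (res T (-1)) f := by
  have hQ := isResolvent_res_neg_one hT hpos
  unfold funCalc
  generalize hQd : res T (-1) = Q at hQ ⊢
  generalize cfc (fun z : ℂ => (z.re : ℂ) * (1 - z.re) * φ ((1 - z.re) / z.re)) Q = P
  generalize hM : Q * (1 - Q) = M
  have hQ0 : ∀ x, Q x = 0 → x = 0 := by
    intro x hx
    obtain ⟨h, e⟩ := hQ.1 x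
    have h0 : (⟨Q x, h⟩ : T.domain) = 0 := Subtype.ext hx
    rw [h0, T.map_zero, hx] at e
    simpa using e.symm
  have hQ1 : ∀ x, x - Q x = 0 → x = 0 := by
    intro x hx
    obtain ⟨h, e⟩ := hQ.1 x
    rw [neg_one_smul, sub_neg_eq_add] at e
    have h1 : T ⟨Q x, h⟩ = T 0 := by
      rw [T.map_zero, ← hx]
      exact eq_sub_of_add_eq e
    exact hQ0 x (congrArg Subtype.val (hinj h1))
  have hker : LinearMap.ker ((M : E →ₗ[ℂ] E).toPMap ⊤).toFun = ⊥ := by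
    rw [LinearMap.ker_eq_bot']
    rintro ⟨y, hy⟩ h
    have h : M y = 0 := h
    rw [← hM] at h
    exact Subtype.ext (hQ1 y (hQ0 _ h))
  have hinv : ∀ w x : E, (w, x) ∈ (((M : E →ₗ[ℂ] E).toPMap ⊤).inverse).graph ↔ M x = w := by
    intro w x
    rw [LinearPMap.inverse_graph hker, Submodule.mem_map]
    constructor
    · rintro ⟨⟨p, q⟩, hpq, e⟩
      rw [LinearPMap.mem_graph_iff] at hpq
      obtain ⟨y, h1, h2⟩ := hpq
      simp only at h1 h2
      obtain ⟨rfl, rfl⟩ : q = w ∧ p = x := by simpa using e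
      rw [← h1, ← h2]
      rfl
    · rintro rfl
      exact ⟨(x, M x), ((M : E →ₗ[ℂ] E).toPMap ⊤).mem_graph ⟨x, trivial⟩, rfl⟩
  rw [LinearPMap.mem_graph_iff]
  constructor
  · rintro ⟨y, h1, h2⟩
    simp only at h1 h2
    obtain ⟨hy, hd⟩ := (mem_pcomp_domain _ _ _).1 y.2
    rw [pcomp_apply _ _ y hy hd] at h2
    have h3 := LinearPMap.mem_graph (((M : E →ₗ[ℂ] E).toPMap ⊤).inverse) ⟨_, hd⟩
    rw [h2] at h3
    rw [(hinv _ _).1 h3, ← h1]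
    rfl
  · intro h
    obtain ⟨w, h1, h2⟩ := (LinearPMap.mem_graph_iff _).1 ((hinv _ _).2 h)
    simp only at h1 h2
    have hf : f ∈ ((P : E →ₗ[ℂ] E).toPMap ⊤).domain := trivial
    have hd : ((P : E →ₗ[ℂ] E).toPMap ⊤) ⟨f, hf⟩ ∈
        (((M : E →ₗ[ℂ] E).toPMap ⊤).inverse).domain := by
      have := w.2
      rw [h1] at this
      exact this
    refine ⟨⟨f, (mem_pcomp_domain _ _ _).2 ⟨hf, hd⟩⟩, rfl, ?_⟩
    rw [pcomp_apply _ _ _ hf hd]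
    exact (congrArg _ (Subtype.ext h1.symm)).trans h2

/-- The power `T ^ s`, for `|s| < 1`. -/
def fracPow {E : Type*} [NormedAddCommGroup E] [InnerProductSpace ℂ E] [CompleteSpace E]
    (T : E →ₗ.[ℂ] E) (s : ℝ) : E →ₗ.[ℂ] E :=
  funCalc T (fun μ => ((μ ^ s : ℝ) : ℂ))

/-- The flow `exp (-i t √T)`. -/
def sqrtFlow {E : Type*} [NormedAddCommGroup E] [InnerProductSpace ℂ E] [CompleteSpace E]
    (T : E →ₗ.[ℂ] E) (t : ℝ) : E →ₗ.[ℂ] E :=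
  funCalc T (fun μ => Complex.exp (-Complex.I * t * √μ))

/-! ### Step functions -/

/-- A step function: measurable, with finitely many values and bounded support. -/
structure IsStep {F : Type*} [NormedAddCommGroup F] (h : ℝ → F) : Prop where
  measurable : StronglyMeasurable h
  finite_range : (Set.range h).Finite
  bounded_support : Bornology.IsBounded (Function.support h)

end KatoSmoothing

end

/-! Write `T = H + ν`, and let `m` be the spectral measure of `A† u` for `T` in the variable `s =
√μ`. Both hypotheses concern `m` alone. With `M = a ‖u‖²`, smoothness says that the Poisson
integrals `∫ ε / ((s² - l)² + ε²) dm` are at most `M`; supersmoothness says that the Cauchy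
transform `∫ (s² - ζ)⁻¹ dm` is at most `M` in modulus for small `|Im ζ|`, and then, by
Phragmén–Lindelöf, for all `ζ` off the half-line `[0, ∞)`.

By Stieltjes inversion the Poisson bound means that `m` has density at most `M / π` with respect to
`dμ`, that is `m ≤ (2 M / π) s ds` (`le_withDensity_of_poisson`). The vector `T^{-1/4} A† u` has
spectral measure `s⁻¹ dm ≤ (2 M / π) ds`, so its Poisson integrals in `s` are at most `2 M`. This is
smoothness with respect to `√T`, with constant `2 a`. For supersmoothness the kernel is `1 / (s (s -
z))`. If `Re z ≤ 0`, it is dominated by a resolvent kernel of `T` at a negative point plus a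
half-line Poisson kernel, each contributing at most `M`. If `Re z > 0`, the identity `1 / (s (s -
z)) = 2 / (s² - z²) - 1 / (s (s + z))` reduces it to the previous case. The resulting constant is `6
a`, and `6 ≤ π + 3`.

The smoothness conditions quantify over the domain of `(A T^{-1/4})†`, which may be larger than that
of `A†`. Approximating `v` by `u n ∈ D(A†)` gives convergence of `T^{-1/4} A† u n` only after the
resolvent of `√T` is applied (`exists_tendsto_resolvent`). This suffices for the imaginary part,
which is `Im z ‖R(z) w‖²`. For the full resolvent form a cutoff `N (T + N)⁻¹` is inserted and
removed at the end.

The time-dependent statements follow from Plancherel. The resolvent of `√T` is the Laplace transform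
of `exp (-i τ √T)`, so the form `∫_{τ > 0} ∫ ⟪g t, exp (-i τ √T) f (t - τ)⟫`, damped by `exp (-ε
τ)`, is an integral over frequency of resolvent forms, to which the bounds above apply uniformly in
`ε`. The diagonal form bounds `∫ exp (i t √T) T^{-1/4} A† h(t) dt`, and the homogeneous estimate is
its dual. The off-diagonal form, after polarization, is dual to the inhomogeneous estimate.

Functions of `T` are handled through the bounded operator `Q = (T + 1)⁻¹` and the substitution `q =
1 / (1 + s²)`; unbounded relations are compared after applying the injective operator `Q (1 - Q)`.
-/

noncomputable section

namespace KatoSmoothing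

set_option linter.unusedSectionVars false

section

variable {E : Type*} [NormedAddCommGroup E] [InnerProductSpace ℂ E] [CompleteSpace E]

/-! ### Functional calculus on the unit interval -/

/-- Injectivity of `Q` and `1 - Q` for a self-adjoint `Q` with spectrum in `[0, 1]`. -/
structure IsRegularizer (Q : E →L[ℂ] E) : Prop where
  selfAdjoint : IsSelfAdjoint Q
  spec : ∀ z ∈ spectrum ℂ Q, ∃ q ∈ Set.Icc (0 : ℝ) 1, z = (q : ℂ)
  inj_zero : ∀ x, Q x = 0 → x = 0
  inj_one : ∀ x, Q x = x → x = 0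

/-- The operator `f(Q)` for a function of a real variable. -/
def bc (Q : E →L[ℂ] E) (f : ℝ → ℂ) : E →L[ℂ] E := cfc (fun z : ℂ => f z.re) Q

/-- The function of `s > 0` given by substituting `q = 1 / (1 + s ^ 2)`. -/
def qs (s : ℝ) : ℝ := 1 / (1 + s ^ 2)

/-- The inverse substitution. -/
def invQs (q : ℝ) : ℝ := √((1 - q) / q)

theorem qs_mem (s : ℝ) : qs s ∈ Set.Icc (0 : ℝ) 1 := by
  unfold qs
  constructor
  · positivity
  · rw [div_le_one (by positivity)]; nlinarith [sq_nonneg s]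

theorem continuous_qs : Continuous qs := by
  unfold qs
  refine continuous_const.div (by fun_prop) fun s => by positivity

theorem measurable_invQs : Measurable invQs := by
  unfold invQs
  fun_prop

theorem qs_invQs {q : ℝ} (h0 : 0 < q) (h1 : q ≤ 1) : qs (invQs q) = q := by
  unfold qs invQs
  rw [Real.sq_sqrt (div_nonneg (by linarith) h0.le)]
  field_simp
  ring

theorem invQs_pos {q : ℝ} (h0 : 0 < q) (h1 : q < 1) : 0 < invQs q :=
  Real.sqrt_pos.2 (div_pos (by linarith) h0)

namespace IsRegularizer

variable {Q : E →L[ℂ] E} (hQ : IsRegularizer Q)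
include hQ

theorem normal : IsStarNormal Q := hQ.selfAdjoint.isStarNormal

theorem contOn {f : ℝ → ℂ} (hf : ContinuousOn f (Set.Icc 0 1)) :
    ContinuousOn (fun z : ℂ => f z.re) (spectrum ℂ Q) := by
  refine hf.comp Complex.continuous_re.continuousOn fun z hz => ?_
  obtain ⟨q, hq, rfl⟩ := hQ.spec z hz
  simpa using hq

theorem bc_congr {f g : ℝ → ℂ} (h : ∀ q ∈ Set.Icc (0 : ℝ) 1, f q = g q) : bc Q f = bc Q g := by
  refine cfc_congr fun z hz => ?_
  obtain ⟨q, hq, rfl⟩ := hQ.spec z hz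
  simpa using h q hq

theorem bc_mul {f g : ℝ → ℂ} (hf : ContinuousOn f (Set.Icc 0 1))
    (hg : ContinuousOn g (Set.Icc 0 1)) : bc Q (fun q => f q * g q) = bc Q f * bc Q g :=
  cfc_mul _ _ Q (hQ.contOn hf) (hQ.contOn hg)

theorem bc_add {f g : ℝ → ℂ} (hf : ContinuousOn f (Set.Icc 0 1))
    (hg : ContinuousOn g (Set.Icc 0 1)) : bc Q (fun q => f q + g q) = bc Q f + bc Q g :=
  cfc_add Q _ _ (hQ.contOn hf) (hQ.contOn hg)

theorem bc_sub {f g : ℝ → ℂ} (hf : ContinuousOn f (Set.Icc 0 1))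
    (hg : ContinuousOn g (Set.Icc 0 1)) : bc Q (fun q => f q - g q) = bc Q f - bc Q g :=
  cfc_sub _ _ Q (hQ.contOn hf) (hQ.contOn hg)

theorem bc_const_mul (c : ℂ) {f : ℝ → ℂ} (hf : ContinuousOn f (Set.Icc 0 1)) :
    bc Q (fun q => c * f q) = c • bc Q f :=
  cfc_const_mul c _ Q (hQ.contOn hf)

omit hQ in
theorem bc_star (f : ℝ → ℂ) : bc Q (fun q => starRingEnd ℂ (f q)) = star (bc Q f) :=
  cfc_star _ Q

theorem bc_one : bc Q (fun _ => 1) = 1 :=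
  cfc_const_one ℂ Q hQ.normal

theorem bc_id : bc Q (fun q => (q : ℂ)) = Q := by
  have : bc Q (fun q => (q : ℂ)) = cfc (fun z : ℂ => z) Q := by
    refine cfc_congr fun z hz => ?_
    obtain ⟨q, hq, rfl⟩ := hQ.spec z hz
    simp
  rw [this, cfc_id' ℂ Q hQ.normal]

theorem bc_mul_apply {f g : ℝ → ℂ} (hf : ContinuousOn f (Set.Icc 0 1))
    (hg : ContinuousOn g (Set.Icc 0 1)) (x : E) :
    bc Q f (bc Q g x) = bc Q (fun q => f q * g q) x := by
  rw [hQ.bc_mul hf hg]; rfl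

omit hQ in
theorem inner_bc_left (f : ℝ → ℂ) (x y : E) :
    ⟪bc Q f x, y⟫_ℂ = ⟪x, bc Q (fun q => starRingEnd ℂ (f q)) y⟫_ℂ := by
  rw [bc_star, ContinuousLinearMap.star_eq_adjoint, ContinuousLinearMap.adjoint_inner_right]

theorem inner_bc_bc {f g : ℝ → ℂ} (hf : ContinuousOn f (Set.Icc 0 1))
    (hg : ContinuousOn g (Set.Icc 0 1)) (x : E) :
    ⟪bc Q f x, bc Q g x⟫_ℂ = ⟪x, bc Q (fun q => starRingEnd ℂ (f q) * g q) x⟫_ℂ := by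
  have hf' : ContinuousOn (fun q => starRingEnd ℂ (f q)) (Set.Icc 0 1) :=
    Complex.continuous_conj.comp_continuousOn hf
  rw [inner_bc_left, hQ.bc_mul_apply hf' hg]

omit hQ in
theorem inner_bc_ofReal_im {f : ℝ → ℝ} (x : E) :
    (⟪x, bc Q (fun q => (f q : ℂ)) x⟫_ℂ).im = 0 := by
  have h := inner_bc_left (Q := Q) (fun q => (f q : ℂ)) x x
  simp only [Complex.conj_ofReal] at h
  rw [← inner_conj_symm] at h
  exact Complex.conj_eq_iff_im.1 h

/-- Here `f = |√f|²`, so the form equals `‖(√f)(Q) x‖²`. This is the positivity required by the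
Riesz–Markov–Kakutani theorem. -/
theorem inner_bc_nonneg {f : ℝ → ℝ} (hf : ContinuousOn f (Set.Icc 0 1))
    (h0 : ∀ q ∈ Set.Icc (0 : ℝ) 1, 0 ≤ f q) (x : E) :
    0 ≤ (⟪x, bc Q (fun q => (f q : ℂ)) x⟫_ℂ).re := by
  have hs : ContinuousOn (fun q => ((√(f q) : ℝ) : ℂ)) (Set.Icc 0 1) :=
    Complex.continuous_ofReal.comp_continuousOn hf.sqrt
  have : bc Q (fun q => (f q : ℂ)) = bc Q (fun q =>
      starRingEnd ℂ ((√(f q) : ℝ) : ℂ) * ((√(f q) : ℝ) : ℂ)) := by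
    refine hQ.bc_congr fun q hq => ?_
    rw [Complex.conj_ofReal, ← Complex.ofReal_mul, Real.mul_self_sqrt (h0 q hq)]
  rw [this, ← hQ.inner_bc_bc hs hs]
  exact inner_self_nonneg (𝕜 := ℂ)

open CompactlySupported in
/-- The measure of `x` in the variable `q`. -/
theorem exists_measure (x : E) : ∃ m : Measure ℝ, IsFiniteMeasure m ∧ m (Set.Icc 0 1)ᶜ = 0 ∧
    ∀ f : ℝ → ℂ, Continuous f → ⟪x, bc Q f x⟫_ℂ = ∫ q, f q ∂m := by
  have cR : ∀ f : C_c(ℝ, ℝ), ContinuousOn (fun q => ((f q : ℝ) : ℂ)) (Set.Icc 0 1) := fun f =>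
    (Complex.continuous_ofReal.comp f.continuous).continuousOn
  let Λ₀ : C_c(ℝ, ℝ) →ₗ[ℝ] ℝ :=
    { toFun := fun f => (⟪x, bc Q (fun q => (f q : ℂ)) x⟫_ℂ).re
      map_add' := by
        intro f g
        have : bc Q (fun q => (((f + g) q : ℝ) : ℂ)) =
            bc Q (fun q => (f q : ℂ)) + bc Q (fun q => (g q : ℂ)) := by
          rw [← hQ.bc_add (cR f) (cR g)]
          exact hQ.bc_congr fun q _ => by simp
        rw [this, _root_.add_apply, inner_add_right, Complex.add_re]
      map_smul' := by
        intro c f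
        have : bc Q (fun q => (((c • f) q : ℝ) : ℂ)) = (c : ℂ) • bc Q (fun q => (f q : ℂ)) := by
          rw [← hQ.bc_const_mul _ (cR f)]
          exact hQ.bc_congr fun q _ => by simp
        rw [this, _root_.smul_apply, inner_smul_right, Complex.re_ofReal_mul]
        rfl }
  let Λ : C_c(ℝ, ℝ) →ₚ[ℝ] ℝ := PositiveLinearMap.mk₀ Λ₀ fun f hf =>
    hQ.inner_bc_nonneg f.continuous.continuousOn (fun q _ => hf q) x
  have hΛ : ∀ f : C_c(ℝ, ℝ), ∫ q, f q ∂(RealRMK.rieszMeasure Λ) =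
      (⟪x, bc Q (fun q => (f q : ℂ)) x⟫_ℂ).re := fun f => RealRMK.integral_rieszMeasure Λ f
  set m := RealRMK.rieszMeasure Λ with hm
  -- A compact set off `[0, 1]` carries a bump function vanishing on `[0, 1]`. That function of `Q`
  -- is zero, so inner regularity leaves no mass outside.
  have hsupp : m (Set.Icc 0 1)ᶜ = 0 := by
    have ho : IsOpen (Set.Icc (0 : ℝ) 1)ᶜ := isClosed_Icc.isOpen_compl
    rw [ho.measure_eq_iSup_isCompact]
    simp only [ENNReal.iSup_eq_zero]
    intro k hk hkc
    obtain ⟨f, hf1, hf0, hfc, hf01⟩ := exists_continuous_one_zero_of_isCompact hkc isClosed_Icc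
      (Set.disjoint_left.2 fun y hy hy' => hk hy hy')
    let g : C_c(ℝ, ℝ) := ⟨f, hfc⟩
    have h1 := hΛ g
    have h2 : bc Q (fun q => ((g q : ℝ) : ℂ)) = bc Q (fun q => 0 * 1) := by
      refine hQ.bc_congr fun q hq => ?_
      have : f q = 0 := hf0 hq
      simp [g, this]
    rw [h2, hQ.bc_const_mul 0 continuousOn_const] at h1
    simp only [zero_smul, _root_.zero_apply, inner_zero_right, Complex.zero_re] at h1
    have h3 := RealRMK.rieszMeasure_le_of_eq_one (f := g) Λ (fun q => (hf01 q).1) hkc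
      (fun q hq => hf1 hq)
    rw [← RealRMK.integral_rieszMeasure, ← hm, h1] at h3
    simpa using h3
  have hfin : IsFiniteMeasure m := by
    constructor
    rw [← measure_add_measure_compl (measurableSet_Icc (a := (0 : ℝ)) (b := 1)), hsupp, add_zero]
    exact isCompact_Icc.measure_lt_top
  have hreal : ∀ f : ℝ → ℝ, Continuous f →
      ⟪x, bc Q (fun q => (f q : ℂ)) x⟫_ℂ = ((∫ q, f q ∂m : ℝ) : ℂ) := by
    intro f hf
    -- Multiplication by a cutoff equal to `1` on `[0, 1]` gives compact support and changes neither
    -- the operator nor the integral.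
    obtain ⟨b, hb1, -, hbc, -⟩ := exists_continuous_one_zero_of_isCompact
      (isCompact_Icc (a := (0 : ℝ)) (b := 1)) isClosed_empty (Set.disjoint_empty _)
    let g : C_c(ℝ, ℝ) := ⟨⟨fun q => b q * f q, b.continuous.mul hf⟩, hbc.mul_right⟩
    have hg : ∀ q, g q = b q * f q := fun q => rfl
    have e1 : ∫ q, g q ∂m = ∫ q, f q ∂m := by
      refine integral_congr_ae ?_
      have : ∀ᵐ q ∂m, q ∈ Set.Icc (0 : ℝ) 1 := by
        rw [ae_iff]; exact hsupp
      filter_upwards [this] with q hq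
      rw [hg, hb1 hq, Pi.one_apply, one_mul]
    have e2 : bc Q (fun q => (f q : ℂ)) = bc Q (fun q => ((g q : ℝ) : ℂ)) := by
      refine hQ.bc_congr fun q hq => ?_
      rw [hg, hb1 hq, Pi.one_apply, one_mul]
    apply Complex.ext
    · rw [e2, ← hΛ g, e1, Complex.ofReal_re]
    · rw [inner_bc_ofReal_im, Complex.ofReal_im]
  refine ⟨m, hfin, hsupp, fun f hf => ?_⟩
  have hre : Continuous fun q => (f q).re := Complex.continuous_re.comp hf
  have him : Continuous fun q => (f q).im := Complex.continuous_im.comp hf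
  have hbound : ∀ g : ℝ → ℝ, Continuous g → Integrable g m := by
    intro g hg
    have : m.restrict (Set.Icc 0 1) = m := by
      refine Measure.restrict_eq_self_of_ae_mem ?_
      rw [ae_iff]; exact hsupp
    rw [← this]
    exact hg.continuousOn.integrableOn_compact isCompact_Icc
  have hdec : bc Q f = bc Q (fun q => (((f q).re : ℝ) : ℂ)) +
      Complex.I • bc Q (fun q => (((f q).im : ℝ) : ℂ)) := by
    have c1 : ContinuousOn (fun q => (((f q).re : ℝ) : ℂ)) (Set.Icc 0 1) :=
      (Complex.continuous_ofReal.comp hre).continuousOn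
    have c2 : ContinuousOn (fun q => (((f q).im : ℝ) : ℂ)) (Set.Icc 0 1) :=
      (Complex.continuous_ofReal.comp him).continuousOn
    have c3 : ContinuousOn (fun q => Complex.I * (((f q).im : ℝ) : ℂ)) (Set.Icc 0 1) :=
      continuousOn_const.mul c2
    rw [← hQ.bc_const_mul _ c2, ← hQ.bc_add c1 c3]
    refine hQ.bc_congr fun q _ => ?_
    rw [mul_comm, Complex.re_add_im]
  rw [hdec, _root_.add_apply, _root_.smul_apply, inner_add_right,
    inner_smul_right, hreal _ hre, hreal _ him]
  have : ∫ q, f q ∂m = ∫ q, ((((f q).re : ℝ) : ℂ) + (((f q).im : ℝ) : ℂ) * Complex.I) ∂m := by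
    simp only [Complex.re_add_im]
  rw [this, integral_add (hbound _ hre).ofReal ((hbound _ him).ofReal.mul_const _),
    integral_mul_const, integral_complex_ofReal, integral_complex_ofReal, mul_comm Complex.I]

/-- The isometry `f ↦ f(Q) x` in the variable `q`. -/
theorem exists_isometry (x : E) : ∃ (m : Measure ℝ) (_ : IsFiniteMeasure m)
    (V : Lp ℂ 2 m →ₗᵢ[ℂ] E), m (Set.Icc 0 1)ᶜ = 0 ∧
    (∀ f : BoundedContinuousFunction ℝ ℂ,
      V (BoundedContinuousFunction.toLp 2 m ℂ f) = bc Q f x) := by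
  obtain ⟨m, hm, hsupp, hint⟩ := hQ.exists_measure x
  refine ⟨m, hm, ?_⟩
  let e : BoundedContinuousFunction ℝ ℂ →ₗ[ℂ] Lp ℂ 2 m :=
    (BoundedContinuousFunction.toLp 2 m ℂ).toLinearMap
  have hd : DenseRange e := BoundedContinuousFunction.toLp_denseRange ℂ m ℂ (by norm_num)
  have cB : ∀ f : BoundedContinuousFunction ℝ ℂ, ContinuousOn (fun q => f q) (Set.Icc 0 1) :=
    fun f => f.continuous.continuousOn
  let F : BoundedContinuousFunction ℝ ℂ →ₗ[ℂ] E :=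
    { toFun := fun f => bc Q f x
      map_add' := fun f g => by
        have := hQ.bc_add (cB f) (cB g)
        exact congrArg (fun T : E →L[ℂ] E => T x) this
      map_smul' := fun c f => by
        have := hQ.bc_const_mul c (cB f)
        exact congrArg (fun T : E →L[ℂ] E => T x) this }
  -- `‖f(Q) x‖² = ⟪x, |f|²(Q) x⟫ = ∫ |f|² dm`, so the map is isometric on a dense subspace of `L²`
  -- and extends.
  have hn : ∀ f, ‖F f‖ = ‖e f‖ := by
    intro f
    have h1 : ((‖F f‖ : ℝ) : ℂ) ^ 2 = ((‖e f‖ : ℝ) : ℂ) ^ 2 := by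
      have e1 : ⟪F f, F f⟫_ℂ = ((‖F f‖ : ℝ) : ℂ) ^ 2 := inner_self_eq_norm_sq_to_K (𝕜 := ℂ) (F f)
      have e2 : ⟪e f, e f⟫_ℂ = ((‖e f‖ : ℝ) : ℂ) ^ 2 := inner_self_eq_norm_sq_to_K (𝕜 := ℂ) (e f)
      rw [← e1, ← e2, L2.inner_def]
      refine (hQ.inner_bc_bc (cB f) (cB f) x).trans ?_
      have hc : Continuous fun q => starRingEnd ℂ (f q) * f q :=
        (Complex.continuous_conj.comp f.continuous).mul f.continuous
      rw [hint _ hc]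
      refine integral_congr_ae ?_
      filter_upwards [BoundedContinuousFunction.coeFn_toLp (p := 2) (𝕜 := ℂ) m f] with q hq
      change _ = ⟪(BoundedContinuousFunction.toLp 2 m ℂ f) q, _⟫_ℂ
      rw [show (e f : ℝ → ℂ) q = f q from hq, hq, RCLike.inner_apply]
      exact mul_comm _ _
    have h2 : ‖F f‖ ^ 2 = ‖e f‖ ^ 2 := by exact_mod_cast h1
    exact (pow_left_inj₀ (norm_nonneg _) (norm_nonneg _) two_ne_zero).1 h2
  have hb : ∃ C : ℝ, ∀ f, ‖F f‖ ≤ C * ‖e f‖ := ⟨1, fun f => by rw [hn, one_mul]⟩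
  let V₀ : Lp ℂ 2 m →L[ℂ] E := F.extendOfNorm e
  have hV : ∀ f, V₀ (e f) = F f := LinearMap.extendOfNorm_eq hd hb
  have hVn : ∀ f, ‖V₀ f‖ = ‖f‖ := by
    intro f
    refine hd.induction_on f (isClosed_eq (by fun_prop) (by fun_prop)) fun g => ?_
    rw [hV, hn]
  exact ⟨⟨V₀.toLinearMap, hVn⟩, hsupp, fun f => hV f⟩

end IsRegularizer

/-- A realization of `f ↦ f(Q) x` on `L²(m)` in the variable `s > 0`, with `q = 1 / (1 + s ^ 2)`. -/
structure SpectralRep (Q : E →L[ℂ] E) (x : E) (m : Measure ℝ) (v : (ℝ → ℂ) → E) : Prop where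
  finite : IsFiniteMeasure m
  pos : ∀ᵐ s ∂m, 0 < s
  inner : ∀ f g, MemLp f 2 m → MemLp g 2 m → ⟪v f, v g⟫_ℂ = ∫ s, starRingEnd ℂ (f s) * g s ∂m
  sub : ∀ f g, MemLp f 2 m → MemLp g 2 m → v (fun s => f s - g s) = v f - v g
  bc : ∀ φ f, ContinuousOn φ (Set.Icc 0 1) → MemLp f 2 m →
    bc Q φ (v f) = v (fun s => φ (qs s) * f s)
  one : v (fun _ => 1) = x
  dual : ∀ y, ∃ g, MemLp g 2 m ∧ ∀ f, MemLp f 2 m → ⟪y, v f⟫_ℂ = ∫ s, starRingEnd ℂ (g s) * f s ∂m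

-- The rule that `φ(Q)` acts as multiplication by `φ` extends from bounded continuous functions to
-- `L²` by density. Injectivity of `Q` and `1 - Q` excludes atoms at `q = 0` and `q = 1`, so `q`
-- corresponds to `s > 0` almost everywhere and the measure can be pushed forward.
open scoped Classical in
theorem IsRegularizer.exists_spectralRep {Q : E →L[ℂ] E} (hQ : IsRegularizer Q) (x : E) :
    ∃ (m : Measure ℝ) (v : (ℝ → ℂ) → E), SpectralRep Q x m v := by
  obtain ⟨m, hm, V, hsupp, hV⟩ := hQ.exists_isometry x
  have hae : ∀ᵐ q ∂m, q ∈ Set.Icc (0 : ℝ) 1 := by rw [ae_iff]; exact hsupp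
  -- multiplication rule for continuous bounded functions
  have hmul : ∀ (φ : ℝ → ℂ), ContinuousOn φ (Set.Icc 0 1) → ∀ f g : Lp ℂ 2 m,
      (∀ᵐ q ∂m, g q = φ q * f q) → bc Q φ (V f) = V g := by
    intro φ hφ
    obtain ⟨b, hb⟩ : ∃ b : BoundedContinuousFunction ℝ ℂ, ∀ q ∈ Set.Icc (0 : ℝ) 1, b q = φ q := by
      have hc : Continuous (Set.IccExtend zero_le_one (Set.domRestrict (Set.Icc (0:ℝ) 1) φ)) :=
        (continuousOn_iff_continuous_domRestrict.1 hφ).Icc_extend'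
      obtain ⟨C, hC⟩ := isCompact_Icc.exists_bound_of_continuousOn hφ
      refine ⟨BoundedContinuousFunction.ofNormedAddCommGroup _ hc C fun q => ?_, fun q hq => ?_⟩
      · exact hC _ (Set.projIcc 0 1 zero_le_one q).2
      · exact Set.IccExtend_of_mem zero_le_one (Set.domRestrict (Set.Icc (0:ℝ) 1) φ) hq
    have hM : ∀ f : Lp ℂ 2 m, MemLp (fun q => b q * f q) 2 m := fun f =>
      (Lp.memLp f).mul' (r := 2) (p := ∞) (memLp_top_of_bound b.continuous.aestronglyMeasurable ‖b‖
        (Filter.Eventually.of_forall b.norm_coe_le_norm))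
    have key : ∀ f : Lp ℂ 2 m, bc Q φ (V f) = V ((hM f).toLp _) := by
      intro f
      have hlip : Continuous fun f : Lp ℂ 2 m => (hM f).toLp _ := by
        refine LipschitzWith.continuous (K := ‖b‖₊) (LipschitzWith.of_dist_le_mul fun f g => ?_)
        rw [dist_eq_norm, dist_eq_norm, ← MemLp.toLp_sub]
        refine Lp.norm_le_mul_norm_of_ae_le_mul ?_
        filter_upwards [MemLp.coeFn_toLp ((hM f).sub (hM g)), Lp.coeFn_sub f g] with q h1 h2
        rw [h1, h2]
        simp only [Pi.sub_apply, ← mul_sub, norm_mul]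
        exact mul_le_mul_of_nonneg_right (b.norm_coe_le_norm q) (norm_nonneg _)
      refine (BoundedContinuousFunction.toLp_denseRange ℂ m ℂ (p := 2) (by norm_num)).induction_on
        (p := fun f => bc Q φ (V f) = V ((hM f).toLp _)) f
        (isClosed_eq (by fun_prop) (V.continuous.comp hlip)) fun g => ?_
      rw [hV, hQ.bc_mul_apply hφ g.continuous.continuousOn]
      have : bc Q (fun q => φ q * g q) = bc Q (b * g : BoundedContinuousFunction ℝ ℂ) :=
        hQ.bc_congr fun q hq => by simp [hb q hq]
      rw [this, ← hV]
      congr 1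
      refine Lp.ext ?_
      filter_upwards [MemLp.coeFn_toLp (hM (BoundedContinuousFunction.toLp 2 m ℂ g)),
        BoundedContinuousFunction.coeFn_toLp (p := 2) (𝕜 := ℂ) m g,
        BoundedContinuousFunction.coeFn_toLp (p := 2) (𝕜 := ℂ) m (b * g)] with q h1 h2 h3
      rw [h1, h2, h3]; rfl
    intro f g hfg
    rw [key]
    congr 1
    refine Lp.ext ?_
    filter_upwards [MemLp.coeFn_toLp (hM f), hfg, hae] with q h1 h2 h3
    rw [h1, h2, hb q h3]
  -- The indicator of `{c}` is annihilated by `q - c`, so its image under the isometry lies in the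
  -- kernel of `Q - c`.
  have hatom : ∀ c : ℝ, (∀ y, bc Q (fun q => (q : ℂ) - c) y = 0 → y = 0) → m {c} = 0 := by
    intro c hc
    have hi : MemLp (Set.indicator {c} fun _ => (1 : ℂ)) 2 m :=
      memLp_indicator_const 2 (measurableSet_singleton c) 1 (Or.inr (measure_ne_top m _))
    have h1 : bc Q (fun q => (q : ℂ) - c) (V (hi.toLp _)) = V 0 := by
      refine hmul _ (by fun_prop) _ _ ?_
      filter_upwards [Lp.coeFn_zero ℂ 2 m, hi.coeFn_toLp] with q h1 h2
      rw [h1, h2]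
      by_cases h : q = c
      · simp [h]
      · simp [h]
    rw [map_zero] at h1
    have h2 := hc _ h1
    have h3 : hi.toLp _ = 0 := by
      rw [← norm_eq_zero, ← V.norm_map, h2, norm_zero]
    rw [← MemLp.toLp_zero (MemLp.zero' (ε := ℂ) (p := 2) (μ := m)), MemLp.toLp_eq_toLp_iff] at h3
    by_contra hne
    have : ∀ᵐ q ∂m, q ∉ ({c} : Set ℝ) := by
      filter_upwards [h3] with q hq hqc
      rw [Set.indicator_of_mem hqc] at hq
      exact one_ne_zero hq
    rw [ae_iff] at this
    simp only [not_not] at this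
    exact hne this
  have hm0 : m {0} = 0 := hatom 0 fun y hy => by
    refine hQ.inj_zero y ?_
    have : bc Q (fun q => (q : ℂ) - ((0:ℝ):ℂ)) = Q := by
      simp only [Complex.ofReal_zero, sub_zero]
      exact hQ.bc_id
    rwa [this] at hy
  have hm1 : m {1} = 0 := hatom 1 fun y hy => by
    refine hQ.inj_one y ?_
    have : bc Q (fun q => (q : ℂ) - ((1:ℝ):ℂ)) = Q - 1 := by
      have := hQ.bc_sub (f := fun q => (q : ℂ)) (g := fun _ => 1) (by fun_prop) (by fun_prop)
      rw [hQ.bc_id, hQ.bc_one] at this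
      simpa using this
    rw [this] at hy
    exact sub_eq_zero.1 hy
  have hoo : ∀ᵐ q ∂m, q ∈ Set.Ioo (0 : ℝ) 1 := by
    filter_upwards [hae, measure_eq_zero_iff_ae_notMem.1 hm0,
      measure_eq_zero_iff_ae_notMem.1 hm1] with q h h0 h1
    exact ⟨lt_of_le_of_ne h.1 fun e => h0 e.symm, lt_of_le_of_ne h.2 h1⟩
  have hsm : AEMeasurable invQs m := measurable_invQs.aemeasurable
  have hcomp : ∀ {f : ℝ → ℂ}, MemLp f 2 (m.map invQs) → MemLp (f ∘ invQs) 2 m := fun hf =>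
    (memLp_map_measure_iff hf.1 hsm).1 hf
  -- The default value `0` off `L²` is never used.
  let v : (ℝ → ℂ) → E := fun f => if h : MemLp f 2 (m.map invQs) then V ((hcomp h).toLp _) else 0
  have hv : ∀ f, ∀ h : MemLp f 2 (m.map invQs), v f = V ((hcomp h).toLp _) := fun f h => dif_pos h
  have hqsm : Measurable qs := continuous_qs.measurable
  refine ⟨m.map invQs, v, ⟨?_, ?_, ?_, ?_, ?_, ?_, ?_⟩⟩
  · exact Measure.isFiniteMeasure_map m invQs
  · rw [ae_map_iff hsm measurableSet_Ioi]
    filter_upwards [hoo] with q hq using invQs_pos hq.1 hq.2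
  · intro f g hf hg
    have hfg : AEStronglyMeasurable (fun s => starRingEnd ℂ (f s) * g s) (m.map invQs) :=
      (Complex.continuous_conj.comp_aestronglyMeasurable hf.1).mul hg.1
    rw [hv f hf, hv g hg, V.inner_map_map, L2.inner_def, integral_map hsm hfg]
    refine integral_congr_ae ?_
    filter_upwards [(hcomp hf).coeFn_toLp, (hcomp hg).coeFn_toLp] with q h1 h2
    rw [h1, h2]
    simp [mul_comm]
  · intro f g hf hg
    have hfg : MemLp (fun s => f s - g s) 2 (m.map invQs) := hf.sub hg
    rw [hv f hf, hv g hg, hv _ hfg, ← map_sub, ← MemLp.toLp_sub]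
    rfl
  · intro φ f hφ hf
    obtain ⟨C, hC⟩ := isCompact_Icc.exists_bound_of_continuousOn hφ
    have hφm : AEStronglyMeasurable (fun s => φ (qs s)) (m.map invQs) :=
      (hφ.comp_continuous continuous_qs qs_mem).aestronglyMeasurable
    have hφf : MemLp (fun s => φ (qs s) * f s) 2 (m.map invQs) :=
      hf.mul' (r := 2) (p := ∞) (memLp_top_of_bound hφm C
        (Filter.Eventually.of_forall fun s => hC _ (qs_mem s)))
    rw [hv f hf, hv _ hφf]
    refine hmul φ hφ _ _ ?_
    filter_upwards [(hcomp hf).coeFn_toLp, (hcomp hφf).coeFn_toLp, hoo] with q h1 h2 h3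
    rw [h1, h2, Function.comp_apply, Function.comp_apply, qs_invQs h3.1 h3.2.le]
  · have h1 : MemLp (fun _ : ℝ => (1 : ℂ)) 2 (m.map invQs) := memLp_const 1
    rw [hv _ h1]
    have := hV (BoundedContinuousFunction.const ℝ 1)
    have h2 : bc Q (BoundedContinuousFunction.const ℝ (1 : ℂ)) = 1 := hQ.bc_one
    rw [h2] at this
    refine Eq.trans ?_ this
    congr 1
  · intro y
    let g : Lp ℂ 2 m := ContinuousLinearMap.adjoint V.toContinuousLinearMap y
    obtain ⟨g', hg'm, hg'⟩ := (Lp.aestronglyMeasurable g)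
    have hgs' : (g' ∘ qs) ∘ invQs =ᵐ[m] g := by
      filter_upwards [hoo, hg'] with q hq h
      rw [Function.comp_apply, Function.comp_apply, qs_invQs hq.1 hq.2.le, h]
    have hgm : MemLp (g' ∘ qs) 2 (m.map invQs) := by
      rw [memLp_map_measure_iff (hg'm.comp_measurable hqsm).aestronglyMeasurable hsm]
      exact (memLp_congr_ae hgs').2 (Lp.memLp g)
    refine ⟨g' ∘ qs, hgm, fun f hf => ?_⟩
    rw [hv f hf]
    have : ⟪y, V ((hcomp hf).toLp _)⟫_ℂ = ⟪g, (hcomp hf).toLp _⟫_ℂ :=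
      (ContinuousLinearMap.adjoint_inner_left V.toContinuousLinearMap _ _).symm
    have hgf : AEStronglyMeasurable (fun s => starRingEnd ℂ ((g' ∘ qs) s) * f s) (m.map invQs) :=
      (Complex.continuous_conj.comp_aestronglyMeasurable hgm.1).mul hf.1
    rw [this, L2.inner_def, integral_map hsm hgf]
    refine integral_congr_ae ?_
    filter_upwards [(hcomp hf).coeFn_toLp, hgs'] with q h1 h2
    rw [Function.comp_apply] at h2
    rw [h1, h2]
    simp [mul_comm]

end

section

variable {E : Type*} [NormedAddCommGroup E] [InnerProductSpace ℂ E] [CompleteSpace E]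

/-! ### The regularizer `(T + 1)⁻¹` -/

/-- Since `x = Q x + T Q x`, the form `⟪Q x, x⟫` is `‖Q x‖² + ⟪Q x, T Q x⟫`, and `(1 - Q) x = T Q
x`; thus `T ≥ 0` makes both `Q` and `1 - Q` positive and puts the spectrum in `[0, 1]`. A fixed
vector of `Q` lies in the kernel of `T`. -/
theorem isRegularizer_res {T : E →ₗ.[ℂ] E} (hT : IsSelfAdjoint T) (hpos : IsNonneg T)
    (hinj : Function.Injective T) : IsRegularizer (res T (-1)) := by
  have hQ := isResolvent_res_neg_one hT hpos
  set Q := res T (-1) with hQd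
  have hadj : T† = T := hT
  have hform : ∀ x y : T.domain, ⟪T x, (y : E)⟫_ℂ = ⟪(x : E), T y⟫_ℂ := by
    intro x y
    have := LinearPMap.adjoint_isFormalAdjoint hT.dense_domain
    rw [hadj] at this
    exact this x y
  have hdom : ∀ x, Q x ∈ T.domain := fun x => (hQ.1 x).1
  have hTQ : ∀ x, T ⟨Q x, hdom x⟩ = x - Q x := by
    intro x
    obtain ⟨h, e⟩ := hQ.1 x
    rw [neg_one_smul, sub_neg_eq_add] at e
    exact eq_sub_of_add_eq e
  have hsym : ∀ x y, ⟪Q x, y⟫_ℂ = ⟪x, Q y⟫_ℂ := by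
    intro x y
    have := hform ⟨Q x, hdom x⟩ ⟨Q y, hdom y⟩
    rw [hTQ, hTQ, inner_sub_left, inner_sub_right] at this
    simpa using this.symm
  have hsa : IsSelfAdjoint Q := by
    rw [ContinuousLinearMap.isSelfAdjoint_iff_isSymmetric]
    exact hsym
  have hpQ : Q.IsPositive := by
    refine ⟨(ContinuousLinearMap.isSelfAdjoint_iff_isSymmetric).1 hsa, fun x => ?_⟩
    have h1 := hpos ⟨Q x, hdom x⟩
    rw [hTQ, inner_sub_right, Complex.sub_re] at h1
    have h2 : 0 ≤ (⟪Q x, Q x⟫_ℂ).re := inner_self_nonneg (𝕜 := ℂ)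
    have h3 : (⟪Q x, x⟫_ℂ).re = Q.reApplyInnerSelf x := rfl
    simp only at h1
    linarith
  have hp1 : (1 - Q).IsPositive := by
    refine ⟨(ContinuousLinearMap.isSelfAdjoint_iff_isSymmetric).1 ((IsSelfAdjoint.one _).sub hsa),
      fun x => ?_⟩
    have h1 := hpos ⟨Q x, hdom x⟩
    rw [hTQ] at h1
    have h2 : 0 ≤ (⟪x - Q x, x - Q x⟫_ℂ).re := inner_self_nonneg (𝕜 := ℂ)
    have h3 : (⟪x - Q x, x⟫_ℂ).re = (1 - Q).reApplyInnerSelf x := rfl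
    have h4 : (⟪x - Q x, x⟫_ℂ).re = (⟪x - Q x, x - Q x⟫_ℂ).re + (⟪Q x, x - Q x⟫_ℂ).re := by
      rw [← Complex.add_re]
      congr 1
      simp only [inner_sub_left, inner_sub_right, hsym, map_sub]
      ring
    simp only at h1
    linarith
  have h0 : 0 ≤ Q := (ContinuousLinearMap.nonneg_iff_isPositive Q).2 hpQ
  have h1 : 0 ≤ 1 - Q := (ContinuousLinearMap.nonneg_iff_isPositive _).2 hp1
  have hq0 : ∀ x, Q x = 0 → x = 0 := by
    intro x hx
    have h := hTQ x
    have h0 : (⟨Q x, hdom x⟩ : T.domain) = 0 := Subtype.ext hx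
    rw [h0, T.map_zero, hx, sub_zero] at h
    exact h.symm
  refine ⟨hsa, fun z hz => ?_, hq0, fun x hx => ?_⟩
  · have hzr := hsa.mem_spectrum_eq_re hz
    have hzr' : z.re ∈ spectrum ℝ Q := by
      rw [← spectrum.algebraMap_mem_iff ℂ]
      rw [hzr] at hz
      exact hz
    refine ⟨z.re, ⟨spectrum_nonneg_of_nonneg h0 hzr', ?_⟩, hzr⟩
    have : (1 - z.re : ℝ) ∈ spectrum ℝ (1 - Q) := by
      have h := Set.sub_mem_sub (Set.mem_singleton (1 : ℝ)) hzr'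
      rwa [spectrum.singleton_sub_eq, map_one] at h
    have := spectrum_nonneg_of_nonneg h1 this
    linarith
  · refine hq0 x ?_
    have h' : T ⟨Q x, hdom x⟩ = 0 := (hTQ x).trans (sub_eq_zero.2 hx.symm)
    rw [← T.map_zero] at h'
    exact congrArg Subtype.val (hinj h')

/-! ### Consequences of the spectral representation -/

namespace SpectralRep

variable {Q : E →L[ℂ] E} {x : E} {m : Measure ℝ} {v : (ℝ → ℂ) → E} (h : SpectralRep Q x m v)
include h

theorem norm_sq {f : ℝ → ℂ} (hf : MemLp f 2 m) : ‖v f‖ ^ 2 = ∫ s, ‖f s‖ ^ 2 ∂m := by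
  have h1 : ((‖v f‖ ^ 2 : ℝ) : ℂ) = ((∫ s, ‖f s‖ ^ 2 ∂m : ℝ) : ℂ) := by
    rw [← integral_complex_ofReal, Complex.ofReal_pow]
    have e1 : ⟪v f, v f⟫_ℂ = ((‖v f‖ : ℝ) : ℂ) ^ 2 := inner_self_eq_norm_sq_to_K (𝕜 := ℂ) (v f)
    rw [← e1, h.inner f f hf hf]
    refine integral_congr_ae (Filter.Eventually.of_forall fun s => ?_)
    simp only
    rw [Complex.ofReal_pow, Complex.conj_mul']
  exact_mod_cast h1

theorem norm_sub_sq {f g : ℝ → ℂ} (hf : MemLp f 2 m) (hg : MemLp g 2 m) :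
    ‖v f - v g‖ ^ 2 = ∫ s, ‖f s - g s‖ ^ 2 ∂m := by
  rw [← h.sub f g hf hg]
  exact h.norm_sq (hf.sub hg)

theorem congr {f g : ℝ → ℂ} (hf : MemLp f 2 m) (hfg : f =ᵐ[m] g) : v f = v g := by
  have hg : MemLp g 2 m := (memLp_congr_ae hfg).1 hf
  have := h.norm_sub_sq hf hg
  have h0 : ∫ s, ‖f s - g s‖ ^ 2 ∂m = 0 := by
    refine integral_eq_zero_of_ae ?_
    filter_upwards [hfg] with s hs
    simp [hs]
  rw [h0] at this
  exact sub_eq_zero.1 (norm_eq_zero.1 (pow_eq_zero_iff two_ne_zero |>.1 this))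

theorem congr_pos {f g : ℝ → ℂ} (hf : MemLp f 2 m) (hfg : ∀ s, 0 < s → f s = g s) : v f = v g := by
  refine h.congr hf ?_
  filter_upwards [h.pos] with s hs using hfg s hs

theorem memLp_bdd {f : ℝ → ℂ} (hf : AEStronglyMeasurable f m) {C : ℝ} (hC : ∀ s, ‖f s‖ ≤ C) :
    MemLp f 2 m := by
  have := h.finite
  exact MemLp.of_bound hf C (Filter.Eventually.of_forall hC)

omit h in
theorem bdd_of_contOn {φ : ℝ → ℂ} (hφ : ContinuousOn φ (Set.Icc 0 1)) :
    Continuous (fun s => φ (qs s)) ∧ ∃ C, ∀ s, ‖φ (qs s)‖ ≤ C := by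
  obtain ⟨C, hC⟩ := isCompact_Icc.exists_bound_of_continuousOn hφ
  exact ⟨hφ.comp_continuous continuous_qs qs_mem, C, fun s => hC _ (qs_mem s)⟩

theorem memLp_qs {φ : ℝ → ℂ} (hφ : ContinuousOn φ (Set.Icc 0 1)) :
    MemLp (fun s => φ (qs s)) 2 m := by
  obtain ⟨h1, C, hC⟩ := bdd_of_contOn hφ
  exact h.memLp_bdd h1.aestronglyMeasurable hC

omit [CompleteSpace E] h [InnerProductSpace ℂ E] [NormedAddCommGroup E] in
theorem memLp_qs_mul {φ f : ℝ → ℂ} (hφ : ContinuousOn φ (Set.Icc 0 1)) (hf : MemLp f 2 m) :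
    MemLp (fun s => φ (qs s) * f s) 2 m := by
  obtain ⟨h1, C, hC⟩ := bdd_of_contOn hφ
  exact hf.mul' (r := 2) (p := ∞) (memLp_top_of_bound h1.aestronglyMeasurable C
        (Filter.Eventually.of_forall hC))

theorem bc_self {φ : ℝ → ℂ} (hφ : ContinuousOn φ (Set.Icc 0 1)) :
    KatoSmoothing.bc Q φ x = v (fun s => φ (qs s)) := by
  have := h.finite
  have h1 := h.bc φ (fun _ => 1) hφ (memLp_const 1)
  rw [h.one] at h1
  rw [h1]
  simp only [mul_one]

theorem inner_self_bc {ψ : ℝ → ℂ} (hψ : ContinuousOn ψ (Set.Icc 0 1)) :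
    ⟪x, KatoSmoothing.bc Q ψ x⟫_ℂ = ∫ s, ψ (qs s) ∂m := by
  have := h.finite
  have h1 := h.inner (fun _ => 1) _ (memLp_const 1) (h.memLp_qs hψ)
  rw [h.one] at h1
  rw [h.bc_self hψ, h1]
  simp

/-- The norm of `v f` is an `L²` norm, so dominated convergence of symbols becomes norm convergence
of vectors. -/
theorem tendsto {ι : Type*} {l : Filter ι} [l.IsCountablyGenerated] {F : ι → ℝ → ℂ} {f : ℝ → ℂ}
    {G : ℝ → ℝ} (hF : ∀ i, MemLp (F i) 2 m) (hf : MemLp f 2 m) (hG : MemLp G 2 m)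
    (hb : ∀ i, ∀ s, 0 < s → ‖F i s - f s‖ ≤ G s)
    (hl : ∀ s, 0 < s → Filter.Tendsto (fun i => F i s) l (nhds (f s))) :
    Filter.Tendsto (fun i => v (F i)) l (nhds (v f)) := by
  rw [tendsto_iff_norm_sub_tendsto_zero]
  have h1 : Filter.Tendsto (fun i => ‖v (F i) - v f‖ ^ 2) l (nhds 0) := by
    simp_rw [fun i => h.norm_sub_sq (hF i) hf]
    rw [show (0 : ℝ) = ∫ s, (0 : ℝ) ∂m by simp]
    refine tendsto_integral_filter_of_dominated_convergence (fun s => G s ^ 2) ?_ ?_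
      hG.integrable_sq ?_
    · exact Filter.Eventually.of_forall fun i => ((hF i).1.sub hf.1).norm.pow 2
    · refine Filter.Eventually.of_forall fun i => ?_
      filter_upwards [h.pos] with s hs
      rw [Real.norm_of_nonneg (by positivity)]
      exact pow_le_pow_left₀ (norm_nonneg _) (hb i s hs) 2
    · filter_upwards [h.pos] with s hs
      have := (tendsto_iff_norm_sub_tendsto_zero.1 (hl s hs)).pow 2
      simpa using this
  have := h1.sqrt
  simpa [Real.sqrt_sq (norm_nonneg _)] using this

end SpectralRep

namespace IsRegularizer

variable {Q : E →L[ℂ] E} (hQ : IsRegularizer Q)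

/-- The spectral measure of a vector, in the variable `s = √μ`. -/
def meas (x : E) : Measure ℝ := (hQ.exists_spectralRep x).choose

/-- The vector `f(√T) x`. -/
def vec (x : E) : (ℝ → ℂ) → E := (hQ.exists_spectralRep x).choose_spec.choose

theorem rep (x : E) : SpectralRep Q x (hQ.meas x) (hQ.vec x) :=
  (hQ.exists_spectralRep x).choose_spec.choose_spec

instance (x : E) : IsFiniteMeasure (hQ.meas x) := (hQ.rep x).finite

end IsRegularizer

/-! ### Graphs of functions of the operator -/

/-- The regularized symbol. -/
def regSymb (φ : ℝ → ℂ) (q : ℝ) : ℂ := (q : ℂ) * (1 - q) * φ ((1 - q) / q)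

/-- Admissible functions. -/
def Adm (φ : ℝ → ℂ) : Prop := ContinuousOn (regSymb φ) (Set.Icc 0 1)

/-- `g = φ(T) f`. -/
def Gr (Q : E →L[ℂ] E) (φ : ℝ → ℂ) (f g : E) : Prop :=
  bc Q (fun q => (q : ℂ) * (1 - q)) g = bc Q (regSymb φ) f

theorem regSymb_qs (φ : ℝ → ℂ) {s : ℝ} (hs : 0 < s) :
    regSymb φ (qs s) = ((qs s : ℂ) * (1 - qs s)) * φ (s ^ 2) := by
  have : (1 - qs s) / qs s = s ^ 2 := by
    unfold qs; field_simp; ring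
  unfold regSymb
  rw [this]

theorem contOn_reg : ContinuousOn (fun q : ℝ => (q : ℂ) * (1 - q)) (Set.Icc 0 1) := by
  fun_prop

theorem regSymb_mul {φ ψ χ : ℝ → ℂ} (h : ∀ μ, 0 < μ → χ μ = φ μ * ψ μ) {q : ℝ}
    (hq : q ∈ Set.Icc (0 : ℝ) 1) :
    ((q : ℂ) * (1 - q)) * regSymb χ q = regSymb φ q * regSymb ψ q := by
  unfold regSymb
  rcases hq.1.eq_or_lt with rfl | h0
  · simp
  rcases hq.2.eq_or_lt with rfl | h1
  · simp
  rw [h _ (div_pos (by linarith) h0)]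
  ring

theorem adm_one : Adm (fun _ => 1) := by
  unfold Adm regSymb
  fun_prop

/-- The regularized symbol is `q^{1-r} (1 - q)^{1+r}`; its two exponents are positive exactly when
`|r| < 1`. -/
theorem adm_rpow {r : ℝ} (h1 : -1 < r) (h2 : r < 1) : Adm (fun μ => ((μ ^ r : ℝ) : ℂ)) := by
  have hc : ContinuousOn (fun q : ℝ => ((q ^ (1 - r) * (1 - q) ^ (1 + r) : ℝ) : ℂ))
      (Set.Icc 0 1) := by
    refine Complex.continuous_ofReal.comp_continuousOn (Continuous.continuousOn ?_)
    refine (Real.continuous_rpow_const (by linarith)).mul ?_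
    exact (Real.continuous_rpow_const (by linarith)).comp (continuous_const.sub continuous_id)
  refine hc.congr fun q hq => ?_
  unfold regSymb
  beta_reduce
  rcases hq.1.eq_or_lt with rfl | h0
  · rw [Real.zero_rpow (by linarith)]; simp
  rcases hq.2.eq_or_lt with rfl | h3
  · rw [sub_self, Real.zero_rpow (by linarith)]; simp
  have h4 : 0 < 1 - q := by linarith
  have : q * (1 - q) * ((1 - q) / q) ^ r = q ^ (1 - r) * (1 - q) ^ (1 + r) := by
    rw [Real.div_rpow h4.le h0.le, Real.rpow_sub h0, Real.rpow_add h4, Real.rpow_one, Real.rpow_one]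
    ring
  rw [← this]
  push_cast
  ring

/-- At `q = 0` and `q = 1`, where `φ` need have no limit, the factor `q (1 - q)` squeezes the symbol
to `0`. -/
theorem adm_of_bounded {φ : ℝ → ℂ} (hφ : ContinuousOn φ (Set.Ioi 0)) {C : ℝ}
    (hC : ∀ μ, ‖φ μ‖ ≤ C) : Adm φ := by
  have hC0 : 0 ≤ C := (norm_nonneg _).trans (hC 0)
  have hb : ∀ q : ℝ, ‖regSymb φ q‖ ≤ ‖q * (1 - q)‖ * C := by
    intro q
    unfold regSymb
    rw [norm_mul]
    refine mul_le_mul (le_of_eq ?_) (hC _) (norm_nonneg _) (norm_nonneg _)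
    rw [← Complex.norm_real]
    push_cast
    rfl
  have hend : ∀ q : ℝ, q * (1 - q) = 0 → ContinuousAt (regSymb φ) q := by
    intro q hq
    have h0 : regSymb φ q = 0 := by
      have := hb q
      rw [hq, norm_zero, zero_mul] at this
      exact norm_le_zero_iff.1 this
    rw [ContinuousAt, h0]
    refine squeeze_zero_norm hb ?_
    have : Continuous fun q : ℝ => ‖q * (1 - q)‖ * C := by fun_prop
    have h := this.tendsto q
    simpa [hq] using h
  intro q hq
  rcases hq.1.eq_or_lt with rfl | h0
  · exact (hend 0 (by simp)).continuousWithinAt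
  rcases hq.2.eq_or_lt with rfl | h1
  · exact (hend 1 (by simp)).continuousWithinAt
  have : ContinuousAt φ ((1 - q) / q) :=
    hφ.continuousAt (Ioi_mem_nhds (div_pos (by linarith) h0))
  refine ContinuousAt.continuousWithinAt ?_
  unfold regSymb
  refine ContinuousAt.mul (by fun_prop) (ContinuousAt.comp (f := fun q : ℝ => (1 - q) / q) this ?_)
  exact ContinuousAt.div (by fun_prop) (by fun_prop) h0.ne'

/-! ### Calculus of the relation `g = φ(T) f` -/

namespace IsRegularizer

variable {Q : E →L[ℂ] E} (hQ : IsRegularizer Q)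
include hQ

theorem reg_inj {x : E} (h : bc Q (fun q => (q : ℂ) * (1 - q)) x = 0) : x = 0 := by
  have h1 : bc Q (fun q : ℝ => (1 : ℂ) - q) = 1 - Q := by
    have := hQ.bc_sub (f := fun _ => 1) (g := fun q => (q : ℂ)) (by fun_prop) (by fun_prop)
    rwa [hQ.bc_id, hQ.bc_one] at this
  rw [hQ.bc_mul (by fun_prop) (by fun_prop), hQ.bc_id, h1] at h
  have h2 := hQ.inj_zero _ h
  refine hQ.inj_one x ?_
  have h3 : x - Q x = 0 := h2
  exact (sub_eq_zero.1 h3).symm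

theorem reg_cancel {x y : E}
    (h : bc Q (fun q => (q : ℂ) * (1 - q)) x = bc Q (fun q => (q : ℂ) * (1 - q)) y) : x = y := by
  rw [← sub_eq_zero, ← map_sub] at h
  exact sub_eq_zero.1 (hQ.reg_inj h)

theorem gr_unique {φ : ℝ → ℂ} {f g g' : E} (h : Gr Q φ f g) (h' : Gr Q φ f g') : g = g' :=
  hQ.reg_cancel (h.trans h'.symm)

omit hQ in
theorem gr_add {φ : ℝ → ℂ} {f g f' g' : E} (h : Gr Q φ f g) (h' : Gr Q φ f' g') :
    Gr Q φ (f + f') (g + g') := by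
  unfold Gr at *
  rw [map_add, map_add, h, h']

omit hQ in
theorem gr_smul {φ : ℝ → ℂ} {f g : E} (c : ℂ) (h : Gr Q φ f g) : Gr Q φ (c • f) (c • g) := by
  unfold Gr at *
  rw [map_smul, map_smul, h]

theorem bc_comm {φ ψ : ℝ → ℂ} (hφ : ContinuousOn φ (Set.Icc 0 1))
    (hψ : ContinuousOn ψ (Set.Icc 0 1)) (x : E) : bc Q φ (bc Q ψ x) = bc Q ψ (bc Q φ x) := by
  rw [hQ.bc_mul_apply hφ hψ, hQ.bc_mul_apply hψ hφ]
  simp only [mul_comm]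

theorem gr_bc {φ η : ℝ → ℂ} (hφ : Adm φ) (hη : ContinuousOn η (Set.Icc 0 1)) {f g : E}
    (h : Gr Q φ f g) : Gr Q φ (bc Q η f) (bc Q η g) := by
  unfold Gr at *
  rw [hQ.bc_comm contOn_reg hη, h, hQ.bc_comm hφ hη]

/-- One more application of the injective regularizer turns the three relations into an identity
between commuting bounded operators, so no domain question arises. -/
theorem gr_comp {φ ψ χ : ℝ → ℂ} (hφ : Adm φ) (hψ : Adm ψ) (hχ : Adm χ)
    (hm : ∀ μ, 0 < μ → χ μ = φ μ * ψ μ) {f g k : E} (h : Gr Q φ f g) (h' : Gr Q ψ g k) :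
    Gr Q χ f k := by
  unfold Gr at *
  refine hQ.reg_cancel ?_
  rw [h', hQ.bc_comm contOn_reg hψ, h, hQ.bc_mul_apply hψ hφ, hQ.bc_mul_apply contOn_reg hχ]
  congr 1
  refine hQ.bc_congr fun q hq => ?_
  rw [regSymb_mul hm hq, mul_comm]

/-- The same cancellation, solved for the second factor. With `χ = 1` it inverts a power of `T`. -/
theorem gr_div {φ ψ χ : ℝ → ℂ} (hφ : Adm φ) (hψ : Adm ψ) (hχ : Adm χ)
    (hm : ∀ μ, 0 < μ → χ μ = φ μ * ψ μ) {f g k : E} (h : Gr Q φ f g) (h' : Gr Q χ f k) :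
    Gr Q ψ g k := by
  unfold Gr at *
  refine hQ.reg_cancel ?_
  rw [h', hQ.bc_comm contOn_reg hψ, h, hQ.bc_mul_apply hψ hφ, hQ.bc_mul_apply contOn_reg hχ]
  congr 1
  refine hQ.bc_congr fun q hq => ?_
  rw [regSymb_mul hm hq, mul_comm]

theorem gr_one (x : E) : Gr Q (fun _ => 1) x x := by
  unfold Gr
  congr 1
  refine hQ.bc_congr fun q hq => ?_
  simp [regSymb]

theorem gr_bc_bc {φ θ η : ℝ → ℂ} (hφ : Adm φ) (hθ : ContinuousOn θ (Set.Icc 0 1))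
    (hη : ContinuousOn η (Set.Icc 0 1))
    (hm : ∀ q, 0 < q → q < 1 → η q = φ ((1 - q) / q) * θ q) (x : E) :
    Gr Q φ (bc Q θ x) (bc Q η x) := by
  unfold Gr
  rw [hQ.bc_mul_apply contOn_reg hη, hQ.bc_mul_apply hφ hθ]
  congr 1
  refine hQ.bc_congr fun q hq => ?_
  unfold regSymb
  rcases hq.1.eq_or_lt with rfl | h0
  · simp
  rcases hq.2.eq_or_lt with rfl | h1
  · simp
  rw [hm q h0 h1]
  ring

theorem gr_vec {φ : ℝ → ℂ} (hφ : Adm φ) {x : E} {f g : ℝ → ℂ} (hf : MemLp f 2 (hQ.meas x))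
    (hg : MemLp g 2 (hQ.meas x)) (h : ∀ s, 0 < s → g s = φ (s ^ 2) * f s) :
    Gr Q φ (hQ.vec x f) (hQ.vec x g) := by
  have r := hQ.rep x
  unfold Gr
  rw [r.bc _ _ contOn_reg hg, r.bc _ _ hφ hf]
  refine r.congr_pos (SpectralRep.memLp_qs_mul contOn_reg hg) fun s hs => ?_
  rw [regSymb_qs φ hs, h s hs]
  ring

theorem vec_one (x : E) : hQ.vec x (fun _ => 1) = x := (hQ.rep x).one

theorem gr_self_vec {φ : ℝ → ℂ} (hφ : Adm φ) {x : E} {g : ℝ → ℂ}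
    (hg : MemLp g 2 (hQ.meas x)) (h : ∀ s, 0 < s → g s = φ (s ^ 2)) :
    Gr Q φ x (hQ.vec x g) := by
  have := hQ.gr_vec hφ (f := fun _ => 1) (memLp_const 1) hg (fun s hs => by rw [h s hs, mul_one])
  rwa [hQ.vec_one] at this

/-- Strong convergence of uniformly bounded functions of `Q` that converge pointwise to `1`. -/
theorem tendsto_bc_one {e : ℕ → ℝ → ℂ} (he : ∀ n, ContinuousOn (e n) (Set.Icc 0 1)) {C : ℝ}
    (hb : ∀ n, ∀ q ∈ Set.Icc (0 : ℝ) 1, ‖e n q‖ ≤ C)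
    (hl : ∀ q, 0 < q → q < 1 → Filter.Tendsto (fun n => e n q) Filter.atTop (nhds 1)) (x : E) :
    Filter.Tendsto (fun n => bc Q (e n) x) Filter.atTop (nhds x) := by
  have r := hQ.rep x
  have h1 := r.tendsto (l := Filter.atTop) (F := fun n s => e n (qs s)) (f := fun _ => 1)
    (G := fun _ => C + 1) (fun n => r.memLp_qs (he n)) (memLp_const 1) (memLp_const _)
    (fun n s _ => (norm_sub_le _ _).trans (by
      rw [norm_one]; exact add_le_add_left (hb n _ (qs_mem s)) 1))
    (fun s hs => hl _ (by unfold qs; positivity) (by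
      unfold qs; rw [div_lt_one (by positivity)]; nlinarith))
  rw [hQ.vec_one] at h1
  refine h1.congr fun n => ?_
  rw [r.bc_self (he n)]

/-- Real functions of `T` are symmetric. -/
theorem gr_symm {φ : ℝ → ℂ} (hφ : Adm φ) (hr : ∀ μ, starRingEnd ℂ (φ μ) = φ μ) {f g f' g' : E}
    (h : Gr Q φ f g) (h' : Gr Q φ f' g') : ⟪g, f'⟫_ℂ = ⟪f, g'⟫_ℂ := by
  -- A bounded approximate inverse of the regularizer: `r n q * (q (1 - q))` is at most `1` and
  -- tends to `1` on `(0, 1)`. The absolute value keeps the denominator positive for every real `q`.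
  let r : ℕ → ℝ → ℝ := fun n q => n / (1 + n * |q * (1 - q)|)
  have rc : ∀ n, Continuous (r n) := fun n => by
    refine continuous_const.div (by fun_prop) fun q => by positivity
  have rC : ∀ n, ContinuousOn (fun q => ((r n q : ℝ) : ℂ)) (Set.Icc 0 1) := fun n =>
    (Complex.continuous_ofReal.comp (rc n)).continuousOn
  let e : ℕ → ℝ → ℂ := fun n q => ((r n q : ℝ) : ℂ) * ((q : ℂ) * (1 - q))
  have eC : ∀ n, ContinuousOn (e n) (Set.Icc 0 1) := fun n => (rC n).mul contOn_reg
  have er : ∀ n (q : ℝ), e n q = ((r n q * (q * (1 - q)) : ℝ) : ℂ) := fun n q => by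
    simp only [e]; push_cast; rfl
  have key : ∀ x, Filter.Tendsto (fun n => bc Q (e n) x) Filter.atTop (nhds x) := by
    refine hQ.tendsto_bc_one eC (C := 1) (fun n q hq => ?_) (fun q h0 h1 => ?_)
    · have hp : 0 ≤ q * (1 - q) := mul_nonneg hq.1 (by linarith [hq.2])
      rw [er, Complex.norm_real, Real.norm_of_nonneg (by positivity)]
      simp only [r, abs_of_nonneg hp]
      rw [div_mul_eq_mul_div, div_le_one (by positivity)]
      linarith
    · have hp : 0 < q * (1 - q) := mul_pos h0 (by linarith)
      simp_rw [er]
      rw [show (1 : ℂ) = ((1 : ℝ) : ℂ) by simp]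
      refine (Complex.continuous_ofReal.tendsto _).comp ?_
      simp only [r, abs_of_nonneg hp.le]
      generalize q * (1 - q) = c at hp
      have h1 : Filter.Tendsto (fun n : ℕ => 1 - 1 / (1 + (n : ℝ) * c)) Filter.atTop
          (nhds (1 - 0)) := by
        refine tendsto_const_nhds.sub ?_
        refine Filter.Tendsto.div_atTop tendsto_const_nhds ?_
        exact Filter.tendsto_atTop_add_const_left _ _
          (tendsto_natCast_atTop_atTop.atTop_mul_const hp)
      rw [sub_zero] at h1
      refine h1.congr fun n => ?_
      field_simp
      ring
  have hreg : ∀ q : ℝ, starRingEnd ℂ (regSymb φ q) = regSymb φ q := fun q => by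
    simp [regSymb, hr]
  have step : ∀ n, ⟪bc Q (e n) g, f'⟫_ℂ = ⟪f, bc Q (e n) g'⟫_ℂ := by
    intro n
    have hφr : ContinuousOn (fun q => ((r n q : ℝ) : ℂ) * regSymb φ q) (Set.Icc 0 1) :=
      (rC n).mul hφ
    have h1 : ∀ {f g}, Gr Q φ f g →
        bc Q (e n) g = bc Q (fun q => ((r n q : ℝ) : ℂ) * regSymb φ q) f := by
      intro f g hfg
      have := hQ.bc_mul_apply (rC n) contOn_reg g
      have h2 := hQ.bc_mul_apply (rC n) hφ f
      rw [hfg] at this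
      rw [← h2, this]
    rw [h1 h, h1 h', inner_bc_left]
    congr 2
    refine hQ.bc_congr fun q _ => ?_
    rw [map_mul, hreg, Complex.conj_ofReal]
  have l1 : Filter.Tendsto (fun n => ⟪bc Q (e n) g, f'⟫_ℂ) Filter.atTop (nhds ⟪g, f'⟫_ℂ) :=
    (key g).inner tendsto_const_nhds
  have l2 : Filter.Tendsto (fun n => ⟪f, bc Q (e n) g'⟫_ℂ) Filter.atTop (nhds ⟪f, g'⟫_ℂ) :=
    tendsto_const_nhds.inner (key g')
  refine tendsto_nhds_unique l1 (l2.congr fun n => (step n).symm)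

end IsRegularizer

theorem mem_funCalc_graph_iff_gr {T : E →ₗ.[ℂ] E} (hT : IsSelfAdjoint T) (hpos : IsNonneg T)
    (hinj : Function.Injective T) (φ : ℝ → ℂ) (f g : E) :
    (f, g) ∈ (funCalc T φ).graph ↔ Gr (res T (-1)) φ f g := by
  have hQ := isRegularizer_res hT hpos hinj
  rw [mem_funCalc_graph hT hpos hinj]
  have h1 : bc (res T (-1)) (fun q => (q : ℂ) * (1 - q)) = res T (-1) * (1 - res T (-1)) := by
    rw [hQ.bc_mul (by fun_prop) (by fun_prop), hQ.bc_id]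
    have := hQ.bc_sub (f := fun _ => 1) (g := fun q => (q : ℂ)) (by fun_prop) (by fun_prop)
    rw [this, hQ.bc_id, hQ.bc_one]
  unfold Gr
  rw [h1]
  rfl

end

section

variable {E : Type*} [NormedAddCommGroup E] [InnerProductSpace ℂ E] [CompleteSpace E]
variable {F : Type*} [NormedAddCommGroup F] [InnerProductSpace ℂ F] [CompleteSpace F]

/-! ### Adjoints of closed operators -/

omit [CompleteSpace F] in
theorem inner_adjoint_apply {A : E →ₗ.[ℂ] F} (hAd : Dense (A.domain : Set E)) (u : A†.domain)
    (x : A.domain) : ⟪A† u, (x : E)⟫_ℂ = ⟪(u : F), A x⟫_ℂ :=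
  LinearPMap.adjoint_isFormalAdjoint hAd u x

omit [CompleteSpace E] [CompleteSpace F] in
theorem apply_of_mem_graph {A : E →ₗ.[ℂ] F} {x : E} {y : F} (h : (x, y) ∈ A.graph) :
    ∃ hx : x ∈ A.domain, A ⟨x, hx⟩ = y := by
  obtain ⟨w, h1, h2⟩ := (LinearPMap.mem_graph_iff _).1 h
  simp only at h1 h2
  subst h1
  exact ⟨w.2, h2⟩

/-- This is `A†† = A`. In the Hilbert sum `E ⊕ F` the closed graph is its own double orthogonal
complement, and the vectors orthogonal to it have the form `(-A† u, u)`. -/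
theorem mem_graph_of_inner_adjoint {A : E →ₗ.[ℂ] F} (hA : A.IsClosed)
    (hAd : Dense (A.domain : Set E)) {x : E} {y : F}
    (h : ∀ u : A†.domain, ⟪A† u, x⟫_ℂ = ⟪(u : F), y⟫_ℂ) : (x, y) ∈ A.graph := by
  let G : Submodule ℂ (WithLp 2 (E × F)) :=
    A.graph.comap (WithLp.linearEquiv 2 ℂ (E × F)).toLinearMap
  have hG : IsClosed (G : Set (WithLp 2 (E × F))) :=
    IsClosed.preimage (WithLp.prod_continuous_ofLp 2 E F) hA
  have : CompleteSpace G := hG.completeSpace_coe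
  have hmem : WithLp.toLp 2 (x, y) ∈ Gᗮᗮ := by
    rw [Submodule.mem_orthogonal']
    intro w hw
    rw [Submodule.mem_orthogonal'] at hw
    have h1 : ∀ e : A.domain, ⟪-w.fst, (e : E)⟫_ℂ = ⟪w.snd, A e⟫_ℂ := by
      intro e
      have := hw (WithLp.toLp 2 ((e : E), A e)) (A.mem_graph e)
      rw [WithLp.prod_inner_apply] at this
      rw [inner_neg_left]
      exact neg_eq_of_add_eq_zero_right this
    have hd : w.snd ∈ A†.domain := LinearPMap.mem_adjoint_domain_of_exists _ ⟨_, h1⟩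
    have hv := LinearPMap.adjoint_apply_eq hAd ⟨w.snd, hd⟩ h1
    have h2 := h ⟨w.snd, hd⟩
    rw [hv] at h2
    rw [WithLp.prod_inner_apply, ← inner_conj_symm x, ← inner_conj_symm y, ← map_add]
    change starRingEnd ℂ (⟪w.fst, x⟫_ℂ + ⟪w.snd, y⟫_ℂ) = 0
    rw [← h2, inner_neg_left, add_neg_cancel, map_zero]
  rw [Submodule.orthogonal_orthogonal] at hmem
  exact hmem

/-- If `y` is orthogonal to `D(A†)`, then `(0, y)` satisfies the criterion above and lies in the
graph of `A`, so `y = 0`. -/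
theorem dense_adjoint_domain {A : E →ₗ.[ℂ] F} (hA : A.IsClosed)
    (hAd : Dense (A.domain : Set E)) : Dense (A†.domain : Set F) := by
  rw [Submodule.dense_iff_topologicalClosure_eq_top, Submodule.topologicalClosure_eq_top_iff,
    Submodule.eq_bot_iff]
  intro y hy
  rw [Submodule.mem_orthogonal] at hy
  have := mem_graph_of_inner_adjoint hA hAd (x := 0) (y := y) fun u => by
    rw [inner_zero_right, hy u u.2]
  exact A.graph_fst_eq_zero_snd this rfl

/-- The bounded functional `u ↦ ⟪x, A† u⟫` extends to the whole space by Hahn–Banach and is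
represented by a vector by Riesz; that vector is the value of `A` at `x`. -/
theorem exists_mem_graph_of_bound {A : E →ₗ.[ℂ] F} (hA : A.IsClosed)
    (hAd : Dense (A.domain : Set E)) {x : E} {c : ℝ}
    (h : ∀ u : A†.domain, ‖⟪A† u, x⟫_ℂ‖ ≤ c * ‖(u : F)‖) : ∃ y, (x, y) ∈ A.graph := by
  let f : A†.domain →ₗ[ℂ] ℂ := (innerSL ℂ x).toLinearMap ∘ₗ A†.toFun
  have hf : ∀ u : A†.domain, f u = ⟪x, A† u⟫_ℂ := fun u => rfl
  let f' : StrongDual ℂ A†.domain := f.mkContinuous c fun u => by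
    rw [hf, norm_inner_symm]; exact h u
  obtain ⟨g, hg, -⟩ := exists_extension_norm_eq A†.domain f'
  refine ⟨(InnerProductSpace.toDual ℂ F).symm g, mem_graph_of_inner_adjoint hA hAd fun u => ?_⟩
  rw [← inner_conj_symm, ← inner_conj_symm (u : F), InnerProductSpace.toDual_symm_apply, hg]
  rfl

/-! ### Shifts -/

omit [CompleteSpace E] in
theorem mem_graph_shift {H : E →ₗ.[ℂ] E} {ν : ℝ} {x y : E} :
    (x, y) ∈ (shift H ν).graph ↔ (x, y - (ν : ℂ) • x) ∈ H.graph := by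
  constructor
  · intro h
    obtain ⟨w, h1, h2⟩ := (LinearPMap.mem_graph_iff _).1 h
    simp only at h1 h2
    rw [← h1, ← h2]
    refine (LinearPMap.mem_graph_iff _).2 ⟨⟨w, w.2⟩, rfl, ?_⟩
    exact eq_sub_of_add_eq' rfl
  · intro h
    obtain ⟨w, h1, h2⟩ := (LinearPMap.mem_graph_iff _).1 h
    simp only at h1 h2
    refine (LinearPMap.mem_graph_iff _).2 ⟨⟨w, w.2⟩, h1, ?_⟩
    have : (shift H ν) ⟨w, w.2⟩ = (ν : ℂ) • (w : E) + H w := rfl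
    rw [this, h2, h1]
    simp

theorem isSelfAdjoint_shift {H : E →ₗ.[ℂ] E} (hH : IsSelfAdjoint H) (ν : ℝ) :
    IsSelfAdjoint (shift H ν) := by
  have hd : Dense ((shift H ν).domain : Set E) := hH.dense_domain
  have hadj : H† = H := hH
  change (shift H ν)† = shift H ν
  refine LinearPMap.eq_of_eq_graph ?_
  ext ⟨x, y⟩
  rw [LinearPMap.adjoint_graph_eq_graph_adjoint hd, mem_graph_shift]
  conv_rhs => rw [← hadj]
  rw [LinearPMap.adjoint_graph_eq_graph_adjoint hH.dense_domain, Submodule.mem_adjoint_iff,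
    Submodule.mem_adjoint_iff]
  constructor
  · intro h a b hab
    have := h a (b + (ν : ℂ) • a) (mem_graph_shift.2 (by simpa using hab))
    simp only [inner_add_left, inner_smul_left, Complex.conj_ofReal] at this
    simp only [inner_sub_right, inner_smul_right]
    linear_combination this
  · intro h a b hab
    have := h a _ (mem_graph_shift.1 hab)
    simp only [inner_sub_left, inner_smul_left, inner_sub_right, inner_smul_right,
      Complex.conj_ofReal] at this
    linear_combination this

omit [CompleteSpace E] in
theorem isResolvent_of_shift {H : E →ₗ.[ℂ] E} {ν : ℝ} {z : ℂ} {R : E →L[ℂ] E}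
    (hR : IsResolvent (shift H ν) (z + ν) R) : IsResolvent H z R := by
  have hs : ∀ w : H.domain,
      H w - z • (w : E) = (shift H ν) ⟨w, w.2⟩ - (z + (ν : ℂ)) • (w : E) := fun w => by
    have : (shift H ν) ⟨w, w.2⟩ = (ν : ℂ) • (w : E) + H w := rfl
    rw [this, add_smul]
    abel
  refine ⟨fun x => ?_, fun y => ?_⟩
  · obtain ⟨hx, e⟩ := hR.1 x
    exact ⟨hx, (hs ⟨R x, hx⟩).trans e⟩
  · rw [hs y]
    exact hR.2 ⟨y, y.2⟩

/-! ### Resolvents as functions of `Q` -/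

/-- The symbol of `(T - ζ)⁻¹`. -/
def resSymb (ζ : ℂ) (q : ℝ) : ℂ := q / (1 - q - ζ * q)

/-- The symbol of `(√T - z)⁻¹`. -/
def sqrtResSymb (z : ℂ) (q : ℝ) : ℂ := (√q : ℂ) / ((√(1 - q) : ℝ) - z * (√q : ℝ))

theorem resSymb_denom {ζ : ℂ} (hζ : ζ.im ≠ 0 ∨ ζ.re < 0) {q : ℝ} (hq : q ∈ Set.Icc (0 : ℝ) 1) :
    (1 : ℂ) - q - ζ * q ≠ 0 := by
  intro h
  have h1 := congrArg Complex.re h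
  have h2 := congrArg Complex.im h
  simp at h1 h2
  rcases hζ with h3 | h3
  · have : q = 0 := h2.resolve_left h3
    rw [this] at h1
    simp at h1
  · have h4 : ζ.re * q ≤ 0 := mul_nonpos_of_nonpos_of_nonneg h3.le hq.1
    have h5 : q = 1 := by linarith [hq.2]
    rw [h5] at h1
    linarith

theorem resSymb_qs {ζ : ℂ} {s : ℝ} : resSymb ζ (qs s) = ((s : ℂ) ^ 2 - ζ)⁻¹ := by
  unfold resSymb qs
  have h : (1 + (s : ℂ) ^ 2) ≠ 0 := by
    have : (1 + s ^ 2 : ℝ) ≠ 0 := by positivity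
    exact_mod_cast this
  push_cast
  rw [show (1 : ℂ) - 1 / (1 + (s : ℂ) ^ 2) - ζ * (1 / (1 + (s : ℂ) ^ 2)) =
    ((s : ℂ) ^ 2 - ζ) / (1 + (s : ℂ) ^ 2) by field_simp; ring]
  rw [div_div_div_cancel_right₀ h, one_div]

theorem sqrtResSymb_denom {z : ℂ} (hz : z.im ≠ 0) {q : ℝ} (hq : q ∈ Set.Icc (0 : ℝ) 1) :
    ((√(1 - q) : ℝ) : ℂ) - z * (√q : ℝ) ≠ 0 := by
  intro h
  have h1 := congrArg Complex.re h
  have h2 := congrArg Complex.im h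
  simp at h1 h2
  have : √q = 0 := h2.resolve_left hz
  rw [this, mul_zero, sub_zero] at h1
  rw [Real.sqrt_eq_zero hq.1] at this
  rw [this] at h1
  simp at h1

theorem sqrtResSymb_qs {z : ℂ} {s : ℝ} (hs : 0 < s) : sqrtResSymb z (qs s) = ((s : ℂ) - z)⁻¹ := by
  unfold sqrtResSymb
  have h1 : √(1 - qs s) = s * √(qs s) := by
    have : 1 - qs s = s ^ 2 * qs s := by unfold qs; field_simp; ring
    rw [this, Real.sqrt_mul (by positivity), Real.sqrt_sq hs.le]
  have h2 : ((√(qs s) : ℝ) : ℂ) ≠ 0 := by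
    have : √(qs s) ≠ 0 := (Real.sqrt_pos.2 (by unfold qs; positivity)).ne'
    exact_mod_cast this
  rw [h1]
  push_cast
  rw [← sub_mul, div_mul_cancel_right₀ h2]

theorem contOn_resSymb {ζ : ℂ} (hζ : ζ.im ≠ 0 ∨ ζ.re < 0) :
    ContinuousOn (resSymb ζ) (Set.Icc 0 1) := by
  unfold resSymb
  exact ContinuousOn.div (by fun_prop) (by fun_prop) fun q hq => resSymb_denom hζ hq

theorem contOn_sqrtResSymb {z : ℂ} (hz : z.im ≠ 0) :
    ContinuousOn (sqrtResSymb z) (Set.Icc 0 1) := by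
  unfold sqrtResSymb
  exact ContinuousOn.div (by fun_prop) (by fun_prop) fun q hq => sqrtResSymb_denom hz hq

/-- Because `T Q = 1 - Q`, the operator `T - ζ` acts on `Q r` as `1 - Q - ζ Q` acts on `r`. The
latter is invertible, as `1 - q - ζ q` has no zero on `[0, 1]`. -/
theorem isResolvent_bc {T : E →ₗ.[ℂ] E} (hT : IsSelfAdjoint T) (hpos : IsNonneg T)
    (hinj : Function.Injective T) {ζ : ℂ} (hζ : ζ.im ≠ 0 ∨ ζ.re < 0) :
    IsResolvent T ζ (bc (res T (-1)) (resSymb ζ)) := by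
  have hR := isRegularizer_res hT hpos hinj
  have hQ := isResolvent_res_neg_one hT hpos
  set Q := res T (-1)
  have hTQ : ∀ x, ∃ h : Q x ∈ T.domain, T ⟨Q x, h⟩ = x - Q x := by
    intro x
    obtain ⟨h, e⟩ := hQ.1 x
    rw [neg_one_smul, sub_neg_eq_add] at e
    exact ⟨h, eq_sub_of_add_eq e⟩
  have c1 : ContinuousOn (fun q : ℝ => ((1 : ℂ) - q - ζ * q)⁻¹) (Set.Icc 0 1) :=
    ContinuousOn.inv₀ (by fun_prop) fun q hq => resSymb_denom hζ hq
  have c2 : ContinuousOn (fun q : ℝ => ((1 : ℂ) - q - ζ * q)) (Set.Icc 0 1) := by fun_prop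
  have c3 : ContinuousOn (fun q : ℝ => (q : ℂ)) (Set.Icc 0 1) := by fun_prop
  have e1 : ∀ x, bc Q (resSymb ζ) x = Q (bc Q (fun q => ((1 : ℂ) - q - ζ * q)⁻¹) x) := by
    intro x
    conv_rhs => enter [1]; rw [← hR.bc_id]
    rw [hR.bc_mul_apply c3 c1]
    rfl
  have e2 : ∀ x, bc Q (fun q : ℝ => ((1 : ℂ) - q - ζ * q)) x = x - Q x - ζ • Q x := by
    intro x
    have h1 := hR.bc_sub (f := fun q : ℝ => (1 : ℂ) - q) (g := fun q => ζ * (q : ℂ))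
      (by fun_prop) (by fun_prop)
    have h2 := hR.bc_sub (f := fun _ => 1) (g := fun q => (q : ℂ)) (by fun_prop) (by fun_prop)
    have h3 := hR.bc_const_mul ζ c3
    rw [h1, h2, h3, hR.bc_id, hR.bc_one]
    rfl
  refine ⟨fun x => ?_, fun y => ?_⟩
  · set r := bc Q (fun q => ((1 : ℂ) - q - ζ * q)⁻¹) x with hr
    obtain ⟨h, e⟩ := hTQ r
    have h' : bc Q (resSymb ζ) x ∈ T.domain := by rw [e1]; exact h
    refine ⟨h', ?_⟩
    have h4 : (⟨bc Q (resSymb ζ) x, h'⟩ : T.domain) = ⟨Q r, h⟩ := Subtype.ext (e1 x)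
    rw [h4, e, e1, ← hr, ← e2, hr, hR.bc_mul_apply c2 c1]
    rw [hR.bc_congr (g := fun _ => 1) fun q hq => mul_inv_cancel₀ (resSymb_denom hζ hq), hR.bc_one]
    rfl
  · have h1 := hQ.2 y
    rw [neg_one_smul, sub_neg_eq_add] at h1
    set w := T y + (y : E) with hw
    have h2 : T y - ζ • (y : E) = w - Q w - ζ • Q w := by
      rw [h1, hw]; abel
    rw [h2, ← e2, hR.bc_mul_apply (contOn_resSymb hζ) c2, ← h1]
    conv_rhs => enter [1]; rw [← hR.bc_id]
    congr 1
    refine hR.bc_congr fun q hq => ?_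
    exact div_mul_cancel₀ _ (resSymb_denom hζ hq)

/-- The operator `√T` is accessible only through its regularized graph, so both halves of the
inverse property are checked after applying `Q (1 - Q)`. There they amount to `(√μ - z) (√μ - z)⁻¹ =
1`, which is `hid`. -/
theorem isResolvent_sqrt {T : E →ₗ.[ℂ] E} (hT : IsSelfAdjoint T) (hpos : IsNonneg T)
    (hinj : Function.Injective T) {z : ℂ} (hz : z.im ≠ 0) :
    IsResolvent (fracPow T (1 / 2)) z (bc (res T (-1)) (sqrtResSymb z)) := by
  have hR := isRegularizer_res hT hpos hinj
  have hG := mem_funCalc_graph_iff_gr hT hpos hinj (fun μ => ((μ ^ (1 / 2 : ℝ) : ℝ) : ℂ))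
  set Q := res T (-1)
  have hA : Adm (fun μ => ((μ ^ (1 / 2 : ℝ) : ℝ) : ℂ)) := adm_rpow (by norm_num) (by norm_num)
  have hc := contOn_sqrtResSymb hz
  have hid : ∀ q ∈ Set.Icc (0 : ℝ) 1, regSymb (fun μ => ((μ ^ (1 / 2 : ℝ) : ℝ) : ℂ)) q *
      sqrtResSymb z q - z * ((q : ℂ) * (1 - q) * sqrtResSymb z q) = (q : ℂ) * (1 - q) := by
    intro q hq
    have hd := sqrtResSymb_denom hz hq
    unfold regSymb
    rcases hq.1.eq_or_lt with rfl | h0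
    · simp
    have h1 : ((√q : ℝ) : ℂ) ≠ 0 := by
      have := (Real.sqrt_pos.2 h0).ne'
      exact_mod_cast this
    have h2 : ((1 - q) / q) ^ (1 / 2 : ℝ) = √(1 - q) / √q := by
      rw [← Real.sqrt_eq_rpow, Real.sqrt_div' _ h0.le]
    simp only [h2]
    unfold sqrtResSymb
    push_cast
    have hd' : ((√(1 - q) : ℝ) : ℂ) - (√q : ℝ) * z ≠ 0 := by rwa [mul_comm z] at hd
    field_simp
  have cz : ContinuousOn (fun q : ℝ => (q : ℂ) * (1 - q) * sqrtResSymb z q) (Set.Icc 0 1) :=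
    contOn_reg.mul hc
  have cz' : ContinuousOn (fun q : ℝ => z * ((q : ℂ) * (1 - q) * sqrtResSymb z q))
    (Set.Icc 0 1) := continuousOn_const.mul cz
  have ca : ContinuousOn (fun q : ℝ => regSymb (fun μ => ((μ ^ (1 / 2 : ℝ) : ℝ) : ℂ)) q *
    sqrtResSymb z q) (Set.Icc 0 1) := ContinuousOn.mul hA hc
  have hop : ∀ x, bc Q (regSymb (fun μ => ((μ ^ (1 / 2 : ℝ) : ℝ) : ℂ))) (bc Q (sqrtResSymb z) x) -
      z • bc Q (fun q => (q : ℂ) * (1 - q)) (bc Q (sqrtResSymb z) x) =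
      bc Q (fun q => (q : ℂ) * (1 - q)) x := by
    intro x
    conv_rhs => rw [← hR.bc_congr hid, hR.bc_sub ca cz', hR.bc_const_mul z cz]
    rw [hR.bc_mul_apply hA hc, hR.bc_mul_apply contOn_reg hc]
    rfl
  refine ⟨fun x => ?_, fun y => ?_⟩
  · have h1 : (bc Q (sqrtResSymb z) x, x + z • bc Q (sqrtResSymb z) x) ∈
        (fracPow T (1 / 2)).graph := by
      refine (hG _ _).2 ?_
      unfold Gr
      rw [map_add, map_smul, ← hop x]
      simp
    obtain ⟨h, e⟩ := apply_of_mem_graph h1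
    refine ⟨h, ?_⟩
    rw [e]; simp
  · have h1 := (hG _ _).1 ((fracPow T (1 / 2)).mem_graph y)
    unfold Gr at h1
    refine hR.reg_cancel ?_
    rw [← hop y, hR.bc_comm contOn_reg hc, map_sub, map_smul, h1, map_sub, map_smul,
      hR.bc_comm hc hA, hR.bc_comm hc contOn_reg]

theorem inner_bc_resSymb {Q : E →L[ℂ] E} {x : E} {m : Measure ℝ} {v : (ℝ → ℂ) → E}
    (h : SpectralRep Q x m v) {ζ : ℂ} (hζ : ζ.im ≠ 0 ∨ ζ.re < 0) :
    ⟪x, bc Q (resSymb ζ) x⟫_ℂ = ∫ s, ((s : ℂ) ^ 2 - ζ)⁻¹ ∂m := by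
  rw [h.inner_self_bc (contOn_resSymb hζ)]
  simp only [resSymb_qs]

theorem conj_sqrtResSymb (z : ℂ) (q : ℝ) :
    starRingEnd ℂ (sqrtResSymb z q) = sqrtResSymb (starRingEnd ℂ z) q := by
  simp [sqrtResSymb]

end

section

variable {E : Type*} [NormedAddCommGroup E] [InnerProductSpace ℂ E] [CompleteSpace E]

/-! ### The unitary group generated by `√T` -/

/-- The symbol of `exp (-i t √T)`. -/
def flowSymb (t : ℝ) (μ : ℝ) : ℂ := Complex.exp (-Complex.I * t * √μ)

theorem norm_exp_flow (t s : ℝ) : ‖Complex.exp (-Complex.I * t * s)‖ = 1 := by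
  rw [show -Complex.I * (t : ℂ) * s = ((-(t * s) : ℝ) : ℂ) * Complex.I by push_cast; ring,
    Complex.norm_exp_ofReal_mul_I]

theorem adm_flowSymb (t : ℝ) : Adm (flowSymb t) := by
  refine adm_of_bounded (C := 1) ?_ fun μ => (norm_exp_flow t _).le
  unfold flowSymb
  fun_prop

namespace IsRegularizer

variable {Q : E →L[ℂ] E} (hQ : IsRegularizer Q)

theorem memLp_exp (t : ℝ) (x : E) :
    MemLp (fun s : ℝ => Complex.exp (-Complex.I * t * s)) 2 (hQ.meas x) :=
  (hQ.rep x).memLp_bdd (by fun_prop) (C := 1) fun s => (norm_exp_flow t s).le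

theorem gr_flow_vec (t : ℝ) (x : E) :
    Gr Q (flowSymb t) x (hQ.vec x fun s => Complex.exp (-Complex.I * t * s)) := by
  refine hQ.gr_self_vec (adm_flowSymb t) (hQ.memLp_exp t x) fun s hs => ?_
  rw [flowSymb, Real.sqrt_sq hs.le]

/-- The unitary group `exp (-i t √T)`. -/
def flow (t : ℝ) : E →ₗᵢ[ℂ] E where
  toFun x := hQ.vec x fun s => Complex.exp (-Complex.I * t * s)
  map_add' x y := hQ.gr_unique (hQ.gr_flow_vec t (x + y))
    (gr_add (hQ.gr_flow_vec t x) (hQ.gr_flow_vec t y))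
  map_smul' c x := hQ.gr_unique (hQ.gr_flow_vec t (c • x)) (gr_smul c (hQ.gr_flow_vec t x))
  norm_map' x := by
    have h1 := (hQ.rep x).norm_sq (hQ.memLp_exp t x)
    have h2 := (hQ.rep x).norm_sq (f := fun _ => 1) (memLp_const 1)
    rw [hQ.vec_one] at h2
    simp only [norm_exp_flow] at h1
    simp only [norm_one] at h2
    exact (pow_left_inj₀ (norm_nonneg _) (norm_nonneg _) two_ne_zero).1 (h1.trans h2.symm)

theorem flow_eq_vec (t : ℝ) (x : E) :
    hQ.flow t x = hQ.vec x fun s => Complex.exp (-Complex.I * t * s) := rfl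

theorem gr_flow (t : ℝ) (x : E) : Gr Q (flowSymb t) x (hQ.flow t x) := hQ.gr_flow_vec t x

theorem flow_add (t s : ℝ) (x : E) : hQ.flow t (hQ.flow s x) = hQ.flow (s + t) x := by
  refine hQ.gr_unique (hQ.gr_comp (adm_flowSymb s) (adm_flowSymb t) (adm_flowSymb (s + t))
    (fun μ _ => ?_) (hQ.gr_flow s x) (hQ.gr_flow t _)) (hQ.gr_flow _ x)
  rw [flowSymb, flowSymb, flowSymb, ← Complex.exp_add]
  congr 1
  push_cast
  ring

theorem flow_zero (x : E) : hQ.flow 0 x = x := by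
  refine hQ.gr_unique (φ := fun _ => 1) ?_ (hQ.gr_one x)
  have := hQ.gr_flow 0 x
  have h : flowSymb 0 = fun _ => 1 := by
    ext μ; simp [flowSymb]
  rwa [h] at this

theorem inner_flow_left (t : ℝ) (x y : E) : ⟪hQ.flow t x, y⟫_ℂ = ⟪x, hQ.flow (-t) y⟫_ℂ := by
  have h : y = hQ.flow t (hQ.flow (-t) y) := by
    rw [flow_add, neg_add_cancel, flow_zero]
  conv_lhs => rw [h]
  exact (hQ.flow t).inner_map_map _ _

theorem flow_bc (t : ℝ) {η : ℝ → ℂ} (hη : ContinuousOn η (Set.Icc 0 1)) (x : E) :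
    hQ.flow t (bc Q η x) = bc Q η (hQ.flow t x) :=
  hQ.gr_unique (hQ.gr_flow t _) (hQ.gr_bc (adm_flowSymb t) hη (hQ.gr_flow t x))

theorem gr_flow_flow {φ : ℝ → ℂ} (hφ : Adm φ) (t : ℝ) {f g : E} (h : Gr Q φ f g) :
    Gr Q φ (hQ.flow t f) (hQ.flow t g) := by
  unfold Gr at *
  rw [← hQ.flow_bc t contOn_reg, ← hQ.flow_bc t hφ, h]

theorem continuous_flow_apply (x : E) : Continuous fun t => hQ.flow t x := by
  rw [continuous_iff_continuousAt]
  intro t₀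
  refine (hQ.rep x).tendsto (fun t => hQ.memLp_exp t x) (hQ.memLp_exp t₀ x)
    (G := fun _ => 2) (memLp_const 2) (fun t s _ => ?_) (fun s _ => ?_)
  · refine (norm_sub_le _ _).trans ?_
    rw [norm_exp_flow, norm_exp_flow]
    norm_num
  · have : Continuous fun t : ℝ => Complex.exp (-Complex.I * t * s) := by fun_prop
    exact this.tendsto t₀

/-- The resolvent of `√T` is the Laplace transform of the group. -/
theorem integral_exp_flow {z : ℂ} (hz : 0 < z.im) (x : E) :
    IntegrableOn (fun τ : ℝ => Complex.exp (Complex.I * z * τ) • hQ.flow τ x) (Set.Ioi 0) ∧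
    ∫ τ in Set.Ioi (0 : ℝ), Complex.exp (Complex.I * z * τ) • hQ.flow τ x =
      -Complex.I • bc Q (sqrtResSymb z) x := by
  have hn : ∀ τ : ℝ, ‖Complex.exp (Complex.I * z * τ)‖ = Real.exp (-z.im * τ) := by
    intro τ
    rw [Complex.norm_exp]
    congr 1
    simp
  have hexp : IntegrableOn (fun τ : ℝ => Real.exp (-z.im * τ)) (Set.Ioi 0) :=
    exp_neg_integrableOn_Ioi 0 hz
  have hcont : Continuous (fun τ : ℝ => Complex.exp (Complex.I * z * τ) • hQ.flow τ x) :=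
    Continuous.smul (by fun_prop) (hQ.continuous_flow_apply x)
  have hint : IntegrableOn (fun τ : ℝ => Complex.exp (Complex.I * z * τ) • hQ.flow τ x)
      (Set.Ioi 0) := by
    refine (hexp.mul_const ‖x‖).mono' hcont.aestronglyMeasurable ?_
    refine Filter.Eventually.of_forall fun τ => ?_
    rw [norm_smul, hn, LinearIsometry.norm_map]
  refine ⟨hint, ?_⟩
  refine ext_inner_left ℂ fun y => ?_
  have r := hQ.rep x
  -- Tested against `y`, the flow becomes a scalar spectral integral. Fubini then leaves `∫_0^∞ exp
  -- (i (z - s) τ) dτ = -i (s - z)⁻¹`.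
  obtain ⟨g, hg, hgv⟩ := r.dual y
  rw [← integral_inner hint y, inner_smul_right]
  have e1 : ∀ τ : ℝ, ⟪y, Complex.exp (Complex.I * z * τ) • hQ.flow τ x⟫_ℂ =
      ∫ s, starRingEnd ℂ (g s) * Complex.exp ((Complex.I * z - Complex.I * s) * τ)
        ∂(hQ.meas x) := by
    intro τ
    rw [inner_smul_right, flow_eq_vec, hgv _ (hQ.memLp_exp τ x), ← integral_const_mul]
    congr 1
    ext s
    rw [show (Complex.I * z - Complex.I * s) * τ = Complex.I * z * τ + -Complex.I * τ * s by ring,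
      Complex.exp_add]
    ring
  simp_rw [e1]
  have hg1 : Integrable g (hQ.meas x) := hg.integrable one_le_two
  rw [integral_integral_swap]
  · rw [r.bc_self (contOn_sqrtResSymb hz.ne'), hgv _ (r.memLp_qs (contOn_sqrtResSymb hz.ne')),
      ← integral_const_mul]
    refine integral_congr_ae ?_
    filter_upwards [r.pos] with s hs
    rw [integral_const_mul, sqrtResSymb_qs hs]
    have hre : (Complex.I * z - Complex.I * s).re < 0 := by simp [hz]
    rw [integral_exp_mul_complex_Ioi hre]
    simp only [Complex.ofReal_zero, mul_zero, Complex.exp_zero]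
    have h1 : (s : ℂ) - z ≠ 0 := by
      intro h
      have := congrArg Complex.im h
      simp at this
      exact hz.ne' this
    have h2 : (Complex.I * z - Complex.I * s) ≠ 0 := by
      rw [← mul_sub]
      refine mul_ne_zero Complex.I_ne_zero fun h => h1 ?_
      rw [← neg_sub, h, neg_zero]
    have h3 : (-1 : ℂ) / (Complex.I * z - Complex.I * s) = -Complex.I * ((s : ℂ) - z)⁻¹ := by
      rw [div_eq_iff h2, ← mul_sub, show z - (s : ℂ) = -((s : ℂ) - z) by ring]
      field_simp
      rw [Complex.I_sq]
    rw [h3]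
    ring
  · have hprod : Integrable (fun p : ℝ × ℝ => Real.exp (-z.im * p.1) * ‖g p.2‖)
        ((volume.restrict (Set.Ioi 0)).prod (hQ.meas x)) := hexp.mul_prod hg1.norm
    refine hprod.mono' ?_ (Filter.Eventually.of_forall fun p => ?_)
    · refine AEStronglyMeasurable.mul
        (Complex.continuous_conj.comp_aestronglyMeasurable hg1.1.comp_snd) ?_
      refine Continuous.aestronglyMeasurable ?_
      fun_prop
    · simp only [Function.uncurry]
      rw [norm_mul, RCLike.norm_conj, mul_comm, Complex.norm_exp]
      refine mul_le_mul_of_nonneg_right (le_of_eq ?_) (norm_nonneg _)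
      congr 1
      simp

end IsRegularizer

theorem sqrtFlow_graph {T : E →ₗ.[ℂ] E} (hT : IsSelfAdjoint T) (hpos : IsNonneg T)
    (hinj : Function.Injective T) (t : ℝ) (f g : E) :
    (f, g) ∈ (sqrtFlow T t).graph ↔ g = (isRegularizer_res hT hpos hinj).flow t f := by
  have hQ := isRegularizer_res hT hpos hinj
  unfold sqrtFlow
  rw [mem_funCalc_graph_iff_gr hT hpos hinj]
  exact ⟨fun h => hQ.gr_unique h (hQ.gr_flow t f), fun h => h ▸ hQ.gr_flow t f⟩

end

section

/-! ### Measures with bounded Poisson integrals -/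

theorem im_inv_sub {s l ε : ℝ} :
    (((s : ℂ) ^ 2 - (l + ε * Complex.I))⁻¹).im = ε / ((s ^ 2 - l) ^ 2 + ε ^ 2) := by
  have h : (s : ℂ) ^ 2 - (l + ε * Complex.I) = ((s ^ 2 - l : ℝ) : ℂ) + ((-ε : ℝ) : ℂ) * Complex.I := by
    push_cast; ring
  rw [h, Complex.inv_im, Complex.normSq_add_mul_I, Complex.add_im, Complex.ofReal_im, zero_add,
    Complex.im_ofReal_mul, Complex.I_im, mul_one, neg_neg, neg_sq]

/-- The weight `2 σ` is the Jacobian of `μ = σ²`, under which the Poisson kernel integrates to an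
arctangent. It is also the source of the factor `s` in the density bound. -/
theorem integral_poisson_sq {s α β ε : ℝ} (hε : 0 < ε) :
    ∫ σ in α..β, ε * (2 * σ) / ((s ^ 2 - σ ^ 2) ^ 2 + ε ^ 2) =
      Real.arctan ((β ^ 2 - s ^ 2) / ε) - Real.arctan ((α ^ 2 - s ^ 2) / ε) := by
  refine intervalIntegral.integral_eq_sub_of_hasDerivAt
    (f := fun σ => Real.arctan ((σ ^ 2 - s ^ 2) / ε)) (fun σ _ => ?_) ?_
  · have h1 : HasDerivAt (fun σ : ℝ => (σ ^ 2 - s ^ 2) / ε) (2 * σ / ε) σ := by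
      simpa using ((hasDerivAt_pow 2 σ).sub_const (s ^ 2)).div_const ε
    refine h1.arctan.congr_deriv ?_
    have h2 : (s ^ 2 - σ ^ 2) ^ 2 + ε ^ 2 ≠ 0 := by positivity
    have h3 : 1 + ((σ ^ 2 - s ^ 2) / ε) ^ 2 = ((s ^ 2 - σ ^ 2) ^ 2 + ε ^ 2) / ε ^ 2 := by
      field_simp
      ring
    rw [h3]
    field_simp
  · refine Continuous.intervalIntegrable ?_ _ _
    refine Continuous.div (by fun_prop) (by fun_prop) fun σ => by positivity

/-- Stieltjes inversion as an inequality. For `s` in the open set, the normalized Poisson kernel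
integrated in `σ` over the set has limit inferior at least `1`. Integrating in `s`, Fatou's lemma
and Tonelli's theorem leave the Poisson integrals of `m`, which are at most `M`. -/
theorem measure_isOpen_le_of_poisson {m : Measure ℝ} [IsFiniteMeasure m] {M : ℝ}
    {ε₀ : ℝ} (hε₀ : 0 < ε₀)
    (hP : ∀ ε l : ℝ, 0 < ε → ε < ε₀ → ∫ s, ε / ((s ^ 2 - l) ^ 2 + ε ^ 2) ∂m ≤ M)
    {U : Set ℝ} (hU : IsOpen U) (hU0 : U ⊆ Set.Ioi 0) :
    m U ≤ ∫⁻ σ in U, ENNReal.ofReal (2 * M / Real.pi * σ) := by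
  -- The shift by `2` keeps every term, including that with `n = 0`, strictly below `ε₀`.
  let e : ℕ → ℝ := fun n => ε₀ / (n + 2)
  have he : ∀ n, 0 < e n := fun n => by positivity
  have he' : ∀ n, e n < ε₀ := fun n => by
    rw [div_lt_iff₀ (by positivity)]
    nlinarith [(Nat.cast_nonneg n : (0:ℝ) ≤ n)]
  have het : Filter.Tendsto e Filter.atTop (nhds 0) :=
    Filter.Tendsto.div_atTop tendsto_const_nhds
      (Filter.tendsto_atTop_add_const_right _ _ tendsto_natCast_atTop_atTop)
  let k : ℕ → ℝ → ℝ → ℝ := fun n s σ =>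
    Real.pi⁻¹ * (e n * (2 * σ) / ((s ^ 2 - σ ^ 2) ^ 2 + e n ^ 2))
  have hkc : ∀ n, Continuous (Function.uncurry (k n)) := fun n => by
    refine continuous_const.mul (Continuous.div (by fun_prop) (by fun_prop) fun p => ?_)
    have := he n
    positivity
  have hkm : ∀ n, Measurable (fun p : ℝ × ℝ => ENNReal.ofReal (k n p.1 p.2)) := fun n =>
    (hkc n).measurable.ennreal_ofReal
  let J : ℕ → ℝ → ℝ≥0∞ := fun n s => ∫⁻ σ in U, ENNReal.ofReal (k n s σ)
  have hJm : ∀ n, Measurable (J n) := fun n => (hkm n).lintegral_prod_right'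
  have hlim : ∀ s ∈ U, 1 ≤ Filter.liminf (fun n => J n s) Filter.atTop := by
    intro s hs
    obtain ⟨δ, hδ, hball⟩ := Metric.isOpen_iff.1 hU s hs
    have hs0 : 0 < s := hU0 hs
    obtain ⟨α, hα1, hα2⟩ : ∃ α, max (s - δ) 0 < α ∧ α < s :=
      exists_between (max_lt (by linarith) hs0)
    obtain ⟨β, hβ1, hβ2⟩ : ∃ β, s < β ∧ β < s + δ := exists_between (by linarith)
    have hα0 : 0 < α := (le_max_right _ _).trans_lt hα1
    have hsub : Set.Ioc α β ⊆ U := by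
      intro σ hσ
      refine hball ?_
      rw [Metric.mem_ball, Real.dist_eq, abs_lt]
      have := (le_max_left (s - δ) 0).trans_lt hα1
      exact ⟨by linarith [hσ.1], by linarith [hσ.2]⟩
    have hlow : ∀ n, ENNReal.ofReal (Real.pi⁻¹ * (Real.arctan ((β ^ 2 - s ^ 2) / e n) -
        Real.arctan ((α ^ 2 - s ^ 2) / e n))) ≤ J n s := by
      intro n
      rw [← integral_poisson_sq (he n), ← intervalIntegral.integral_const_mul,
        intervalIntegral.integral_of_le (by linarith),
        ofReal_integral_eq_lintegral_ofReal]
      · exact lintegral_mono_set hsub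
      · have hc : Continuous (k n s) := (hkc n).comp (by fun_prop : Continuous fun σ => (s, σ))
        exact (hc.integrableOn_Icc).mono_set Set.Ioc_subset_Icc_self
      · refine (ae_restrict_iff' measurableSet_Ioc).2 (Filter.Eventually.of_forall fun σ hσ => ?_)
        have h1 : 0 < σ := hα0.trans hσ.1
        have := he n
        have := Real.pi_pos
        simp only [Pi.zero_apply]
        positivity
    have htop : ∀ {c : ℝ}, 0 < c → Filter.Tendsto (fun n => Real.arctan (c / e n)) Filter.atTop
        (nhds (Real.pi / 2)) := by
      intro c hc
      have h1 : Filter.Tendsto (fun n => c / e n) Filter.atTop Filter.atTop := by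
        have : Filter.Tendsto e Filter.atTop (nhdsWithin 0 (Set.Ioi 0)) :=
          tendsto_nhdsWithin_iff.2 ⟨het, Filter.Eventually.of_forall he⟩
        have := (tendsto_inv_nhdsGT_zero.comp this).const_mul_atTop hc
        exact this
      exact (Real.tendsto_arctan_atTop.mono_right nhdsWithin_le_nhds).comp h1
    have h1 : Filter.Tendsto (fun n => ENNReal.ofReal (Real.pi⁻¹ *
        (Real.arctan ((β ^ 2 - s ^ 2) / e n) - Real.arctan ((α ^ 2 - s ^ 2) / e n))))
        Filter.atTop (nhds 1) := by
      have hb : 0 < β ^ 2 - s ^ 2 := by nlinarith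
      have ha : 0 < s ^ 2 - α ^ 2 := by nlinarith
      have h2 := (((htop hb).add (htop ha)).const_mul Real.pi⁻¹)
      have h3 : Real.pi⁻¹ * (Real.pi / 2 + Real.pi / 2) = 1 := by
        have := Real.pi_pos.ne'
        field_simp
        norm_num
      rw [h3] at h2
      have h4 := (ENNReal.continuous_ofReal.tendsto 1).comp h2
      rw [ENNReal.ofReal_one] at h4
      refine h4.congr fun n => ?_
      rw [Function.comp_apply, ← neg_sub (s ^ 2) (α ^ 2), neg_div, Real.arctan_neg, sub_neg_eq_add]
    rw [← h1.liminf_eq]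
    exact Filter.liminf_le_liminf (Filter.Eventually.of_forall hlow)
  have hker : ∀ n, ∀ σ ∈ U, ∫⁻ s, ENNReal.ofReal (k n s σ) ∂m ≤
      ENNReal.ofReal (2 * M / Real.pi * σ) := by
    intro n σ hσ
    have hσ0 : 0 < σ := hU0 hσ
    have hen := he n
    have hpi := Real.pi_pos
    have hk0 : ∀ s, k n s σ = (Real.pi⁻¹ * (2 * σ)) * (e n / ((s ^ 2 - σ ^ 2) ^ 2 + e n ^ 2)) :=
      fun s => by simp only [k]; ring
    have hint : Integrable (fun s : ℝ => e n / ((s ^ 2 - σ ^ 2) ^ 2 + e n ^ 2)) m := by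
      refine Integrable.of_bound (C := e n / e n ^ 2) ?_ (Filter.Eventually.of_forall fun s => ?_)
      · refine Continuous.aestronglyMeasurable ?_
        exact Continuous.div (by fun_prop) (by fun_prop) fun p => by positivity
      · rw [Real.norm_of_nonneg (by positivity)]
        gcongr
        nlinarith [sq_nonneg (s ^ 2 - σ ^ 2)]
    simp_rw [hk0]
    rw [← ofReal_integral_eq_lintegral_ofReal (hint.const_mul _)
      (Filter.Eventually.of_forall fun s => by simp only [Pi.zero_apply]; positivity),
      integral_const_mul]
    refine ENNReal.ofReal_le_ofReal ?_
    calc _ ≤ (Real.pi⁻¹ * (2 * σ)) * M := by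
          refine mul_le_mul_of_nonneg_left (hP _ _ hen (he' n)) (by positivity)
      _ = _ := by field_simp
  calc m U = ∫⁻ s in U, 1 ∂m := by simp
    _ ≤ ∫⁻ s in U, Filter.liminf (fun n => J n s) Filter.atTop ∂m :=
      setLIntegral_mono' hU.measurableSet hlim
    _ ≤ ∫⁻ s, Filter.liminf (fun n => J n s) Filter.atTop ∂m := setLIntegral_le_lintegral _ _
    _ ≤ Filter.liminf (fun n => ∫⁻ s, J n s ∂m) Filter.atTop := lintegral_liminf_le hJm
    _ ≤ Filter.liminf (fun _ : ℕ => ∫⁻ σ in U, ENNReal.ofReal (2 * M / Real.pi * σ))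
        Filter.atTop := by
      refine Filter.liminf_le_liminf (Filter.Eventually.of_forall fun n => ?_)
      simp only [J]
      rw [lintegral_lintegral_swap (hkm n).aemeasurable]
      exact setLIntegral_mono' hU.measurableSet (hker n)
    _ = _ := Filter.liminf_const _

/-- Outer regularity of the measure with the given density passes from open sets to all measurable
sets; the part of an open set outside `(0, ∞)` is `m`-null. -/
theorem le_withDensity_of_poisson {m : Measure ℝ} [IsFiniteMeasure m] (hpos : ∀ᵐ s ∂m, 0 < s)
    {M : ℝ} {ε₀ : ℝ} (hε₀ : 0 < ε₀)
    (hP : ∀ ε l : ℝ, 0 < ε → ε < ε₀ → ∫ s, ε / ((s ^ 2 - l) ^ 2 + ε ^ 2) ∂m ≤ M) :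
    m ≤ volume.withDensity (fun σ => ENNReal.ofReal (2 * M / Real.pi * max σ 0)) := by
  set n := (volume : Measure ℝ).withDensity
    (fun σ => ENNReal.ofReal (2 * M / Real.pi * max σ 0)) with hn
  have : IsLocallyFiniteMeasure n :=
    IsLocallyFiniteMeasure.withDensity_ofReal (by fun_prop)
  refine Measure.le_iff.2 fun S _ => ?_
  rw [S.measure_eq_iInf_isOpen n]
  refine le_iInf fun U => le_iInf fun hSU => le_iInf fun hU => ?_
  refine (measure_mono hSU).trans ?_
  have h1 : m U = m (U ∩ Set.Ioi 0) := by
    refine (measure_congr ?_)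
    filter_upwards [hpos] with s hs
    exact propext ⟨fun h => ⟨h, hs⟩, fun h => h.1⟩
  have hU' : IsOpen (U ∩ Set.Ioi 0) := hU.inter isOpen_Ioi
  rw [h1, hn, withDensity_apply _ hU.measurableSet]
  refine (measure_isOpen_le_of_poisson hε₀ hP hU' Set.inter_subset_right).trans ?_
  refine le_trans (le_of_eq ?_) (lintegral_mono_set (Set.inter_subset_left (s := U) (t := Set.Ioi 0)))
  refine setLIntegral_congr_fun hU'.measurableSet fun σ hσ => ?_
  rw [max_eq_left (le_of_lt hσ.2)]

/-- The measure has density at most `2 M s / π` on `(0, ∞)`. -/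
structure DensityBound (m : Measure ℝ) (M : ℝ) : Prop where
  finite : IsFiniteMeasure m
  pos : ∀ᵐ s ∂m, 0 < s
  nonneg : 0 ≤ M
  le : m ≤ volume.withDensity (fun σ => ENNReal.ofReal (2 * M / Real.pi * max σ 0))

/-! ### Integration against measures of bounded density -/

namespace DensityBound

variable {m : Measure ℝ} {M : ℝ} (h : DensityBound m M)
include h

theorem lintegral_le {g : ℝ → ℝ≥0∞} (hg : Measurable g) :
    ∫⁻ s, g s ∂m ≤ ∫⁻ σ in Set.Ioi 0, ENNReal.ofReal (2 * M / Real.pi * σ) * g σ := by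
  refine (lintegral_mono' h.le le_rfl).trans ?_
  rw [lintegral_withDensity_eq_lintegral_mul _ (by fun_prop) hg,
    ← lintegral_indicator measurableSet_Ioi]
  refine lintegral_mono fun σ => ?_
  by_cases hσ : 0 < σ
  · rw [Set.indicator_of_mem (Set.mem_Ioi.2 hσ), Pi.mul_apply, max_eq_left hσ.le]
  · rw [Pi.mul_apply, max_eq_right (not_lt.1 hσ)]
    simp

theorem integral_le {g : ℝ → ℝ} (hg : Measurable g) (hg0 : ∀ s, 0 < s → 0 ≤ g s)
    (hi : IntegrableOn (fun σ => σ * g σ) (Set.Ioi 0)) :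
    Integrable g m ∧ ∫ s, g s ∂m ≤ 2 * M / Real.pi * ∫ σ in Set.Ioi 0, σ * g σ := by
  have hc : 0 ≤ 2 * M / Real.pi := div_nonneg (by linarith [h.nonneg]) Real.pi_pos.le
  have h0 : 0 ≤ᵐ[m] g := by
    filter_upwards [h.pos] with s hs using hg0 s hs
  have h1 : ∫⁻ s, ENNReal.ofReal (g s) ∂m ≤
      ENNReal.ofReal (2 * M / Real.pi * ∫ σ in Set.Ioi 0, σ * g σ) := by
    refine (h.lintegral_le hg.ennreal_ofReal).trans ?_
    rw [← integral_const_mul, ofReal_integral_eq_lintegral_ofReal (hi.const_mul _)]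
    · refine setLIntegral_mono' measurableSet_Ioi fun σ hσ => ?_
      rw [← ENNReal.ofReal_mul (mul_nonneg hc (le_of_lt hσ)), mul_assoc]
    · refine (ae_restrict_iff' measurableSet_Ioi).2 (Filter.Eventually.of_forall fun σ hσ => ?_)
      exact mul_nonneg hc (mul_nonneg (le_of_lt hσ) (hg0 σ hσ))
  have hint : Integrable g m := by
    refine (lintegral_ofReal_ne_top_iff_integrable hg.aestronglyMeasurable h0).1 ?_
    exact (h1.trans_lt ENNReal.ofReal_lt_top).ne
  refine ⟨hint, ?_⟩
  rw [← ENNReal.ofReal_le_ofReal_iff, ofReal_integral_eq_lintegral_ofReal hint h0]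
  · exact h1
  · refine mul_nonneg hc (setIntegral_nonneg measurableSet_Ioi fun σ hσ => ?_)
    exact mul_nonneg (le_of_lt hσ) (hg0 σ hσ)

/-- On `(0, 1]` the factor `σ` in the density cancels the singularity; on `(1, ∞)` the function is
at most `1` and `m` is finite. -/
theorem integrable_inv : Integrable (fun s : ℝ => s⁻¹) m := by
  have := h.finite
  have h1 : Integrable ((Set.Iic (1 : ℝ)).indicator fun s => s⁻¹) m := by
    refine (h.integral_le ?_ ?_ ?_).1
    · exact measurable_inv.indicator measurableSet_Iic
    · intro s hs
      exact Set.indicator_apply_nonneg fun _ => inv_nonneg.2 hs.le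
    · have : Set.EqOn (fun σ : ℝ => σ * (Set.Iic (1 : ℝ)).indicator (fun s => s⁻¹) σ)
          ((Set.Iic (1 : ℝ)).indicator fun _ => 1) (Set.Ioi 0) := by
        intro σ hσ
        by_cases h1 : σ ∈ Set.Iic (1 : ℝ)
        · simp only [Set.indicator_of_mem h1]
          exact mul_inv_cancel₀ (ne_of_gt hσ)
        · simp only [Set.indicator_of_notMem h1, mul_zero]
      refine (integrableOn_congr_fun this measurableSet_Ioi).2 ?_
      rw [IntegrableOn, integrable_indicator_iff measurableSet_Iic, IntegrableOn,
        Measure.restrict_restrict measurableSet_Iic]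
      refine integrableOn_const ?_
      rw [Set.inter_comm, Set.Ioi_inter_Iic]
      simp
  refine (h1.add (integrable_const (1 : ℝ))).mono' measurable_inv.aestronglyMeasurable ?_
  filter_upwards [h.pos] with s hs
  rw [Real.norm_of_nonneg (by positivity), Pi.add_apply]
  by_cases h2 : s ∈ Set.Iic (1 : ℝ)
  · rw [Set.indicator_of_mem h2]; linarith
  · rw [Set.indicator_of_notMem h2, zero_add]
    exact inv_le_one_of_one_le₀ (not_le.1 h2).le

end DensityBound

/-- The Cauchy density. -/
theorem integral_cauchy {l ε : ℝ} (hε : 0 < ε) :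
    Integrable (fun σ : ℝ => ε / ((σ - l) ^ 2 + ε ^ 2)) ∧
      ∫ σ : ℝ, ε / ((σ - l) ^ 2 + ε ^ 2) = Real.pi := by
  have e : (fun σ : ℝ => ε / ((σ - l) ^ 2 + ε ^ 2)) =
      fun σ => ε⁻¹ * (fun y : ℝ => (1 + (y / ε) ^ 2)⁻¹) (σ - l) := by
    ext σ
    have h1 : (σ - l) ^ 2 + ε ^ 2 ≠ 0 := by positivity
    have h2 : 1 + ((σ - l) / ε) ^ 2 ≠ 0 := by positivity
    field_simp
    ring
  constructor
  · rw [e]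
    exact ((integrable_inv_one_add_sq.comp_div hε.ne').comp_sub_right l).const_mul _
  · rw [e, integral_const_mul, integral_sub_right_eq_self (fun y : ℝ => (1 + (y / ε) ^ 2)⁻¹) l,
      Measure.integral_comp_div (fun y : ℝ => (1 + y ^ 2)⁻¹) ε, integral_univ_inv_one_add_sq,
      abs_of_pos hε, smul_eq_mul, inv_mul_cancel_left₀ hε.ne']

theorem integral_Ioi_cauchy {c : ℝ} (hc : 0 < c) :
    IntegrableOn (fun σ : ℝ => c / (σ ^ 2 + c ^ 2)) (Set.Ioi 0) ∧
      ∫ σ in Set.Ioi (0 : ℝ), c / (σ ^ 2 + c ^ 2) = Real.pi / 2 := by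
  have e : (fun σ : ℝ => c / (σ ^ 2 + c ^ 2)) =
      fun σ => c⁻¹ * (fun y : ℝ => (1 + y ^ 2)⁻¹) (c⁻¹ * σ) := by
    ext σ
    have h1 : σ ^ 2 + c ^ 2 ≠ 0 := by positivity
    have h2 : 1 + (c⁻¹ * σ) ^ 2 ≠ 0 := by positivity
    field_simp
    ring
  constructor
  · have := (integral_cauchy (l := 0) hc).1.integrableOn (s := Set.Ioi 0)
    simpa using this
  · rw [e, integral_const_mul, integral_comp_mul_left_Ioi (fun y : ℝ => (1 + y ^ 2)⁻¹) 0
      (inv_pos.2 hc), mul_zero, integral_Ioi_inv_one_add_sq, Real.arctan_zero, sub_zero, inv_inv,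
      smul_eq_mul, inv_mul_cancel_left₀ hc.ne']

namespace DensityBound

variable {m : Measure ℝ} {M : ℝ} (h : DensityBound m M)
include h

/-- The bound behind `√T`-smoothness. -/
theorem integral_poisson_le {l ε : ℝ} (hε : 0 < ε) :
    Integrable (fun s => s⁻¹ * (ε / ((s - l) ^ 2 + ε ^ 2))) m ∧
      ∫ s, s⁻¹ * (ε / ((s - l) ^ 2 + ε ^ 2)) ∂m ≤ 2 * M := by
  have hc : 0 ≤ 2 * M / Real.pi := div_nonneg (by linarith [h.nonneg]) Real.pi_pos.le
  -- The `σ` of the density cancels `s⁻¹` and leaves the Cauchy kernel, whose mass over the whole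
  -- line is `π`.
  have he : Set.EqOn (fun σ : ℝ => σ * (σ⁻¹ * (ε / ((σ - l) ^ 2 + ε ^ 2))))
      (fun σ : ℝ => ε / ((σ - l) ^ 2 + ε ^ 2)) (Set.Ioi 0) := fun σ hσ =>
    mul_inv_cancel_left₀ (ne_of_gt hσ) _
  obtain ⟨h1, h2⟩ := integral_cauchy (l := l) hε
  have h3 := h.integral_le (g := fun s => s⁻¹ * (ε / ((s - l) ^ 2 + ε ^ 2))) (by fun_prop)
    (fun s hs => by positivity)
    ((integrableOn_congr_fun he measurableSet_Ioi).2 h1.integrableOn)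
  refine ⟨h3.1, h3.2.trans ?_⟩
  rw [setIntegral_congr_fun measurableSet_Ioi he]
  calc _ ≤ 2 * M / Real.pi * ∫ σ : ℝ, ε / ((σ - l) ^ 2 + ε ^ 2) := by
        refine mul_le_mul_of_nonneg_left (setIntegral_le_integral h1
          (Filter.Eventually.of_forall fun σ => ?_)) hc
        simp only [Pi.zero_apply]; positivity
    _ = 2 * M := by rw [h2]; have := Real.pi_pos.ne'; field_simp

/-- The same cancellation for the kernel centred at `0`. Only half of its mass, `π / 2`, lies over
the half-line, hence `M` instead of `2 M`. -/
theorem integral_inv_mul_le {c : ℝ} (hc : 0 < c) :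
    Integrable (fun s => s⁻¹ * (c / (s ^ 2 + c ^ 2))) m ∧
      ∫ s, s⁻¹ * (c / (s ^ 2 + c ^ 2)) ∂m ≤ M := by
  have he : Set.EqOn (fun σ : ℝ => σ * (σ⁻¹ * (c / (σ ^ 2 + c ^ 2))))
      (fun σ : ℝ => c / (σ ^ 2 + c ^ 2)) (Set.Ioi 0) := fun σ hσ =>
    mul_inv_cancel_left₀ (ne_of_gt hσ) _
  obtain ⟨h1, h2⟩ := integral_Ioi_cauchy hc
  have h3 := h.integral_le (g := fun s => s⁻¹ * (c / (s ^ 2 + c ^ 2))) (by fun_prop)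
    (fun s hs => by positivity)
    ((integrableOn_congr_fun he measurableSet_Ioi).2 h1)
  refine ⟨h3.1, h3.2.trans (le_of_eq ?_)⟩
  rw [setIntegral_congr_fun measurableSet_Ioi he, h2]
  have := Real.pi_pos.ne'
  field_simp

end DensityBound

end

section

/-! ### Measures with bounded Cauchy transform -/

theorem sq_sub_ne_zero {ζ : ℂ} (hζ : ζ.im ≠ 0 ∨ ζ.re < 0) (s : ℝ) : (s : ℂ) ^ 2 - ζ ≠ 0 := by
  intro h
  have h1 : ζ = ((s ^ 2 : ℝ) : ℂ) := by push_cast; exact (sub_eq_zero.1 h).symm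
  rw [h1] at hζ
  simp only [Complex.ofReal_im, ne_eq, not_true_eq_false, Complex.ofReal_re, false_or] at hζ
  nlinarith [sq_nonneg s]

theorem continuous_sq_sub_inv {ζ : ℂ} (hζ : ζ.im ≠ 0 ∨ ζ.re < 0) :
    Continuous fun s : ℝ => ((s : ℂ) ^ 2 - ζ)⁻¹ :=
  Continuous.inv₀ (by fun_prop) (sq_sub_ne_zero hζ)

theorem norm_sq_sub_inv_le {ζ : ℂ} (hζ : ζ.im ≠ 0) (s : ℝ) :
    ‖((s : ℂ) ^ 2 - ζ)⁻¹‖ ≤ |ζ.im|⁻¹ := by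
  rw [norm_inv]
  refine inv_anti₀ (abs_pos.2 hζ) ?_
  refine le_trans (le_of_eq ?_) (Complex.abs_im_le_norm _)
  rw [Complex.sub_im, ← Complex.ofReal_pow, Complex.ofReal_im, zero_sub, abs_neg]

/-- The Cauchy transform in the variable `s ^ 2`. -/
def cauchy (m : Measure ℝ) (ζ : ℂ) : ℂ := ∫ s, ((s : ℂ) ^ 2 - ζ)⁻¹ ∂m

/-! ### Extension of the Cauchy transform bound beyond the strip -/

section

variable {m : Measure ℝ} [IsFiniteMeasure m]

theorem norm_sq_sub_inv_le_re {ζ : ℂ} (hζ : ζ.re < 0) (s : ℝ) :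
    ‖((s : ℂ) ^ 2 - ζ)⁻¹‖ ≤ (-ζ.re)⁻¹ := by
  rw [norm_inv]
  refine inv_anti₀ (by linarith) ?_
  refine le_trans ?_ (Complex.re_le_norm _)
  rw [Complex.sub_re, ← Complex.ofReal_pow, Complex.ofReal_re]
  nlinarith [sq_nonneg s]

theorem integrable_sq_sub_inv {ζ : ℂ} (hζ : ζ.im ≠ 0 ∨ ζ.re < 0) :
    Integrable (fun s : ℝ => ((s : ℂ) ^ 2 - ζ)⁻¹) m := by
  have hc := (continuous_sq_sub_inv hζ).aestronglyMeasurable (μ := m)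
  rcases hζ with h | h
  · exact Integrable.of_bound hc _ (Filter.Eventually.of_forall (norm_sq_sub_inv_le h))
  · exact Integrable.of_bound hc _ (Filter.Eventually.of_forall (norm_sq_sub_inv_le_re h))

omit [IsFiniteMeasure m] in
theorem cauchy_conj (ζ : ℂ) : cauchy m (starRingEnd ℂ ζ) = starRingEnd ℂ (cauchy m ζ) := by
  unfold cauchy
  rw [← integral_conj]
  simp

theorem differentiableAt_cauchy {ζ₀ : ℂ} (h0 : 0 < ζ₀.im) : DifferentiableAt ℂ (cauchy m) ζ₀ := by
  have hS : {ζ : ℂ | ζ₀.im / 2 < ζ.im} ∈ nhds ζ₀ :=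
    (isOpen_lt continuous_const Complex.continuous_im).mem_nhds (by simp [h0])
  have hpos : ∀ ζ ∈ {ζ : ℂ | ζ₀.im / 2 < ζ.im}, 0 < ζ.im := fun ζ hζ =>
    (half_pos h0).trans hζ
  refine (hasDerivAt_integral_of_dominated_loc_of_deriv_le (μ := m)
    (F := fun ζ s => ((s : ℂ) ^ 2 - ζ)⁻¹) (F' := fun ζ s => (((s : ℂ) ^ 2 - ζ)⁻¹) ^ 2)
    (bound := fun _ => ((ζ₀.im / 2)⁻¹) ^ 2) hS ?_ ?_ ?_ ?_ ?_ ?_).2.differentiableAt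
  · filter_upwards [hS] with ζ hζ
    exact (continuous_sq_sub_inv (Or.inl (hpos ζ hζ).ne')).aestronglyMeasurable
  · exact integrable_sq_sub_inv (Or.inl h0.ne')
  · exact ((continuous_sq_sub_inv (Or.inl h0.ne')).pow 2).aestronglyMeasurable
  · refine Filter.Eventually.of_forall fun s ζ hζ => ?_
    rw [norm_pow]
    refine pow_le_pow_left₀ (norm_nonneg _) ((norm_sq_sub_inv_le (hpos ζ hζ).ne' s).trans ?_) 2
    rw [abs_of_pos (hpos ζ hζ)]
    exact inv_anti₀ (half_pos h0) (le_of_lt hζ)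
  · exact integrable_const _
  · refine Filter.Eventually.of_forall fun s ζ hζ => ?_
    have hne := sq_sub_ne_zero (Or.inl (hpos ζ hζ).ne') s
    refine (((hasDerivAt_id ζ).const_sub ((s : ℂ) ^ 2)).inv hne).congr_deriv ?_
    simp [neg_neg, inv_pow]

/-- Above the line `Im ζ = ε₀ / 2`, which lies inside the strip of the hypothesis, the transform is
holomorphic and bounded by the crude constant `2 m(ℝ) / ε₀`. Phragmén–Lindelöf then carries the
bound `M` from the line to the half-plane. -/
theorem cauchy_bound_of_im_pos {M ε₀ : ℝ} (hε₀ : 0 < ε₀)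
    (hS : ∀ ε l : ℝ, 0 < |ε| → |ε| < ε₀ → ‖cauchy m (l + ε * Complex.I)‖ ≤ M)
    {ζ : ℂ} (hζ : 0 < ζ.im) : ‖cauchy m ζ‖ ≤ M := by
  have hS' : ∀ ζ : ℂ, 0 < ζ.im → ζ.im < ε₀ → ‖cauchy m ζ‖ ≤ M := by
    intro ζ h1 h2
    have := hS ζ.im ζ.re (abs_pos.2 h1.ne') (by rwa [abs_of_pos h1])
    rwa [Complex.re_add_im] at this
  by_cases hlt : ζ.im < ε₀
  · exact hS' ζ hζ hlt
  set δ := ε₀ / 2 with hδ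
  have hδ0 : 0 < δ := half_pos hε₀
  -- Maps the right half-plane to `Im > δ` and the imaginary axis to the line `Im = δ`.
  let g : ℂ → ℂ := fun w => Complex.I * (w + δ)
  have gim : ∀ w, (g w).im = w.re + δ := fun w => by simp [g]
  have hz : g (-Complex.I * ζ - δ) = ζ := by
    simp only [g, sub_add_cancel]
    rw [← mul_assoc, mul_neg, Complex.I_mul_I, neg_neg, one_mul]
  rw [← hz]
  have hK : ∀ w : ℂ, 0 ≤ w.re → ‖cauchy m (g w)‖ ≤ δ⁻¹ * m.real Set.univ := by
    intro w hw
    refine norm_integral_le_of_norm_le_const (Filter.Eventually.of_forall fun s => ?_)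
    have hp : 0 < (g w).im := by rw [gim]; linarith
    refine (norm_sq_sub_inv_le hp.ne' s).trans ?_
    rw [abs_of_pos hp]
    refine inv_anti₀ hδ0 ?_
    rw [gim]; linarith
  refine PhragmenLindelof.right_half_plane_of_bounded_on_real (f := fun w => cauchy m (g w))
    ?_ ⟨0, by norm_num, 0, ?_⟩ ?_ ?_ ?_
  · refine DifferentiableOn.diffContOnCl fun w hw => ?_
    have hw' : 0 ≤ w.re := by
      have hcl : IsClosed {w : ℂ | 0 ≤ w.re} := isClosed_le continuous_const Complex.continuous_re
      have hsub : {w : ℂ | 0 < w.re} ⊆ {w : ℂ | 0 ≤ w.re} := fun w (hw : 0 < w.re) => (show 0 ≤ w.re from hw.le)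
      exact closure_minimal hsub hcl hw
    refine DifferentiableAt.differentiableWithinAt ?_
    have h1 : DifferentiableAt ℂ (cauchy m) (g w) :=
      differentiableAt_cauchy (by rw [gim]; linarith)
    have h2 : DifferentiableAt ℂ g w := by fun_prop
    exact h1.comp w h2
  · refine Asymptotics.IsBigO.of_bound (δ⁻¹ * m.real Set.univ) ?_
    refine Filter.eventually_inf_principal.2 (Filter.Eventually.of_forall fun w hw => ?_)
    simp only [zero_mul, Real.exp_zero, norm_one, mul_one]
    exact hK w (le_of_lt hw)
  · refine ⟨δ⁻¹ * m.real Set.univ, Filter.eventually_map.2 ?_⟩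
    filter_upwards [Filter.eventually_ge_atTop (0 : ℝ)] with x hx
    exact hK x (by simpa using hx)
  · intro x
    refine hS' _ ?_ ?_
    · rw [gim]; simp [hδ0]
    · rw [gim]; simp [hδ, hε₀]
  · have h1 : (-Complex.I * ζ - δ).re = ζ.im - δ := by simp
    rw [h1]
    have := not_lt.1 hlt
    linarith

/-- The lower half-plane follows by conjugation, and the negative axis by letting the imaginary part
tend to `0`. -/
theorem cauchy_bound {M ε₀ : ℝ} (hε₀ : 0 < ε₀)
    (hS : ∀ ε l : ℝ, 0 < |ε| → |ε| < ε₀ → ‖cauchy m (l + ε * Complex.I)‖ ≤ M)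
    {ζ : ℂ} (hζ : ζ.im ≠ 0 ∨ ζ.re < 0) : ‖cauchy m ζ‖ ≤ M := by
  have him : ∀ ζ : ℂ, ζ.im ≠ 0 → ‖cauchy m ζ‖ ≤ M := by
    intro ζ hζ
    rcases lt_or_gt_of_ne hζ with h | h
    · have := cauchy_bound_of_im_pos hε₀ hS (ζ := starRingEnd ℂ ζ) (by simpa using h)
      rwa [cauchy_conj, RCLike.norm_conj] at this
    · exact cauchy_bound_of_im_pos hε₀ hS h
  by_cases h : ζ.im = 0
  swap
  · exact him ζ h
  have hre : ζ.re < 0 := hζ.resolve_left (not_not.2 h)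
  let z : ℕ → ℂ := fun n => ζ + (((n : ℝ) + 1)⁻¹ : ℝ) * Complex.I
  have hz : Filter.Tendsto z Filter.atTop (nhds ζ) := by
    have h1 : Filter.Tendsto (fun n : ℕ => ((n : ℝ) + 1)⁻¹) Filter.atTop (nhds 0) := by
      simpa using tendsto_one_div_add_atTop_nhds_zero_nat (𝕜 := ℝ)
    have h2 := ((Complex.continuous_ofReal.tendsto _).comp h1).mul_const Complex.I
    have h3 := h2.const_add ζ
    rwa [Complex.ofReal_zero, zero_mul, add_zero] at h3
  have hzre : ∀ n, (z n).re = ζ.re := fun n => by simp [z]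
  have hlim : Filter.Tendsto (fun n => cauchy m (z n)) Filter.atTop (nhds (cauchy m ζ)) := by
    refine tendsto_integral_of_dominated_convergence (fun _ => (-ζ.re)⁻¹) ?_
      (integrable_const _) ?_ ?_
    · exact fun n => (continuous_sq_sub_inv (Or.inr (by rw [hzre]; exact hre))).aestronglyMeasurable
    · refine fun n => Filter.Eventually.of_forall fun s => ?_
      have := norm_sq_sub_inv_le_re (ζ := z n) (by rw [hzre]; exact hre) s
      rwa [hzre] at this
    · refine Filter.Eventually.of_forall fun s => ?_
      exact (tendsto_const_nhds.sub hz).inv₀ (sq_sub_ne_zero hζ s)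
  refine le_of_tendsto hlim.norm (Filter.Eventually.of_forall fun n => him _ ?_)
  simp only [z, Complex.add_im, h, zero_add, Complex.im_ofReal_mul, Complex.I_im, mul_one]
  positivity

end

/-- Density bound together with a bound for the Cauchy transform. -/
structure CauchyBound (m : Measure ℝ) (M : ℝ) : Prop extends DensityBound m M where
  cauchy_le : ∀ ζ : ℂ, ζ.im ≠ 0 ∨ ζ.re < 0 → ‖cauchy m ζ‖ ≤ M

/-! ### Kernel estimates for the resolvent of `√T` -/

namespace CauchyBound

variable {m : Measure ℝ} {M : ℝ} (h : CauchyBound m M)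
include h

/-- At the negative point `-c` the integrand is positive, so a bound on the Cauchy transform is a
bound on the integral. -/
theorem integral_inv_add_le {c : ℝ} (hc : 0 < c) :
    Integrable (fun s : ℝ => (s ^ 2 + c)⁻¹) m ∧ ∫ s, (s ^ 2 + c)⁻¹ ∂m ≤ M := by
  have := h.finite
  have hre : ((-c : ℝ) : ℂ).im ≠ 0 ∨ ((-c : ℝ) : ℂ).re < 0 := Or.inr (by simpa using hc)
  have h1 := h.cauchy_le _ hre
  have h2 := integrable_sq_sub_inv (m := m) hre
  have e : ∀ s : ℝ, ((s : ℂ) ^ 2 - ((-c : ℝ) : ℂ))⁻¹ = (((s ^ 2 + c)⁻¹ : ℝ) : ℂ) := by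
    intro s; push_cast; rw [sub_neg_eq_add]
  unfold cauchy at h1
  simp_rw [e] at h1 h2
  rw [integral_complex_ofReal, Complex.norm_real] at h1
  refine ⟨h2.re.congr (Filter.Eventually.of_forall fun s => ?_), (le_abs_self _).trans h1⟩
  exact Complex.ofReal_re _

/-- Letting `c → 0` in `integral_inv_add_le`, Fatou's lemma gives `∫ s⁻² dm ≤ M`. This places `A† u`
in the domain of `T^{-1/2}`. -/
theorem memLp_inv : MemLp (fun s : ℝ => ((s⁻¹ : ℝ) : ℂ)) 2 m := by
  have h1 : ∫⁻ s, ENNReal.ofReal (s⁻¹ ^ 2) ∂m ≤ ENNReal.ofReal M := by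
    have hl : ∀ᵐ s ∂m, ENNReal.ofReal (s⁻¹ ^ 2) =
        Filter.liminf (fun n : ℕ => ENNReal.ofReal ((s ^ 2 + ((n : ℝ) + 1)⁻¹)⁻¹)) Filter.atTop := by
      filter_upwards [h.pos] with s hs
      refine (Filter.Tendsto.liminf_eq ?_).symm
      refine (ENNReal.continuous_ofReal.tendsto _).comp ?_
      have h1 : Filter.Tendsto (fun n : ℕ => ((n : ℝ) + 1)⁻¹) Filter.atTop (nhds 0) := by
        simpa using tendsto_one_div_add_atTop_nhds_zero_nat (𝕜 := ℝ)
      have h2 := (h1.const_add (s ^ 2)).inv₀ (by positivity)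
      simpa using h2
    rw [lintegral_congr_ae hl]
    refine (lintegral_liminf_le fun n => by fun_prop).trans ?_
    refine (Filter.liminf_le_liminf (Filter.Eventually.of_forall fun n => ?_)).trans
      (Filter.liminf_const (ENNReal.ofReal M)).le
    obtain ⟨i1, i2⟩ := h.integral_inv_add_le (c := ((n : ℝ) + 1)⁻¹) (by positivity)
    rw [← ofReal_integral_eq_lintegral_ofReal i1
      (Filter.Eventually.of_forall fun s => by simp only [Pi.zero_apply]; positivity)]
    exact ENNReal.ofReal_le_ofReal i2
  refine MemLp.ofReal ?_
  refine (memLp_two_iff_integrable_sq measurable_inv.aestronglyMeasurable).2 ?_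
  refine (lintegral_ofReal_ne_top_iff_integrable (by fun_prop)
    (Filter.Eventually.of_forall fun s => by simp only [Pi.zero_apply]; positivity)).1 ?_
  exact (h1.trans_lt ENNReal.ofReal_lt_top).ne

omit h in
theorem norm_cutoff_le {N : ℝ} (hN : 0 < N) (s : ℝ) : ‖((N / (s ^ 2 + N) : ℝ) : ℂ)‖ ≤ 1 := by
  rw [Complex.norm_real, Real.norm_of_nonneg (by positivity), div_le_one (by positivity)]
  nlinarith [sq_nonneg s]

omit h in
theorem norm_sub_inv_le {z : ℂ} (hz : z.im ≠ 0) (s : ℝ) : ‖((s : ℂ) - z)⁻¹‖ ≤ |z.im|⁻¹ := by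
  rw [norm_inv]
  refine inv_anti₀ (abs_pos.2 hz) ?_
  refine le_trans (le_of_eq ?_) (Complex.abs_im_le_norm _)
  rw [Complex.sub_im, Complex.ofReal_im, zero_sub, abs_neg]

omit h in
theorem continuous_sub_inv {z : ℂ} (hz : z.im ≠ 0) : Continuous fun s : ℝ => ((s : ℂ) - z)⁻¹ := by
  refine Continuous.inv₀ (by fun_prop) fun s h => hz ?_
  rw [← sub_eq_zero.1 h, Complex.ofReal_im]

theorem integrable_kernel {z : ℂ} (hz : z.im ≠ 0) {N : ℝ} (hN : 0 < N) :
    Integrable (fun s : ℝ => ((N / (s ^ 2 + N) : ℝ) : ℂ) * ((s : ℂ) * ((s : ℂ) - z))⁻¹) m := by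
  refine (h.integrable_inv.mul_const |z.im|⁻¹).mono' ?_ ?_
  · have h1 : Measurable fun s : ℝ => ((s : ℂ) - z)⁻¹ := (continuous_sub_inv hz).measurable
    simp_rw [mul_inv]
    fun_prop
  · filter_upwards [h.pos] with s hs
    rw [norm_mul, mul_inv, norm_mul, norm_inv (s : ℂ), Complex.norm_real s,
      Real.norm_of_nonneg hs.le]
    refine (mul_le_of_le_one_left (by positivity) (norm_cutoff_le hN s)).trans ?_
    exact mul_le_mul_of_nonneg_left (norm_sub_inv_le hz s) (by positivity)

/-- For `Re z ≤ 0` and `c = ‖z‖` one has `|s - z|² ≥ s² + c²`, and `(s + c)² ≥ s² + c²`. Hence `1 /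
(s |s - z|) ≤ (s + c) / (s (s² + c²))`, which is the sum of two kernels with integral at most `M`
each. The cutoff is at most `1` and is dropped. -/
theorem kernel_le_of_re_nonpos {z : ℂ} (hz : z.im ≠ 0) (hre : z.re ≤ 0) {N : ℝ} (hN : 0 < N) :
    ‖∫ s, ((N / (s ^ 2 + N) : ℝ) : ℂ) * ((s : ℂ) * ((s : ℂ) - z))⁻¹ ∂m‖ ≤ 2 * M := by
  set c := ‖z‖ with hc
  have hc0 : 0 < c := norm_pos_iff.2 fun h => hz (by rw [h, Complex.zero_im])
  obtain ⟨i1, b1⟩ := h.integral_inv_add_le (c := c ^ 2) (by positivity)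
  obtain ⟨i2, b2⟩ := h.integral_inv_mul_le hc0
  calc _ ≤ ∫ s, ((s ^ 2 + c ^ 2)⁻¹ + s⁻¹ * (c / (s ^ 2 + c ^ 2))) ∂m := by
        refine norm_integral_le_of_norm_le (i1.add i2) ?_
        filter_upwards [h.pos] with s hs
        rw [norm_mul]
        refine (mul_le_of_le_one_left (norm_nonneg _) (norm_cutoff_le hN s)).trans ?_
        have hd : 0 < s ^ 2 + c ^ 2 := by positivity
        rw [norm_inv, norm_mul, Complex.norm_real, Real.norm_of_nonneg hs.le]
        have hn : s ^ 2 + c ^ 2 ≤ ‖(s : ℂ) - z‖ ^ 2 := by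
          rw [hc, ← Complex.normSq_eq_norm_sq, ← Complex.normSq_eq_norm_sq, Complex.normSq_apply,
            Complex.normSq_apply]
          simp only [Complex.sub_re, Complex.ofReal_re, Complex.sub_im, Complex.ofReal_im]
          nlinarith
        have hn0 : 0 < ‖(s : ℂ) - z‖ := by
          by_contra hcon
          have : ‖(s : ℂ) - z‖ = 0 := le_antisymm (not_lt.1 hcon) (norm_nonneg _)
          rw [this] at hn
          nlinarith
        have e : (s ^ 2 + c ^ 2)⁻¹ + s⁻¹ * (c / (s ^ 2 + c ^ 2)) =
            (s + c) / (s * (s ^ 2 + c ^ 2)) := by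
          field_simp
        rw [e, inv_eq_one_div, div_le_div_iff₀ (by positivity) (by positivity), one_mul]
        have h3 : s ^ 2 + c ^ 2 ≤ (s + c) * ‖(s : ℂ) - z‖ := by
          have h4 : (s ^ 2 + c ^ 2) ^ 2 ≤ ((s + c) * ‖(s : ℂ) - z‖) ^ 2 := by
            rw [mul_pow, sq (s ^ 2 + c ^ 2)]
            refine mul_le_mul ?_ hn hd.le (by positivity)
            nlinarith
          exact (pow_le_pow_iff_left₀ hd.le (by positivity) two_ne_zero).1 h4
        nlinarith
    _ ≤ 2 * M := by rw [integral_add i1 i2]; linarith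

/-- The bound behind `√T`-supersmoothness. -/
theorem kernel_le {z : ℂ} (hz : z.im ≠ 0) {N : ℝ} (hN : ‖z‖ ^ 2 < N) :
    ‖∫ s, ((N / (s ^ 2 + N) : ℝ) : ℂ) * ((s : ℂ) * ((s : ℂ) - z))⁻¹ ∂m‖ ≤
      (4 * ‖(N : ℂ) / (N + z ^ 2)‖ + 2) * M := by
  have hN0 : 0 < N := (sq_nonneg _).trans_lt hN
  have hM := h.nonneg
  have hfin := h.finite
  rcases le_or_gt z.re 0 with hre | hre
  · refine (h.kernel_le_of_re_nonpos hz hre hN0).trans ?_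
    nlinarith [norm_nonneg ((N : ℂ) / (N + z ^ 2))]
  have hζ : (z ^ 2).im ≠ 0 ∨ (z ^ 2).re < 0 := by
    left
    rw [sq, Complex.mul_im]
    have : z.re * z.im ≠ 0 := mul_ne_zero hre.ne' hz
    intro h0
    exact this (by linarith)
  have hneg : (-z).im ≠ 0 := by simpa using hz
  have hD : (N : ℂ) + z ^ 2 ≠ 0 := by
    intro h0
    have h1 : ‖z ^ 2‖ = N := by
      rw [show z ^ 2 = -(N : ℂ) by linear_combination h0, norm_neg, Complex.norm_real,
        Real.norm_of_nonneg hN0.le]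
    rw [norm_pow] at h1
    linarith
  have hb2 := h.kernel_le_of_re_nonpos hneg (by simpa using hre.le) hN0
  have i2 := h.integrable_kernel hneg hN0
  obtain ⟨iN, bN⟩ := h.integral_inv_add_le hN0
  have i1 := integrable_sq_sub_inv (m := m) hζ
  have b1 := h.cauchy_le _ hζ
  have iN' : Integrable (fun s : ℝ => (((s ^ 2 + N)⁻¹ : ℝ) : ℂ)) m := iN.ofReal
  -- Two partial fractions: `1 / (s (s - z)) = 2 / (s² - z²) - 1 / (s (s + z))`, and the cutoff
  -- times `1 / (s² - z²)` is `N / (N + z²)` times `1 / (s² - z²) - 1 / (s² + N)`. The last term has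
  -- pole `-z`, of negative real part.
  have key : ∀ᵐ s ∂m, ((N / (s ^ 2 + N) : ℝ) : ℂ) * ((s : ℂ) * ((s : ℂ) - z))⁻¹ =
      2 * ((N : ℂ) / (N + z ^ 2)) * (((s : ℂ) ^ 2 - z ^ 2)⁻¹ - (((s ^ 2 + N)⁻¹ : ℝ) : ℂ)) -
      ((N / (s ^ 2 + N) : ℝ) : ℂ) * ((s : ℂ) * ((s : ℂ) - -z))⁻¹ := by
    filter_upwards [h.pos] with s hs
    have a1 : (s : ℂ) ≠ 0 := by exact_mod_cast hs.ne'
    have a2 : (s : ℂ) - z ≠ 0 := fun h0 => hz (by rw [← sub_eq_zero.1 h0, Complex.ofReal_im])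
    have a3 : (s : ℂ) + z ≠ 0 := fun h0 => hneg (by
      rw [← sub_neg_eq_add] at h0; rw [← sub_eq_zero.1 h0, Complex.ofReal_im])
    have a4 : (s : ℂ) ^ 2 + N ≠ 0 := by
      have : s ^ 2 + N ≠ 0 := by positivity
      exact_mod_cast this
    push_cast
    rw [show (s : ℂ) ^ 2 - z ^ 2 = (s - z) * (s + z) by ring, sub_neg_eq_add]
    field_simp
    ring
  have i3 : Integrable (fun s : ℝ => 2 * ((N : ℂ) / (N + z ^ 2)) *
      (((s : ℂ) ^ 2 - z ^ 2)⁻¹ - (((s ^ 2 + N)⁻¹ : ℝ) : ℂ))) m := (i1.sub iN').const_mul _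
  rw [integral_congr_ae key, integral_sub i3 i2, integral_const_mul, integral_sub i1 iN']
  refine (norm_sub_le _ _).trans ?_
  rw [norm_mul, norm_mul, Complex.norm_ofNat]
  have h3 : ‖∫ s, ((s : ℂ) ^ 2 - z ^ 2)⁻¹ ∂m - ∫ s, (((s ^ 2 + N)⁻¹ : ℝ) : ℂ) ∂m‖ ≤ M + M := by
    refine (norm_sub_le _ _).trans (add_le_add b1 ?_)
    rw [integral_complex_ofReal, Complex.norm_real, Real.norm_of_nonneg]
    · exact bN
    · exact integral_nonneg fun s => by simp only [Pi.zero_apply]; positivity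
  have := mul_le_mul_of_nonneg_left h3 (by positivity : 0 ≤ 2 * ‖(N : ℂ) / (N + z ^ 2)‖)
  linarith

end CauchyBound

end

section

variable {E : Type*} [NormedAddCommGroup E] [InnerProductSpace ℂ E] [CompleteSpace E]
variable {F : Type*} [NormedAddCommGroup F] [InnerProductSpace ℂ F] [CompleteSpace F]

/-! ### The factorization through the fourth root -/

/-- The power function `μ ^ r` with complex values. -/
def pw (r : ℝ) (μ : ℝ) : ℂ := ((μ ^ r : ℝ) : ℂ)

theorem adm_pw {r : ℝ} (h1 : -1 < r) (h2 : r < 1) : Adm (pw r) := adm_rpow h1 h2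

theorem conj_pw (r μ : ℝ) : starRingEnd ℂ (pw r μ) = pw r μ := Complex.conj_ofReal _

theorem pw_sq {s : ℝ} (hs : 0 < s) (r : ℝ) : pw r (s ^ 2) = ((s ^ (2 * r) : ℝ) : ℂ) := by
  unfold pw
  rw [← Real.rpow_natCast, ← Real.rpow_mul hs.le]
  norm_num

theorem measurable_pw_sq (r : ℝ) : Measurable fun s : ℝ => pw r (s ^ 2) := by
  unfold pw
  fun_prop

theorem pw_mul {μ : ℝ} (hμ : 0 < μ) (r r' : ℝ) : pw r μ * pw r' μ = pw (r + r') μ := by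
  unfold pw
  rw [Real.rpow_add hμ]
  push_cast
  rfl

theorem norm_pw_neg_quarter_sq {s : ℝ} (hs : 0 < s) : ‖pw (-(1 / 4)) (s ^ 2)‖ ^ 2 = s⁻¹ := by
  rw [pw_sq hs, Complex.norm_real, Real.norm_eq_abs, sq_abs, ← Real.rpow_natCast,
    ← Real.rpow_mul hs.le]
  norm_num
  rw [Real.rpow_neg_one]

/-- The symbol of `T^{-1/4}` is `s^{-1/2}`, whose square is `m`-integrable; this makes `T^{-1/4} A†`
defined on all of `D(A†)`. -/
theorem DensityBound.memLp_pw {m : Measure ℝ} {M : ℝ} (h : DensityBound m M) :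
    MemLp (fun s => pw (-(1 / 4)) (s ^ 2)) 2 m := by
  refine (memLp_two_iff_integrable_sq_norm (measurable_pw_sq _).aestronglyMeasurable).2 ?_
  refine h.integrable_inv.congr ?_
  filter_upwards [h.pos] with s hs
  exact (norm_pw_neg_quarter_sq hs).symm

theorem DensityBound.gr_pw {Q : E →L[ℂ] E} {hQ : IsRegularizer Q} {x : E} {M : ℝ}
    (h : DensityBound (hQ.meas x) M) :
    Gr Q (pw (-(1 / 4))) x (hQ.vec x fun s => pw (-(1 / 4)) (s ^ 2)) :=
  hQ.gr_self_vec (adm_pw (by norm_num) (by norm_num)) h.memLp_pw fun _ _ => rfl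

/-- All spectral measures of vectors in the range of `A†` have bounded density. -/
def AdjDensityBound {Q : E →L[ℂ] E} (hQ : IsRegularizer Q) (A : E →ₗ.[ℂ] F) (a : ℝ) : Prop :=
  ∀ u : A†.domain, DensityBound (hQ.meas (A† u)) (a * ‖(u : F)‖ ^ 2)

/-- All spectral measures of vectors in the range of `A†` have bounded Cauchy transform. -/
def AdjCauchyBound {Q : E →L[ℂ] E} (hQ : IsRegularizer Q) (A : E →ₗ.[ℂ] F) (a : ℝ) : Prop :=
  ∀ u : A†.domain, CauchyBound (hQ.meas (A† u)) (a * ‖(u : F)‖ ^ 2)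

theorem AdjCauchyBound.adjDensityBound {Q : E →L[ℂ] E} {hQ : IsRegularizer Q} {A : E →ₗ.[ℂ] F}
    {a : ℝ} (h : AdjCauchyBound hQ A a) : AdjDensityBound hQ A a :=
  fun u => (h u).toDensityBound

/-- The map `T^{-1/4} A†` on `D(A†)`. -/
def AdjDensityBound.quarter {Q : E →L[ℂ] E} {hQ : IsRegularizer Q} {A : E →ₗ.[ℂ] F} {a : ℝ}
    (h : AdjDensityBound hQ A a) : A†.domain →ₗ[ℂ] E where
  toFun u := hQ.vec (A† u) fun s => pw (-(1 / 4)) (s ^ 2)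
  map_add' u v := by
    refine hQ.gr_unique (h (u + v)).gr_pw ?_
    rw [LinearPMap.map_add]
    exact IsRegularizer.gr_add (h u).gr_pw (h v).gr_pw
  map_smul' c u := by
    refine hQ.gr_unique (h (c • u)).gr_pw ?_
    rw [LinearPMap.map_smul]
    exact IsRegularizer.gr_smul c (h u).gr_pw

/-! ### Bounds on the range of the adjoint of `A T^{-1/4}` -/

namespace AdjDensityBound
variable {Q : E →L[ℂ] E} {hQ : IsRegularizer Q} {A : E →ₗ.[ℂ] F} {a : ℝ}
  (h : AdjDensityBound hQ A a)
include h

theorem gr_quarter (u : A†.domain) : Gr Q (pw (-(1 / 4))) (A† u) (h.quarter u) := (h u).gr_pw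

theorem inner_quarter {x f : E} (hx : Gr Q (pw (-(1 / 4))) x f) (u : A†.domain) :
    ⟪h.quarter u, x⟫_ℂ = ⟪A† u, f⟫_ℂ :=
  hQ.gr_symm (adm_pw (by norm_num) (by norm_num)) (conj_pw _) (h.gr_quarter u) hx

theorem bc_quarter {φ : ℝ → ℂ} (hφ : ContinuousOn φ (Set.Icc 0 1)) (u : A†.domain) :
    bc Q φ (h.quarter u) = hQ.vec (A† u) fun s => φ (qs s) * pw (-(1 / 4)) (s ^ 2) :=
  (hQ.rep (A† u)).bc φ _ hφ (h u).memLp_pw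

/-- The spectral measure of `T^{-1/4} A† u` is `s⁻¹ dm`, so the left side is the Poisson integral
estimated by `integral_poisson_le`. -/
theorem resolvent_quarter_le {z : ℂ} (hz : z.im ≠ 0) (u : A†.domain) :
    |z.im| * ‖bc Q (sqrtResSymb z) (h.quarter u)‖ ^ 2 ≤ 2 * (a * ‖(u : F)‖ ^ 2) := by
  have hc := contOn_sqrtResSymb hz
  rw [h.bc_quarter hc, (hQ.rep (A† u)).norm_sq (SpectralRep.memLp_qs_mul hc (h u).memLp_pw),
    ← integral_const_mul]
  refine le_trans (le_of_eq ?_) ((h u).integral_poisson_le (l := z.re) (abs_pos.2 hz)).2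
  refine integral_congr_ae ?_
  filter_upwards [(h u).pos] with s hs
  rw [norm_mul, mul_pow, norm_pw_neg_quarter_sq hs, sqrtResSymb_qs hs, norm_inv, inv_pow,
    Complex.sq_norm, Complex.normSq_apply]
  simp only [Complex.sub_re, Complex.ofReal_re, Complex.sub_im, Complex.ofReal_im, sq_abs]
  rw [div_eq_mul_inv]
  ring_nf

theorem norm_resolvent_quarter_le {z : ℂ} (hz : z.im ≠ 0) :
    ∃ c, ∀ u : A†.domain, ‖bc Q (sqrtResSymb z) (h.quarter u)‖ ≤ c * ‖(u : F)‖ := by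
  refine ⟨√(2 * a / |z.im|), fun u => ?_⟩
  have h1 := h.resolvent_quarter_le hz u
  have h2 : 0 < |z.im| := abs_pos.2 hz
  rw [← Real.sqrt_sq (norm_nonneg (u : F)), ← Real.sqrt_mul' _ (sq_nonneg _)]
  refine Real.le_sqrt_of_sq_le ?_
  rw [div_mul_eq_mul_div, le_div_iff₀ h2]
  linarith

/-- If `w = (A T^{-1/4})† v`, then the resolvent of `√T` at `w` is a limit of its values on the
range of `T^{-1/4} A†`. -/
theorem exists_tendsto_resolvent (hA : A.IsClosed) (hAd : Dense (A.domain : Set E)) {v : F} {w : E}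
    (hw : ∀ x f y, Gr Q (pw (-(1 / 4))) x f → (f, y) ∈ A.graph → ⟪w, x⟫_ℂ = ⟪v, y⟫_ℂ)
    {z : ℂ} (hz : z.im ≠ 0) :
    ∃ u : ℕ → A†.domain, Filter.Tendsto (fun n => (u n : F)) Filter.atTop (nhds v) ∧
      Filter.Tendsto (fun n => bc Q (sqrtResSymb z) (h.quarter (u n))) Filter.atTop
        (nhds (bc Q (sqrtResSymb z) w)) := by
  obtain ⟨u', hu', hlim'⟩ := mem_closure_iff_seq_limit.1 (dense_adjoint_domain hA hAd v)
  let u : ℕ → A†.domain := fun n => ⟨u' n, hu' n⟩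
  have hlim : Filter.Tendsto (fun n => (u n : F)) Filter.atTop (nhds v) := hlim'
  obtain ⟨c, hc⟩ := h.norm_resolvent_quarter_le hz
  have hc0 : ∀ u, ‖bc Q (sqrtResSymb z) (h.quarter u)‖ ≤ |c| * ‖(u : F)‖ := fun u =>
    (hc u).trans (mul_le_mul_of_nonneg_right (le_abs_self c) (norm_nonneg _))
  have hcau : CauchySeq fun n => bc Q (sqrtResSymb z) (h.quarter (u n)) := by
    have hcu := hlim.cauchySeq
    rw [Metric.cauchySeq_iff] at hcu ⊢
    intro ε hε
    obtain ⟨N, hN⟩ := hcu (ε / (|c| + 1)) (by positivity)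
    refine ⟨N, fun m hm n hn => ?_⟩
    have h1 := hN m hm n hn
    rw [dist_eq_norm, lt_div_iff₀ (by positivity)] at h1
    have h2 := hc0 (u m - u n)
    rw [map_sub, map_sub, ← dist_eq_norm] at h2
    have h3 : ‖((u m - u n : A†.domain) : F)‖ = ‖(u m : F) - u n‖ := rfl
    rw [h3] at h2
    nlinarith [norm_nonneg ((u m : F) - u n)]
  obtain ⟨y, hy⟩ := cauchySeq_tendsto_of_complete hcau
  have hσ := contOn_sqrtResSymb hz
  have hz' : (starRingEnd ℂ z).im ≠ 0 := by simpa using hz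
  have hσ' := contOn_sqrtResSymb hz'
  have hσr : ContinuousOn (fun q : ℝ => sqrtResSymb (starRingEnd ℂ z) q *
    ((q : ℂ) * (1 - q))) (Set.Icc 0 1) := hσ'.mul contOn_reg
  have hpw : Adm (pw (-(1 / 4))) := adm_pw (by norm_num) (by norm_num)
  have hρ : ContinuousOn (fun q : ℝ => sqrtResSymb (starRingEnd ℂ z) q *
    regSymb (pw (-(1 / 4))) q) (Set.Icc 0 1) := hσ'.mul hpw
  have hadj : ∀ x p : E, ⟪x, bc Q (fun q : ℝ => sqrtResSymb (starRingEnd ℂ z) q *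
      ((q : ℂ) * (1 - q))) p⟫_ℂ =
      ⟪bc Q (sqrtResSymb z) x, bc Q (fun q => (q : ℂ) * (1 - q)) p⟫_ℂ := by
    intro x p
    rw [IsRegularizer.inner_bc_left, hQ.bc_congr fun q _ => conj_sqrtResSymb z q,
      hQ.bc_mul_apply hσ' contOn_reg]
  -- The limit `y` is identified weakly, against the range of the regularizer, by moving the
  -- resolvent to the other factor.
  have key : ∀ p : E, ⟪y, bc Q (fun q => (q : ℂ) * (1 - q)) p⟫_ℂ =
      ⟪bc Q (sqrtResSymb z) w, bc Q (fun q => (q : ℂ) * (1 - q)) p⟫_ℂ := by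
    intro p
    have hg := hQ.gr_bc_bc (x := p) hpw hσr hρ fun q _ _ => by unfold regSymb; ring
    have e1 : ∀ u : A†.domain, ⟪A† u, bc Q (fun q : ℝ => sqrtResSymb (starRingEnd ℂ z) q *
        regSymb (pw (-(1 / 4))) q) p⟫_ℂ = ⟪bc Q (sqrtResSymb z) (h.quarter u),
          bc Q (fun q => (q : ℂ) * (1 - q)) p⟫_ℂ := by
      intro u
      rw [← h.inner_quarter hg, hadj]
    -- The pairing of this vector with `A† u` is bounded by a multiple of `‖u‖`, so it lies in
    -- `D(A)`. It is also `T^{-1/4}` of a vector, and the hypothesis on `w` applies.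
    obtain ⟨y', hy'⟩ := exists_mem_graph_of_bound hA hAd
      (x := bc Q (fun q : ℝ => sqrtResSymb (starRingEnd ℂ z) q *
        regSymb (pw (-(1 / 4))) q) p)
      (c := c * ‖bc Q (fun q => (q : ℂ) * (1 - q)) p‖) fun u => by
        rw [e1]
        refine (norm_inner_le_norm _ _).trans ?_
        have := mul_le_mul_of_nonneg_right (hc u)
          (norm_nonneg (bc Q (fun q => (q : ℂ) * (1 - q)) p))
        linarith
    have e2 : ∀ u : A†.domain, ⟪(u : F), y'⟫_ℂ = ⟪bc Q (sqrtResSymb z) (h.quarter u),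
          bc Q (fun q => (q : ℂ) * (1 - q)) p⟫_ℂ := by
      intro u
      obtain ⟨hx, rfl⟩ := apply_of_mem_graph hy'
      rw [← e1, ← inner_adjoint_apply hAd u ⟨_, hx⟩]
    rw [← hadj w p, hw _ _ _ hg hy']
    have l1 : Filter.Tendsto (fun n => ⟪(u n : F), y'⟫_ℂ) Filter.atTop (nhds ⟪v, y'⟫_ℂ) :=
      hlim.inner tendsto_const_nhds
    have l2 := hy.inner (𝕜 := ℂ)
      (tendsto_const_nhds (x := bc Q (fun q => (q : ℂ) * (1 - q)) p))
    exact tendsto_nhds_unique (l2.congr fun n => (e2 (u n)).symm) l1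
  refine ⟨u, hlim, ?_⟩
  have : y = bc Q (sqrtResSymb z) w := by
    refine hQ.reg_cancel (ext_inner_right ℂ fun p => ?_)
    rw [IsRegularizer.inner_bc_left, IsRegularizer.inner_bc_left]
    have hr : ∀ q ∈ Set.Icc (0 : ℝ) 1, starRingEnd ℂ ((q : ℂ) * (1 - q)) = (q : ℂ) * (1 - q) :=
      fun q _ => by simp
    rw [hQ.bc_congr hr, key]
  rwa [← this]

theorem norm_resolvent_le (hA : A.IsClosed) (hAd : Dense (A.domain : Set E)) {v : F} {w : E}
    (hw : ∀ x f y, Gr Q (pw (-(1 / 4))) x f → (f, y) ∈ A.graph → ⟪w, x⟫_ℂ = ⟪v, y⟫_ℂ)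
    {z : ℂ} (hz : z.im ≠ 0) :
    |z.im| * ‖bc Q (sqrtResSymb z) w‖ ^ 2 ≤ 2 * (a * ‖v‖ ^ 2) := by
  obtain ⟨u, h1, h2⟩ := h.exists_tendsto_resolvent hA hAd hw hz
  exact le_of_tendsto_of_tendsto ((h2.norm.pow 2).const_mul _)
    (((h1.norm.pow 2).const_mul a).const_mul 2)
    (Filter.Eventually.of_forall fun n => h.resolvent_quarter_le hz (u n))

end AdjDensityBound

/-- The symbol of `N (T + N)⁻¹`. -/
def cutSymb (N : ℝ) (q : ℝ) : ℂ := ((N * q / (N * q + (1 - q)) : ℝ) : ℂ)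

/-- The symbol of `N (T + N)⁻¹ (√T - z̄)`. -/
def cutMulSymb (N : ℝ) (z : ℂ) (q : ℝ) : ℂ :=
  ((N * √q / (N * q + (1 - q)) : ℝ) : ℂ) * ((√(1 - q) : ℝ) - starRingEnd ℂ z * (√q : ℝ))

theorem cut_denom_pos {N : ℝ} (hN : 0 < N) {q : ℝ} (hq : q ∈ Set.Icc (0 : ℝ) 1) :
    0 < N * q + (1 - q) := by
  rcases hq.1.eq_or_lt with rfl | h0
  · norm_num
  · have := hq.2
    have := mul_pos hN h0
    linarith

theorem contOn_cutSymb {N : ℝ} (hN : 0 < N) : ContinuousOn (cutSymb N) (Set.Icc 0 1) := by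
  refine Complex.continuous_ofReal.comp_continuousOn ?_
  exact ContinuousOn.div (by fun_prop) (by fun_prop) fun q hq => (cut_denom_pos hN hq).ne'

theorem contOn_cutMulSymb {N : ℝ} (hN : 0 < N) (z : ℂ) :
    ContinuousOn (cutMulSymb N z) (Set.Icc 0 1) := by
  refine ContinuousOn.mul (Complex.continuous_ofReal.comp_continuousOn ?_) ?_
  · exact ContinuousOn.div (by fun_prop) (by fun_prop) fun q hq => (cut_denom_pos hN hq).ne'
  · exact Continuous.continuousOn (by fun_prop)

theorem cutSymb_qs {N : ℝ} (hN : 0 < N) (s : ℝ) :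
    cutSymb N (qs s) = ((N / (s ^ 2 + N) : ℝ) : ℂ) := by
  unfold cutSymb qs
  have h1 : (0 : ℝ) < 1 + s ^ 2 := by positivity
  have h2 : (0 : ℝ) < s ^ 2 + N := by positivity
  congr 1
  have h3 : N * (1 / (1 + s ^ 2)) + (1 - 1 / (1 + s ^ 2)) = (s ^ 2 + N) / (1 + s ^ 2) := by
    field_simp
    ring
  rw [h3]
  field_simp

/-- With `R = (√T - z)⁻¹`, this is `R* (N (T + N)⁻¹ (√T - z̄)) R = N (T + N)⁻¹ R`. The middle factor
is bounded, so the cut-off form depends continuously on `R w` alone. -/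
theorem conj_mul_cutMulSymb {N : ℝ} {z : ℂ} (hz : z.im ≠ 0) {q : ℝ}
    (hq : q ∈ Set.Icc (0 : ℝ) 1) :
    starRingEnd ℂ (sqrtResSymb z q) * (cutMulSymb N z q * sqrtResSymb z q) =
      cutSymb N q * sqrtResSymb z q := by
  rw [conj_sqrtResSymb, ← mul_assoc]
  congr 1
  have hz' : (starRingEnd ℂ z).im ≠ 0 := by simpa using hz
  have hd := sqrtResSymb_denom hz' hq
  unfold sqrtResSymb cutMulSymb cutSymb
  have h1 : (√q : ℂ) * (√q : ℂ) = q := by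
    rw [← Complex.ofReal_mul, Real.mul_self_sqrt hq.1]
  rw [div_mul_eq_mul_div, div_eq_iff hd]
  push_cast
  rw [← h1]
  ring

namespace AdjCauchyBound
variable {Q : E →L[ℂ] E} {hQ : IsRegularizer Q} {A : E →ₗ.[ℂ] F} {a : ℝ}
  (h : AdjCauchyBound hQ A a)
include h

theorem inner_cut_quarter_le {z : ℂ} (hz : z.im ≠ 0) {N : ℝ} (hN : ‖z‖ ^ 2 < N)
    (u : A†.domain) :
    ‖⟪h.adjDensityBound.quarter u,
      bc Q (fun q => cutSymb N q * sqrtResSymb z q) (h.adjDensityBound.quarter u)⟫_ℂ‖ ≤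
      (4 * ‖(N : ℂ) / (N + z ^ 2)‖ + 2) * (a * ‖(u : F)‖ ^ 2) := by
  have hN0 : 0 < N := (sq_nonneg _).trans_lt hN
  have hc : ContinuousOn (fun q => cutSymb N q * sqrtResSymb z q) (Set.Icc 0 1) :=
    (contOn_cutSymb hN0).mul (contOn_sqrtResSymb hz)
  refine le_trans (le_of_eq ?_) ((h u).kernel_le hz hN)
  congr 1
  rw [h.adjDensityBound.bc_quarter hc]
  refine ((hQ.rep (A† u)).inner _ _ (h u).memLp_pw
    (SpectralRep.memLp_qs_mul hc (h u).memLp_pw)).trans ?_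
  refine integral_congr_ae ?_
  filter_upwards [(h u).pos] with s hs
  rw [cutSymb_qs hN0, sqrtResSymb_qs hs, conj_pw, mul_inv]
  have h1 : pw (-(1 / 4)) (s ^ 2) * pw (-(1 / 4)) (s ^ 2) = (s : ℂ)⁻¹ := by
    rw [pw_sq hs, ← Complex.ofReal_mul, ← Real.rpow_add hs]
    norm_num
    rw [Real.rpow_neg_one, Complex.ofReal_inv]
  rw [← h1]
  ring

/-- The approximants of `w` converge only after the resolvent is applied, so the limit is taken in
the cut-off form for fixed `N`. Then `N → ∞`, where `N / (N + z²) → 1` and the constant becomes `4 +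
2`. -/
theorem inner_resolvent_le (hA : A.IsClosed) (hAd : Dense (A.domain : Set E)) {v : F} {w : E}
    (hw : ∀ x f y, Gr Q (pw (-(1 / 4))) x f → (f, y) ∈ A.graph → ⟪w, x⟫_ℂ = ⟪v, y⟫_ℂ)
    {z : ℂ} (hz : z.im ≠ 0) :
    ‖⟪w, bc Q (sqrtResSymb z) w⟫_ℂ‖ ≤ 6 * (a * ‖v‖ ^ 2) := by
  have hσ := contOn_sqrtResSymb hz
  have hd := h.adjDensityBound
  obtain ⟨u, h1, h2⟩ := hd.exists_tendsto_resolvent hA hAd hw hz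
  have main : ∀ N : ℝ, ‖z‖ ^ 2 < N → ‖⟪w, bc Q (cutSymb N) (bc Q (sqrtResSymb z) w)⟫_ℂ‖ ≤
      (4 * ‖(N : ℂ) / (N + z ^ 2)‖ + 2) * (a * ‖v‖ ^ 2) := by
    intro N hN
    have hN0 : 0 < N := (sq_nonneg _).trans_lt hN
    have hcut := contOn_cutSymb hN0
    have hτ := contOn_cutMulSymb hN0 z
    have hτσ : ContinuousOn (fun q => cutMulSymb N z q * sqrtResSymb z q) (Set.Icc 0 1) :=
      hτ.mul hσ
    have e : ∀ x, ⟪bc Q (sqrtResSymb z) x, bc Q (cutMulSymb N z) (bc Q (sqrtResSymb z) x)⟫_ℂ =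
        ⟪x, bc Q (fun q => cutSymb N q * sqrtResSymb z q) x⟫_ℂ := by
      intro x
      rw [hQ.bc_mul_apply hτ hσ, hQ.inner_bc_bc hσ hτσ,
        hQ.bc_congr fun q hq => conj_mul_cutMulSymb hz hq]
    rw [hQ.bc_mul_apply hcut hσ, ← e]
    refine le_of_tendsto_of_tendsto (h2.inner (((bc Q (cutMulSymb N z)).continuous.tendsto
      _).comp h2)).norm (((h1.norm.pow 2).const_mul a).const_mul _)
      (Filter.Eventually.of_forall fun n => ?_)
    simp only [Function.comp_apply]
    rw [e]
    exact h.inner_cut_quarter_le hz hN (u n)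
  have l1 : Filter.Tendsto (fun n : ℕ => bc Q (cutSymb ((n : ℝ) + 1))
      (bc Q (sqrtResSymb z) w)) Filter.atTop (nhds (bc Q (sqrtResSymb z) w)) := by
    refine hQ.tendsto_bc_one (C := 1) (fun n => contOn_cutSymb (by positivity)) ?_ ?_ _
    · intro n q hq
      have hp := cut_denom_pos (N := (n : ℝ) + 1) (by positivity) hq
      have hq0 := hq.1
      have hq1 := hq.2
      unfold cutSymb
      rw [Complex.norm_real, Real.norm_eq_abs, abs_of_nonneg (by positivity), div_le_one hp]
      linarith
    · intro q hq0 hq1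
      have e1 : ∀ n : ℕ, cutSymb ((n : ℝ) + 1) q =
          ((1 - (1 - q) / (((n : ℝ) + 1) * q + (1 - q)) : ℝ) : ℂ) := by
        intro n
        have hp := cut_denom_pos (N := (n : ℝ) + 1) (by positivity) ⟨hq0.le, hq1.le⟩
        unfold cutSymb
        congr 1
        field_simp
        ring
      simp only [e1]
      have l0 : Filter.Tendsto (fun n : ℕ => ((n : ℝ) + 1) * q + (1 - q)) Filter.atTop
          Filter.atTop := by
        refine Filter.tendsto_atTop_add_const_right _ _ (Filter.Tendsto.atTop_mul_const hq0 ?_)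
        exact Filter.tendsto_atTop_add_const_right _ _ tendsto_natCast_atTop_atTop
      have l0' := (tendsto_const_nhds (x := (1 : ℝ))).sub (l0.const_div_atTop (1 - q))
      rw [sub_zero] at l0'
      have := (Complex.continuous_ofReal.tendsto 1).comp l0'
      simpa [Function.comp_def] using this
  have l2 : Filter.Tendsto (fun n : ℕ => (4 * ‖(((n : ℝ) + 1 : ℝ) : ℂ) /
      ((((n : ℝ) + 1 : ℝ) : ℂ) + z ^ 2)‖ + 2) * (a * ‖v‖ ^ 2)) Filter.atTop
      (nhds (6 * (a * ‖v‖ ^ 2))) := by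
    have l0 : Filter.Tendsto (fun n : ℕ => ((((n : ℝ) + 1 : ℝ) : ℂ))⁻¹) Filter.atTop (nhds 0) := by
      have := (Complex.continuous_ofReal.tendsto 0).comp
        (tendsto_one_div_add_atTop_nhds_zero_nat (𝕜 := ℝ))
      simpa [Function.comp_def] using this
    have l0' : Filter.Tendsto (fun n : ℕ => (((n : ℝ) + 1 : ℝ) : ℂ) /
      ((((n : ℝ) + 1 : ℝ) : ℂ) + z ^ 2)) Filter.atTop (nhds 1) := by
      have h3 : Filter.Tendsto (fun n : ℕ => (1 + z ^ 2 * ((((n : ℝ) + 1 : ℝ) : ℂ))⁻¹)⁻¹)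
          Filter.atTop (nhds (1 + z ^ 2 * 0)⁻¹) :=
        Filter.Tendsto.inv₀ ((l0.const_mul _).const_add _) (by simp)
      rw [mul_zero, add_zero, inv_one] at h3
      refine h3.congr fun n => ?_
      have hn : ((((n : ℝ) + 1 : ℝ) : ℂ)) ≠ 0 := by
        have : ((n : ℝ) + 1) ≠ 0 := by positivity
        exact_mod_cast this
      rw [← inv_div, add_div, div_self hn, div_eq_mul_inv]
    have h4 := (((l0'.norm.const_mul 4).add_const 2).mul_const (a * ‖v‖ ^ 2))
    rw [norm_one] at h4
    convert h4 using 2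
    norm_num
  refine le_of_tendsto_of_tendsto (tendsto_const_nhds.inner l1).norm l2 ?_
  obtain ⟨n₀, hn₀⟩ := exists_nat_gt (‖z‖ ^ 2)
  filter_upwards [Filter.eventually_ge_atTop n₀] with n hn
  refine main _ ?_
  have : (n₀ : ℝ) ≤ n := by exact_mod_cast hn
  linarith

end AdjCauchyBound

end

section

variable {E : Type*} [NormedAddCommGroup E] [InnerProductSpace ℂ E] [CompleteSpace E]
variable {F : Type*} [NormedAddCommGroup F] [InnerProductSpace ℂ F] [CompleteSpace F]

/-! ### Smoothness with respect to the square root -/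

theorem mem_pcomp_graph {D E F : Type*} [AddCommGroup D] [Module ℂ D] [AddCommGroup E]
    [Module ℂ E] [AddCommGroup F] [Module ℂ F] {g : E →ₗ.[ℂ] F} {f : D →ₗ.[ℂ] E} {x : D} {y : F} :
    (x, y) ∈ (g ∘ₚ f).graph ↔ ∃ w, (x, w) ∈ f.graph ∧ (w, y) ∈ g.graph := by
  simp only [LinearPMap.mem_graph_iff]
  constructor
  · rintro ⟨p, h1, h2⟩
    obtain ⟨hx, h⟩ := (mem_pcomp_domain g f p).1 p.2
    rw [pcomp_apply g f p hx h] at h2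
    exact ⟨f ⟨p, hx⟩, ⟨⟨p, hx⟩, h1, rfl⟩, ⟨⟨_, h⟩, rfl, h2⟩⟩
  · rintro ⟨w, ⟨p, h1, h2⟩, ⟨r, h3, h4⟩⟩
    have hf : f p ∈ g.domain := by rw [h2, ← h3]; exact r.2
    refine ⟨⟨p, (mem_pcomp_domain _ _ _).2 ⟨p.2, hf⟩⟩, h1, ?_⟩
    refine (pcomp_apply g f _ p.2 hf).trans ?_
    rw [← h4]
    exact congrArg g (Subtype.ext (h2.trans h3.symm))

theorem inner_imRes {H : E →ₗ.[ℂ] E} {z : ℂ} {x : E} {c : ℂ}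
    (h1 : ⟪x, res H z x⟫_ℂ = c) (h2 : ⟪x, res H (starRingEnd ℂ z) x⟫_ℂ = starRingEnd ℂ c) :
    ⟪x, imRes H z x⟫_ℂ = (c.im : ℂ) := by
  have h3 : imRes H z x = (2 * Complex.I)⁻¹ • (res H z x - res H (starRingEnd ℂ z) x) := rfl
  rw [h3, inner_smul_right, inner_sub_right, h1, h2, Complex.sub_conj]
  have := Complex.I_ne_zero
  field_simp
  push_cast
  ring

/-! ### From resolvent bounds for `H` to spectral measures of `H + ν` -/

section
variable {H : E →ₗ.[ℂ] E} {ν : ℝ} (hT : IsSelfAdjoint (shift H ν))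
  (hpos : IsNonneg (shift H ν)) (hinj : Function.Injective (shift H ν)) {A : E →ₗ.[ℂ] F} {a : ℝ}

/-- Passing from `H` to `H + ν` translates the spectral parameter by a real number, which is
harmless because the hypotheses range over all `λ`. -/
theorem inner_res_eq_cauchy {z : ℂ} (hz : z.im ≠ 0) (x : E) :
    ⟪x, res H z x⟫_ℂ = cauchy ((isRegularizer_res hT hpos hinj).meas x) (z + ν) := by
  have hζ : (z + ν).im ≠ 0 ∨ (z + ν).re < 0 := Or.inl (by simpa using hz)
  rw [(isResolvent_of_shift (isResolvent_bc hT hpos hinj hζ)).res_eq]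
  exact inner_bc_resSymb ((isRegularizer_res hT hpos hinj).rep x) hζ

theorem IsSmooth.adjDensityBound (h : IsSmooth H A a) :
    AdjDensityBound (isRegularizer_res hT hpos hinj) A a := by
  intro u
  obtain ⟨ε₀, hε₀, hb⟩ := h.bound
  have hrep := (isRegularizer_res hT hpos hinj).rep (A† u)
  -- The inequality `0 ≤ a ‖u‖²` is read off from a single instance of the bound, so no sign of `a`
  -- is assumed.
  refine ⟨inferInstance, hrep.pos, (norm_nonneg _).trans
    (hb (ε₀ / 2) 0 (by positivity) (by rw [abs_of_pos (by positivity)]; linarith) u), ?_⟩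
  refine le_withDensity_of_poisson hrep.pos hε₀ fun ε l hε hε' => ?_
  have h1 := hb ε (l - ν) (abs_pos.2 hε.ne') (by rwa [abs_of_pos hε]) u
  have him : (((l - ν : ℝ) : ℂ) + ε * Complex.I).im ≠ 0 := by simpa using hε.ne'
  have him' : (starRingEnd ℂ (((l - ν : ℝ) : ℂ) + ε * Complex.I)).im ≠ 0 := by
    simpa using hε.ne'
  have e1 : ((l - ν : ℝ) : ℂ) + ε * Complex.I + ν = l + ε * Complex.I := by push_cast; ring
  have e2 : starRingEnd ℂ (((l - ν : ℝ) : ℂ) + ε * Complex.I) + ν =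
      starRingEnd ℂ (l + ε * Complex.I) := by
    rw [← e1, map_add _ _ (ν : ℂ), Complex.conj_ofReal]
  rw [inner_imRes (inner_res_eq_cauchy hT hpos hinj him _)
    (by rw [inner_res_eq_cauchy hT hpos hinj him' _, e1, e2, cauchy_conj]), e1,
    Complex.norm_real] at h1
  refine le_trans (le_of_eq ?_) ((le_abs_self _).trans h1)
  have hint := integrable_sq_sub_inv (m := (isRegularizer_res hT hpos hinj).meas (A† u))
    (ζ := l + ε * Complex.I) (Or.inl (by simpa using hε.ne'))
  unfold cauchy
  rw [← RCLike.im_eq_complex_im, ← integral_im hint]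
  refine integral_congr_ae (Filter.Eventually.of_forall fun s => ?_)
  exact im_inv_sub.symm

theorem IsSupersmooth.adjCauchyBound (h : IsSupersmooth H A a) :
    AdjCauchyBound (isRegularizer_res hT hpos hinj) A a := by
  -- The form of `Im R(z)` is the imaginary part of the form of `R(z)`, so supersmooth implies
  -- smooth with the same constant.
  have hs : IsSmooth H A a := by
    refine ⟨h.closed, h.dense, ?_⟩
    obtain ⟨ε₀, hε₀, hb⟩ := h.bound
    refine ⟨ε₀, hε₀, fun ε l h0 h1 u => ?_⟩
    have hε : ε ≠ 0 := abs_pos.1 h0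
    have him : ((l : ℂ) + ε * Complex.I).im ≠ 0 := by simpa using hε
    have him' : (starRingEnd ℂ ((l : ℂ) + ε * Complex.I)).im ≠ 0 := by simpa using hε
    have h2 := hb ε l h0 h1 u
    rw [inner_res_eq_cauchy hT hpos hinj him] at h2
    rw [inner_imRes (inner_res_eq_cauchy hT hpos hinj him _)
      (by rw [inner_res_eq_cauchy hT hpos hinj him' _, ← cauchy_conj, map_add _ _ (ν : ℂ),
        Complex.conj_ofReal]), Complex.norm_real]
    exact (Complex.abs_im_le_norm _).trans h2
  intro u
  refine ⟨hs.adjDensityBound hT hpos hinj u, ?_⟩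
  obtain ⟨ε₀, hε₀, hb⟩ := h.bound
  refine fun ζ hζ => cauchy_bound hε₀ (fun ε l h0 h1 => ?_) hζ
  have hε : ε ≠ 0 := abs_pos.1 h0
  have him : (((l - ν : ℝ) : ℂ) + ε * Complex.I).im ≠ 0 := by simpa using hε
  have e1 : ((l - ν : ℝ) : ℂ) + ε * Complex.I + ν = l + ε * Complex.I := by push_cast; ring
  have h2 := hb ε (l - ν) h0 h1 u
  rwa [inner_res_eq_cauchy hT hpos hinj him, e1] at h2

end

/-! ### The composite operator `A T^{-1/4}` -/

section
variable {T : E →ₗ.[ℂ] E} (hT : IsSelfAdjoint T) (hpos : IsNonneg T)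
  (hinj : Function.Injective T) {A : E →ₗ.[ℂ] F} {a : ℝ}

include hT hpos hinj in
theorem mem_fracPow_graph {r : ℝ} {x f : E} :
    (x, f) ∈ (fracPow T r).graph ↔ Gr (res T (-1)) (pw r) x f :=
  mem_funCalc_graph_iff_gr hT hpos hinj (pw r) x f

include hT hpos hinj in
theorem inner_adjoint_pcomp (hBd : Dense ((A ∘ₚ fracPow T (-(1 / 4))).domain : Set E))
    (v : (A ∘ₚ fracPow T (-(1 / 4)))†.domain) {x f : E} {y : F}
    (hx : Gr (res T (-1)) (pw (-(1 / 4))) x f) (hy : (f, y) ∈ A.graph) :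
    ⟪(A ∘ₚ fracPow T (-(1 / 4)))† v, x⟫_ℂ = ⟪(v : F), y⟫_ℂ := by
  obtain ⟨h, rfl⟩ := apply_of_mem_graph
    (mem_pcomp_graph.2 ⟨f, (mem_fracPow_graph hT hpos hinj).2 hx, hy⟩)
  exact inner_adjoint_apply hBd v ⟨x, h⟩

/-- The first resolvent identity at `z` and `z̄`; it gives `Im R(z) = Im z · R(z)* R(z)`. -/
theorem sqrtResSymb_sub_conj {z : ℂ} (hz : z.im ≠ 0) {q : ℝ} (hq : q ∈ Set.Icc (0 : ℝ) 1) :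
    sqrtResSymb z q - sqrtResSymb (starRingEnd ℂ z) q =
      (2 * Complex.I * z.im) * (starRingEnd ℂ (sqrtResSymb z q) * sqrtResSymb z q) := by
  have hz' : (starRingEnd ℂ z).im ≠ 0 := by simpa using hz
  have h1 := sqrtResSymb_denom hz hq
  have h2 := sqrtResSymb_denom hz' hq
  have h3 : 2 * Complex.I * z.im = z - starRingEnd ℂ z := by
    rw [Complex.sub_conj]; push_cast; ring
  rw [conj_sqrtResSymb, h3]
  unfold sqrtResSymb
  rw [div_sub_div _ _ h1 h2, div_mul_div_comm, mul_div_assoc',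
    div_eq_div_iff (mul_ne_zero h1 h2) (mul_ne_zero h2 h1)]
  ring

include hT hpos hinj in
theorem norm_inner_imRes_sqrt {z : ℂ} (hz : z.im ≠ 0) (w : E) :
    ‖⟪w, imRes (fracPow T (1 / 2)) z w⟫_ℂ‖ =
      |z.im| * ‖bc (res T (-1)) (sqrtResSymb z) w‖ ^ 2 := by
  have hQ := isRegularizer_res hT hpos hinj
  have hz' : (starRingEnd ℂ z).im ≠ 0 := by simpa using hz
  have h3 : imRes (fracPow T (1 / 2)) z w = (2 * Complex.I)⁻¹ •
      (res (fracPow T (1 / 2)) z w - res (fracPow T (1 / 2)) (starRingEnd ℂ z) w) := rfl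
  have hc := contOn_sqrtResSymb hz
  have hc' := contOn_sqrtResSymb hz'
  have hcs : ContinuousOn (fun q => starRingEnd ℂ (sqrtResSymb z q)) (Set.Icc 0 1) :=
    Complex.continuous_conj.comp_continuousOn hc
  have hcc : ContinuousOn (fun q => starRingEnd ℂ (sqrtResSymb z q) * sqrtResSymb z q)
    (Set.Icc 0 1) := hcs.mul hc
  have h4 : bc (res T (-1)) (sqrtResSymb z) - bc (res T (-1)) (sqrtResSymb (starRingEnd ℂ z)) =
      (2 * Complex.I * z.im) • bc (res T (-1))
        (fun q => starRingEnd ℂ (sqrtResSymb z q) * sqrtResSymb z q) := by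
    rw [← hQ.bc_sub hc hc', ← hQ.bc_const_mul _ hcc]
    exact hQ.bc_congr fun q hq => sqrtResSymb_sub_conj hz hq
  rw [h3, (isResolvent_sqrt hT hpos hinj hz).res_eq, (isResolvent_sqrt hT hpos hinj hz').res_eq,
    ← _root_.sub_apply, h4, inner_smul_right, _root_.smul_apply, inner_smul_right,
    ← hQ.inner_bc_bc hc hc, inner_self_eq_norm_sq_to_K, norm_mul, norm_mul]
  simp
  ring

theorem isSmooth_sqrt (hA : A.IsClosed) (hAd : Dense (A.domain : Set E))
    (hB : (A ∘ₚ fracPow T (-(1 / 4))).IsClosed)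
    (hBd : Dense ((A ∘ₚ fracPow T (-(1 / 4))).domain : Set E))
    (h : AdjDensityBound (isRegularizer_res hT hpos hinj) A a) :
    IsSmooth (fracPow T (1 / 2)) (A ∘ₚ fracPow T (-(1 / 4))) ((Real.pi + 3) * a) := by
  -- The radius `1` is arbitrary: the density bound is global, so the estimate with constant `2 a`
  -- holds for every `ε ≠ 0`.
  refine ⟨hB, hBd, 1, one_pos, fun ε l h0 _ v => ?_⟩
  have him : ((l : ℂ) + ε * Complex.I).im ≠ 0 := by simpa using abs_pos.1 h0
  rw [norm_inner_imRes_sqrt hT hpos hinj him]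
  have h1 := h.norm_resolvent_le hA hAd
    (fun x f y hx hy => inner_adjoint_pcomp hT hpos hinj hBd v hx hy) him
  have h2 : 0 ≤ a * ‖(v : F)‖ ^ 2 := by
    have : 0 ≤ 2 * (a * ‖(v : F)‖ ^ 2) := le_trans (by positivity) h1
    linarith
  refine h1.trans ?_
  rw [mul_assoc]
  exact mul_le_mul_of_nonneg_right (by linarith [Real.pi_gt_three]) h2

theorem isSupersmooth_sqrt (hA : A.IsClosed) (hAd : Dense (A.domain : Set E))
    (hB : (A ∘ₚ fracPow T (-(1 / 4))).IsClosed)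
    (hBd : Dense ((A ∘ₚ fracPow T (-(1 / 4))).domain : Set E))
    (h : AdjCauchyBound (isRegularizer_res hT hpos hinj) A a) :
    IsSupersmooth (fracPow T (1 / 2)) (A ∘ₚ fracPow T (-(1 / 4))) ((Real.pi + 3) * a) := by
  refine ⟨hB, hBd, 1, one_pos, fun ε l h0 _ v => ?_⟩
  have him : ((l : ℂ) + ε * Complex.I).im ≠ 0 := by simpa using abs_pos.1 h0
  rw [(isResolvent_sqrt hT hpos hinj him).res_eq]
  have h1 := h.inner_resolvent_le hA hAd
    (fun x f y hx hy => inner_adjoint_pcomp hT hpos hinj hBd v hx hy) him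
  have h2 : 0 ≤ a * ‖(v : F)‖ ^ 2 := by
    have : 0 ≤ 6 * (a * ‖(v : F)‖ ^ 2) := le_trans (by positivity) h1
    linarith
  refine h1.trans ?_
  rw [mul_assoc]
  -- `6 ≤ π + 3`, the only place in the supersmooth bound where `π > 3` is essential.
  exact mul_le_mul_of_nonneg_right (by linarith [Real.pi_gt_three]) h2

end

end

section

/-! ### Plancherel's theorem for integrable square integrable functions -/

open FourierTransform in
theorem continuous_fourier_of_integrable {f : ℝ → ℂ} (h1 : Integrable f) : Continuous (𝓕 f) :=
  VectorFourier.fourierIntegral_continuous Real.continuous_fourierChar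
    (L := innerₗ ℝ) (by fun_prop) h1

-- Paired with a smooth compactly supported `g`, both sides give `∫ ĝ f`: the `L²` transform by its
-- agreement with that of tempered distributions, the integral by Fubini.
open FourierTransform in
theorem fourier_toLp_ae {f : ℝ → ℂ} (h1 : Integrable f) (h2 : MemLp f 2) :
    (𝓕 (h2.toLp f) : Lp ℂ 2 (volume : Measure ℝ)) =ᵐ[volume] 𝓕 f := by
  refine ae_eq_of_integral_contDiff_smul_eq
    ((Lp.memLp _).locallyIntegrable (by norm_num))
    (continuous_fourier_of_integrable h1).locallyIntegrable fun g hg hgs => ?_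
  have h₂' : HasCompactSupport (Complex.ofRealCLM ∘ g) := hgs.comp_left rfl
  let G : SchwartzMap ℝ ℂ := h₂'.toSchwartzMap (Complex.ofRealCLM.contDiff.comp hg)
  have hG : ∀ x, G x = (g x : ℂ) := fun x => rfl
  have e1 := congrArg (fun T => T G) (Lp.fourier_toTemperedDistribution_eq (h2.toLp f))
  simp only [TemperedDistribution.fourier_apply, Lp.toTemperedDistribution_apply] at e1
  have e2 : ∫ x, 𝓕 (G : ℝ → ℂ) x • f x = ∫ x, G x • 𝓕 f x := by
    simpa using! VectorFourier.integral_fourierIntegral_smul_eq_flip (L := innerₗ ℝ)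
      (μ := volume) (ν := volume) Real.continuous_fourierChar continuous_inner
      (G.integrable (μ := volume)) h1
  have e3 : ∫ x, (𝓕 G) x • (h2.toLp f) x = ∫ x, 𝓕 (G : ℝ → ℂ) x • f x := by
    refine integral_congr_ae ?_
    filter_upwards [h2.coeFn_toLp] with x hx
    rw [hx, SchwartzMap.fourier_coe]
  rw [e3, e2] at e1
  simp only [hG] at e1
  exact e1.symm

open FourierTransform in
theorem memLp_fourier {f : ℝ → ℂ} (h1 : Integrable f) (h2 : MemLp f 2) : MemLp (𝓕 f) 2 :=
  (memLp_congr_ae (fourier_toLp_ae h1 h2)).1 (Lp.memLp _)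

open FourierTransform in
theorem integral_conj_fourier_mul {f g : ℝ → ℂ} (hf1 : Integrable f) (hf2 : MemLp f 2)
    (hg1 : Integrable g) (hg2 : MemLp g 2) :
    ∫ ξ, starRingEnd ℂ (𝓕 g ξ) * 𝓕 f ξ = ∫ t, starRingEnd ℂ (g t) * f t := by
  have h := Lp.inner_fourier_eq (hg2.toLp g) (hf2.toLp f)
  rw [L2.inner_def, L2.inner_def] at h
  refine Eq.trans ?_ (h.trans ?_)
  · refine integral_congr_ae ?_
    filter_upwards [fourier_toLp_ae hf1 hf2, fourier_toLp_ae hg1 hg2] with ξ e1 e2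
    rw [e1, e2, RCLike.inner_apply, mul_comm]
  · refine integral_congr_ae ?_
    filter_upwards [hf2.coeFn_toLp, hg2.coeFn_toLp] with ξ e1 e2
    rw [e1, e2, RCLike.inner_apply, mul_comm]

open FourierTransform in
theorem fourier_translate (f : ℝ → ℂ) (τ ξ : ℝ) :
    𝓕 (fun t => f (t - τ)) ξ = Complex.exp (-(2 * Real.pi * τ * ξ) * Complex.I) * 𝓕 f ξ := by
  simp only [Real.fourier_real_eq_integral_exp_smul, smul_eq_mul]
  rw [← integral_const_mul]
  refine Eq.trans ?_ (integral_sub_right_eq_self (fun t : ℝ =>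
    Complex.exp (-(2 * Real.pi * τ * ξ) * Complex.I) *
      (Complex.exp (((-2 * Real.pi * t * ξ : ℝ) : ℂ) * Complex.I) * f t)) τ)
  refine integral_congr_ae (Filter.Eventually.of_forall fun t => ?_)
  simp only
  rw [← mul_assoc, ← Complex.exp_add]
  congr 2
  push_cast
  ring

/-- The cross-correlation of two functions. -/
def crossCorr (η χ : ℝ → ℂ) (τ : ℝ) : ℂ := ∫ t, starRingEnd ℂ (η t) * χ (t - τ)

/-- Up to a swap of coordinates, this is a product of integrable functions composed with the
measure-preserving shear `(t, τ) ↦ (t, t - τ)`. -/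
theorem integrable_prod_crossCorr {η χ : ℝ → ℂ} (hη : Integrable η) (hχ : Integrable χ) :
    Integrable (fun p : ℝ × ℝ => starRingEnd ℂ (η p.2) * χ (p.2 - p.1))
      (volume.prod volume) := by
  have hη' : Integrable (fun t => starRingEnd ℂ (η t)) := by
    refine hη.congr' (Complex.continuous_conj.comp_aestronglyMeasurable hη.1) ?_
    exact Filter.Eventually.of_forall fun t => (RCLike.norm_conj _).symm
  have h1 : Integrable (fun p : ℝ × ℝ => starRingEnd ℂ (η p.1) * χ p.2) (volume.prod volume) :=
    hη'.mul_prod hχ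
  have h2 : MeasurePreserving (fun p : ℝ × ℝ => (p.1, p.1 - p.2)) (volume.prod volume)
      (volume.prod volume) := by
    have h3 : MeasurePreserving (fun p : ℝ × ℝ => (p.1, -p.2)) (volume.prod volume)
        (volume.prod volume) :=
      (MeasurePreserving.id _).prod (Measure.measurePreserving_neg volume)
    have h4 := (measurePreserving_prod_add (volume : Measure ℝ) (volume : Measure ℝ)).comp h3
    convert h4 using 2
    simp [sub_eq_add_neg]
  exact ((h2.integrable_comp h1.1).2 h1).swap

theorem integrable_crossCorr {η χ : ℝ → ℂ} (hη : Integrable η) (hχ : Integrable χ) :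
    Integrable (crossCorr η χ) :=
  (integrable_prod_crossCorr hη hχ).integral_prod_left

open FourierTransform in
theorem crossCorr_eq {η χ : ℝ → ℂ} (hη1 : Integrable η) (hη2 : MemLp η 2) (hχ1 : Integrable χ)
    (hχ2 : MemLp χ 2) (τ : ℝ) :
    crossCorr η χ τ = ∫ ξ, starRingEnd ℂ (𝓕 η ξ) * 𝓕 χ ξ *
      Complex.exp (-(2 * Real.pi * τ * ξ) * Complex.I) := by
  have hm : MeasurePreserving (fun t : ℝ => t - τ) := measurePreserving_sub_right volume τ
  have h := integral_conj_fourier_mul (f := fun t => χ (t - τ)) (hχ1.comp_sub_right τ)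
    (hχ2.comp_measurePreserving hm) hη1 hη2
  unfold crossCorr
  rw [← h]
  refine integral_congr_ae (Filter.Eventually.of_forall fun ξ => ?_)
  simp only
  rw [fourier_translate]
  ring

/-! ### The resolvent as a Fourier multiplier -/

variable {E : Type*} [NormedAddCommGroup E] [InnerProductSpace ℂ E] [CompleteSpace E]

namespace IsRegularizer
variable {Q : E →L[ℂ] E} (hQ : IsRegularizer Q)

theorem continuous_inner_flow (x y : E) : Continuous fun τ => ⟪y, hQ.flow τ x⟫_ℂ :=
  continuous_const.inner (hQ.continuous_flow_apply x)

theorem norm_inner_flow_le (x y : E) (τ : ℝ) : ‖⟪y, hQ.flow τ x⟫_ℂ‖ ≤ ‖y‖ * ‖x‖ := by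
  refine (norm_inner_le_norm _ _).trans ?_
  rw [LinearIsometry.norm_map]

-- With the cross-correlation written as a Fourier integral and the order exchanged, the
-- `τ`-integral is the Laplace transform of the flow at `z = -2πξ + iε`, since `exp (-ε τ) exp (-2πi
-- τ ξ) = exp (i z τ)`.
open FourierTransform in
theorem integral_crossCorr_flow {η χ : ℝ → ℂ} (hη1 : Integrable η) (hη2 : MemLp η 2)
    (hχ1 : Integrable χ) (hχ2 : MemLp χ 2) {ε : ℝ} (hε : 0 < ε) (x y : E) :
    Integrable (fun ξ : ℝ => starRingEnd ℂ (𝓕 η ξ) * 𝓕 χ ξ *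
      ⟪y, -Complex.I • bc Q (sqrtResSymb (((-(2 * Real.pi * ξ) : ℝ) : ℂ) + ε * Complex.I)) x⟫_ℂ) ∧
    ∫ τ in Set.Ioi (0 : ℝ), (Real.exp (-ε * τ) : ℂ) * ⟪y, hQ.flow τ x⟫_ℂ * crossCorr η χ τ =
      ∫ ξ : ℝ, starRingEnd ℂ (𝓕 η ξ) * 𝓕 χ ξ *
      ⟪y, -Complex.I • bc Q (sqrtResSymb (((-(2 * Real.pi * ξ) : ℝ) : ℂ) + ε * Complex.I)) x⟫_ℂ := by
  have ha : IntegrableOn (fun τ : ℝ => (Real.exp (-ε * τ) : ℂ) * ⟪y, hQ.flow τ x⟫_ℂ)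
      (Set.Ioi 0) := by
    refine Integrable.mono' ((exp_neg_integrableOn_Ioi 0 hε).mul_const (‖y‖ * ‖x‖)) ?_
      (Filter.Eventually.of_forall fun τ => ?_)
    · refine Continuous.aestronglyMeasurable ?_
      exact (by fun_prop : Continuous fun τ : ℝ => (Real.exp (-ε * τ) : ℂ)).mul
        (hQ.continuous_inner_flow x y)
    · rw [norm_mul, Complex.norm_real, Real.norm_eq_abs, abs_of_pos (Real.exp_pos _)]
      exact mul_le_mul_of_nonneg_left (hQ.norm_inner_flow_le x y τ) (Real.exp_pos _).le
  have hη' := memLp_fourier hη1 hη2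
  have hχ' := memLp_fourier hχ1 hχ2
  have hcη : Continuous fun ξ => starRingEnd ℂ (𝓕 η ξ) :=
    Complex.continuous_conj.comp (continuous_fourier_of_integrable hη1)
  have hcχ : Continuous (𝓕 χ) := continuous_fourier_of_integrable hχ1
  have hb : Integrable (fun ξ : ℝ => starRingEnd ℂ (𝓕 η ξ) * 𝓕 χ ξ) := by
    have h3 : MemLp (fun ξ => starRingEnd ℂ (𝓕 η ξ)) 2 := hη'.star
    exact h3.integrable_mul hχ'
  have hker : ∀ τ ξ : ℝ, ‖Complex.exp (-(2 * Real.pi * τ * ξ) * Complex.I)‖ = 1 := by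
    intro τ ξ
    have := Complex.norm_exp_ofReal_mul_I (-(2 * Real.pi * τ * ξ))
    push_cast at this
    exact this
  have hprod : Integrable (fun p : ℝ × ℝ => ((Real.exp (-ε * p.1) : ℂ) * ⟪y, hQ.flow p.1 x⟫_ℂ) *
      (starRingEnd ℂ (𝓕 η p.2) * 𝓕 χ p.2 *
        Complex.exp (-(2 * Real.pi * p.1 * p.2) * Complex.I)))
      ((volume.restrict (Set.Ioi (0 : ℝ))).prod volume) := by
    refine (ha.mul_prod hb).congr' ?_ (Filter.Eventually.of_forall fun p => ?_)
    · refine Continuous.aestronglyMeasurable ?_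
      have hf := hQ.continuous_inner_flow x y
      exact ((by fun_prop : Continuous fun p : ℝ × ℝ => (Real.exp (-ε * p.1) : ℂ)).mul
        (hf.comp continuous_fst)).mul (((hcη.comp continuous_snd).mul
          (hcχ.comp continuous_snd)).mul (by fun_prop))
    · simp only [norm_mul, hker, mul_one]
  have hin : ∀ ξ : ℝ, ∫ τ in Set.Ioi (0 : ℝ), ((Real.exp (-ε * τ) : ℂ) * ⟪y, hQ.flow τ x⟫_ℂ) *
      (starRingEnd ℂ (𝓕 η ξ) * 𝓕 χ ξ * Complex.exp (-(2 * Real.pi * τ * ξ) * Complex.I)) =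
      starRingEnd ℂ (𝓕 η ξ) * 𝓕 χ ξ *
      ⟪y, -Complex.I •
        bc Q (sqrtResSymb (((-(2 * Real.pi * ξ) : ℝ) : ℂ) + ε * Complex.I)) x⟫_ℂ := by
    intro ξ
    have hz : 0 < ((((-(2 * Real.pi * ξ) : ℝ) : ℂ) + ε * Complex.I)).im := by simpa using hε
    obtain ⟨h1, h2⟩ := hQ.integral_exp_flow hz x
    rw [← h2, ← integral_inner h1, ← integral_const_mul]
    refine integral_congr_ae (Filter.Eventually.of_forall fun τ => ?_)
    simp only
    rw [inner_smul_right, Complex.ofReal_exp]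
    have h3 : Complex.exp (Complex.I * (((-(2 * Real.pi * ξ) : ℝ) : ℂ) + ε * Complex.I) * τ) =
        Complex.exp ((-ε * τ : ℝ) : ℂ) * Complex.exp (-(2 * Real.pi * τ * ξ) * Complex.I) := by
      rw [← Complex.exp_add]
      congr 1
      push_cast
      linear_combination (ε : ℂ) * τ * Complex.I_mul_I
    rw [h3]
    ring
  refine ⟨hprod.integral_prod_right.congr (Filter.Eventually.of_forall hin), ?_⟩
  calc _ = ∫ τ in Set.Ioi (0 : ℝ), ∫ ξ : ℝ, ((Real.exp (-ε * τ) : ℂ) * ⟪y, hQ.flow τ x⟫_ℂ) *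
      (starRingEnd ℂ (𝓕 η ξ) * 𝓕 χ ξ * Complex.exp (-(2 * Real.pi * τ * ξ) * Complex.I)) := by
        refine integral_congr_ae (Filter.Eventually.of_forall fun τ => ?_)
        simp only
        rw [crossCorr_eq hη1 hη2 hχ1 hχ2, integral_const_mul]
    _ = ∫ ξ : ℝ, ∫ τ in Set.Ioi (0 : ℝ), ((Real.exp (-ε * τ) : ℂ) * ⟪y, hQ.flow τ x⟫_ℂ) *
      (starRingEnd ℂ (𝓕 η ξ) * 𝓕 χ ξ * Complex.exp (-(2 * Real.pi * τ * ξ) * Complex.I)) :=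
        integral_integral_swap hprod
    _ = _ := integral_congr_ae (Filter.Eventually.of_forall hin)

end IsRegularizer

end

section

variable {E : Type*} [NormedAddCommGroup E] [InnerProductSpace ℂ E] [CompleteSpace E]
variable {F : Type*} [NormedAddCommGroup F] [InnerProductSpace ℂ F] [CompleteSpace F]

/-! ### Sesquilinear forms -/

/-- Polarization and the parallelogram law bound the form by `C (‖v‖² + ‖u‖²)`; rescaling to unit
vectors gives the factor `2`. -/
theorem norm_inner_le_of_quadratic {V : Type*} [NormedAddCommGroup V]
    [InnerProductSpace ℂ V] (W : V →ₗ[ℂ] E) (R : E →L[ℂ] E) {C : ℝ}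
    (h : ∀ u, ‖⟪W u, R (W u)⟫_ℂ‖ ≤ C * ‖u‖ ^ 2) (u v : V) :
    ‖⟪W v, R (W u)⟫_ℂ‖ ≤ 2 * C * (‖v‖ * ‖u‖) := by
  have hq : ∀ u v, ‖⟪W v, R (W u)⟫_ℂ‖ ≤ C * (‖v‖ ^ 2 + ‖u‖ ^ 2) := by
    intro u v
    have e : 4 * ⟪W v, R (W u)⟫_ℂ = (⟪W (v + u), R (W (v + u))⟫_ℂ -
        ⟪W (v - u), R (W (v - u))⟫_ℂ) - Complex.I * (⟪W (v + Complex.I • u),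
          R (W (v + Complex.I • u))⟫_ℂ - ⟪W (v - Complex.I • u), R (W (v - Complex.I • u))⟫_ℂ) := by
      simp only [map_add, map_sub, map_smul, inner_add_left, inner_add_right, inner_sub_left,
        inner_sub_right, inner_smul_left, inner_smul_right, Complex.conj_I]
      linear_combination (2 * ⟪W v, R (W u)⟫_ℂ - 2 * ⟪W u, R (W v)⟫_ℂ) * Complex.I_mul_I
    have e1 := congrArg norm e
    rw [norm_mul] at e1
    have p1 := parallelogram_law_with_norm ℂ v u
    have p2 := parallelogram_law_with_norm ℂ v (Complex.I • u)
    rw [norm_smul, Complex.norm_I, one_mul] at p2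
    have b : ‖(⟪W (v + u), R (W (v + u))⟫_ℂ -
        ⟪W (v - u), R (W (v - u))⟫_ℂ) - Complex.I * (⟪W (v + Complex.I • u),
          R (W (v + Complex.I • u))⟫_ℂ - ⟪W (v - Complex.I • u), R (W (v - Complex.I • u))⟫_ℂ)‖ ≤
        (C * ‖v + u‖ ^ 2 + C * ‖v - u‖ ^ 2) +
          (C * ‖v + Complex.I • u‖ ^ 2 + C * ‖v - Complex.I • u‖ ^ 2) := by
      refine (norm_sub_le _ _).trans (add_le_add ((norm_sub_le _ _).trans
        (add_le_add (h _) (h _))) ?_)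
      rw [norm_mul, Complex.norm_I, one_mul]
      exact (norm_sub_le _ _).trans (add_le_add (h _) (h _))
    rw [← e1] at b
    have n4 : ‖(4 : ℂ)‖ = 4 := by norm_num
    rw [n4] at b
    have p1' : ‖v + u‖ ^ 2 + ‖v - u‖ ^ 2 = 2 * (‖v‖ ^ 2 + ‖u‖ ^ 2) := p1
    have p2' : ‖v + Complex.I • u‖ ^ 2 + ‖v - Complex.I • u‖ ^ 2 = 2 * (‖v‖ ^ 2 + ‖u‖ ^ 2) := p2
    have : (C * ‖v + u‖ ^ 2 + C * ‖v - u‖ ^ 2) +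
          (C * ‖v + Complex.I • u‖ ^ 2 + C * ‖v - Complex.I • u‖ ^ 2) =
          4 * (C * (‖v‖ ^ 2 + ‖u‖ ^ 2)) := by
      linear_combination C * p1' + C * p2'
    linarith
  rcases eq_or_ne u 0 with rfl | hu
  · simp
  rcases eq_or_ne v 0 with rfl | hv
  · simp
  have hu' := norm_pos_iff.2 hu
  have hv' := norm_pos_iff.2 hv
  have h1 := hq (((‖u‖⁻¹ : ℝ) : ℂ) • u) (((‖v‖⁻¹ : ℝ) : ℂ) • v)
  simp only [map_smul, inner_smul_left, inner_smul_right, norm_mul, norm_smul, Complex.conj_ofReal,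
    Complex.norm_real, norm_inv, norm_norm, inv_mul_cancel₀ hu'.ne', inv_mul_cancel₀ hv'.ne'] at h1
  rw [inv_mul_eq_div, inv_mul_eq_div, div_div, div_le_iff₀ (by positivity)] at h1
  linarith

/-! ### Finite sums of simple tensors -/

/-- Integrable and square integrable. -/
def IsNice (χ : ℝ → ℂ) : Prop := Integrable χ ∧ MemLp χ 2

/-- The squared `L²` norm of a finite sum of simple tensors. -/
def tensorSq {ι : Type*} [Fintype ι] (χ : ι → ℝ → ℂ) (u : ι → F) : ℝ :=
  ∫ t, ‖∑ j, χ j t • u j‖ ^ 2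

section
variable {ι κ : Type*} [Fintype ι] [Fintype κ]

theorem memLp_sum_smul {χ : ι → ℝ → ℂ} (hχ : ∀ j, MemLp (χ j) 2) (u : ι → F) :
    MemLp (fun t => ∑ j, χ j t • u j) 2 := by
  refine memLp_finsetSum _ fun j _ => ?_
  refine MemLp.of_le_mul (c := ‖u j‖) (hχ j) ((hχ j).1.smul_const (u j))
    (Filter.Eventually.of_forall fun t => ?_)
  rw [norm_smul, mul_comm]

theorem integrable_norm_sum_sq {χ : ι → ℝ → ℂ} (hχ : ∀ j, MemLp (χ j) 2) (u : ι → F) :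
    Integrable fun t => ‖∑ j, χ j t • u j‖ ^ 2 :=
  (memLp_sum_smul hχ u).integrable_norm_pow (by norm_num)

theorem ofReal_norm_sum_sq (c : ι → ℂ) (u : ι → F) :
    ((‖∑ j, c j • u j‖ ^ 2 : ℝ) : ℂ) =
      ∑ j, ∑ k, (starRingEnd ℂ (c j) * c k) * ⟪u j, u k⟫_ℂ := by
  have h := inner_self_eq_norm_sq_to_K (𝕜 := ℂ) (∑ j, c j • u j)
  have h' : ((‖∑ j, c j • u j‖ ^ 2 : ℝ) : ℂ) = ⟪∑ j, c j • u j, ∑ j, c j • u j⟫_ℂ := by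
    rw [h]; push_cast; rfl
  rw [h', sum_inner]
  refine Finset.sum_congr rfl fun j _ => ?_
  rw [inner_sum]
  refine Finset.sum_congr rfl fun k _ => ?_
  rw [inner_smul_left, inner_smul_right, mul_assoc]

theorem integrable_conj_mul {η χ : ℝ → ℂ} (hη : MemLp η 2) (hχ : MemLp χ 2) :
    Integrable fun t => starRingEnd ℂ (η t) * χ t := by
  have h : MemLp (fun t => starRingEnd ℂ (η t)) 2 := hη.star
  exact h.integrable_mul hχ

theorem ofReal_tensorSq {χ : ι → ℝ → ℂ} (hχ : ∀ j, MemLp (χ j) 2) (u : ι → F) :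
    ((tensorSq χ u : ℝ) : ℂ) =
      ∑ j, ∑ k, (∫ t, starRingEnd ℂ (χ j t) * χ k t) * ⟪u j, u k⟫_ℂ := by
  have hi : ∀ j k, Integrable fun t => (starRingEnd ℂ (χ j t) * χ k t) * ⟪u j, u k⟫_ℂ :=
    fun j k => (integrable_conj_mul (hχ j) (hχ k)).mul_const _
  unfold tensorSq
  rw [← integral_complex_ofReal]
  simp_rw [ofReal_norm_sum_sq]
  rw [integral_finsetSum _ fun j _ => integrable_finsetSum _ fun k _ => hi j k]
  refine Finset.sum_congr rfl fun j _ => ?_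
  rw [integral_finsetSum _ fun k _ => hi j k]
  refine Finset.sum_congr rfl fun k _ => ?_
  rw [integral_mul_const]

-- Both sides expand into the Gram matrix of the `u j`, and scalar Plancherel applies to each entry.
open FourierTransform in
theorem tensorSq_fourier {χ : ι → ℝ → ℂ} (hχ : ∀ j, IsNice (χ j)) (u : ι → F) :
    tensorSq (fun j => 𝓕 (χ j)) u = tensorSq χ u := by
  have h1 := ofReal_tensorSq (fun j => memLp_fourier (hχ j).1 (hχ j).2) u
  have h2 := ofReal_tensorSq (fun j => (hχ j).2) u
  have h3 : ((tensorSq (fun j => 𝓕 (χ j)) u : ℝ) : ℂ) = ((tensorSq χ u : ℝ) : ℂ) := by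
    rw [h1, h2]
    refine Finset.sum_congr rfl fun j _ => Finset.sum_congr rfl fun k _ => ?_
    rw [integral_conj_fourier_mul (hχ k).1 (hχ k).2 (hχ j).1 (hχ j).2]
  exact_mod_cast h3

end

/-! ### The forward correlation form -/

namespace IsRegularizer
variable {Q : E →L[ℂ] E} (hQ : IsRegularizer Q)
variable {ι κ : Type*} [Fintype ι] [Fintype κ]

/-- The form `∫_{τ > 0} ∫_t ⟪g t, exp (-i τ √T) f (t - τ)⟫` on finite sums of simple tensors. -/
def corrForm (η : κ → ℝ → ℂ) (y : κ → E) (χ : ι → ℝ → ℂ) (x : ι → E) : ℂ :=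
  ∑ k, ∑ j, ∫ τ in Set.Ioi (0 : ℝ), ⟪y k, hQ.flow τ (x j)⟫_ℂ * crossCorr (η k) (χ j) τ

theorem integrable_flow_crossCorr {η χ : ℝ → ℂ} (hη : Integrable η) (hχ : Integrable χ)
    (x y : E) : Integrable fun τ => ⟪y, hQ.flow τ x⟫_ℂ * crossCorr η χ τ :=
  (integrable_crossCorr hη hχ).bdd_mul
    (hQ.continuous_inner_flow x y).aestronglyMeasurable
    (Filter.Eventually.of_forall (hQ.norm_inner_flow_le x y))

theorem tendsto_damped {η χ : ℝ → ℂ} (hη : Integrable η) (hχ : Integrable χ) (x y : E) :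
    Filter.Tendsto (fun n : ℕ => ∫ τ in Set.Ioi (0 : ℝ), (Real.exp (-((n : ℝ) + 1)⁻¹ * τ) : ℂ) *
      ⟪y, hQ.flow τ x⟫_ℂ * crossCorr η χ τ) Filter.atTop
      (nhds (∫ τ in Set.Ioi (0 : ℝ), ⟪y, hQ.flow τ x⟫_ℂ * crossCorr η χ τ)) := by
  have hi := hQ.integrable_flow_crossCorr hη hχ x y
  refine tendsto_integral_of_dominated_convergence
    (fun τ => ‖⟪y, hQ.flow τ x⟫_ℂ * crossCorr η χ τ‖) (fun n => ?_) hi.norm.integrableOn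
    (fun n => ?_) (Filter.Eventually.of_forall fun τ => ?_)
  · simp_rw [mul_assoc]
    refine AEStronglyMeasurable.mul ?_ hi.1.restrict
    exact Continuous.aestronglyMeasurable (by fun_prop)
  · refine (ae_restrict_iff' measurableSet_Ioi).2 (Filter.Eventually.of_forall fun τ hτ => ?_)
    rw [mul_assoc, norm_mul, Complex.norm_real, Real.norm_eq_abs, abs_of_pos (Real.exp_pos _)]
    refine mul_le_of_le_one_left (norm_nonneg _) (Real.exp_le_one_iff.2 ?_)
    have h1 : (0 : ℝ) < ((n : ℝ) + 1)⁻¹ := by positivity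
    have h2 : (0 : ℝ) < τ := hτ
    nlinarith
  · simp_rw [mul_assoc]
    have h0 : Filter.Tendsto (fun n : ℕ => Real.exp (-((n : ℝ) + 1)⁻¹ * τ)) Filter.atTop
        (nhds 1) := by
      have h1 := tendsto_one_div_add_atTop_nhds_zero_nat (𝕜 := ℝ)
      have h2 := (Real.continuous_exp.tendsto _).comp ((h1.neg).mul_const τ)
      simpa [Function.comp_def] using h2
    have h3 := ((Complex.continuous_ofReal.tendsto _).comp h0).mul_const
      (⟪y, hQ.flow τ x⟫_ℂ * crossCorr η χ τ)
    simpa [Function.comp_def] using h3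

open FourierTransform in
theorem sum_damped {η : κ → ℝ → ℂ} {χ : ι → ℝ → ℂ} (hη : ∀ k, IsNice (η k))
    (hχ : ∀ j, IsNice (χ j)) (y : κ → E) (x : ι → E) {ε : ℝ} (hε : 0 < ε) :
    Integrable (fun ξ : ℝ => ⟪∑ k, 𝓕 (η k) ξ • y k, -Complex.I •
      bc Q (sqrtResSymb (((-(2 * Real.pi * ξ) : ℝ) : ℂ) + ε * Complex.I))
        (∑ j, 𝓕 (χ j) ξ • x j)⟫_ℂ) ∧
    ∑ k, ∑ j, ∫ τ in Set.Ioi (0 : ℝ), (Real.exp (-ε * τ) : ℂ) * ⟪y k, hQ.flow τ (x j)⟫_ℂ *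
      crossCorr (η k) (χ j) τ =
    ∫ ξ : ℝ, ⟪∑ k, 𝓕 (η k) ξ • y k, -Complex.I •
      bc Q (sqrtResSymb (((-(2 * Real.pi * ξ) : ℝ) : ℂ) + ε * Complex.I))
        (∑ j, 𝓕 (χ j) ξ • x j)⟫_ℂ := by
  have e : ∀ ξ : ℝ, ⟪∑ k, 𝓕 (η k) ξ • y k, -Complex.I •
      bc Q (sqrtResSymb (((-(2 * Real.pi * ξ) : ℝ) : ℂ) + ε * Complex.I))
        (∑ j, 𝓕 (χ j) ξ • x j)⟫_ℂ = ∑ k, ∑ j, starRingEnd ℂ (𝓕 (η k) ξ) * 𝓕 (χ j) ξ *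
      ⟪y k, -Complex.I • bc Q (sqrtResSymb (((-(2 * Real.pi * ξ) : ℝ) : ℂ) + ε * Complex.I))
        (x j)⟫_ℂ := by
    intro ξ
    rw [sum_inner]
    refine Finset.sum_congr rfl fun k _ => ?_
    rw [map_sum, Finset.smul_sum, inner_sum]
    refine Finset.sum_congr rfl fun j _ => ?_
    rw [map_smul, smul_comm, inner_smul_left, inner_smul_right]
    exact (mul_assoc _ _ _).symm
  have h := fun k j => hQ.integral_crossCorr_flow (hη k).1 (hη k).2 (hχ j).1 (hχ j).2 hε
    (x j) (y k)
  simp_rw [e]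
  refine ⟨integrable_finsetSum _ fun k _ => integrable_finsetSum _ fun j _ => (h k j).1, ?_⟩
  rw [integral_finsetSum _ fun k _ => integrable_finsetSum _ fun j _ => (h k j).1]
  refine Finset.sum_congr rfl fun k _ => ?_
  rw [integral_finsetSum _ fun j _ => (h k j).1]
  exact Finset.sum_congr rfl fun j _ => (h k j).2

-- Abel summation: the damped forms are frequency integrals of resolvents at height `ε = 1 / (n +
-- 1)`, so resolvent bounds uniform in `ε` survive in the limit.
open FourierTransform in
theorem tendsto_corrForm {η : κ → ℝ → ℂ} {χ : ι → ℝ → ℂ} (hη : ∀ k, IsNice (η k))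
    (hχ : ∀ j, IsNice (χ j)) (y : κ → E) (x : ι → E) :
    Filter.Tendsto (fun n : ℕ => ∫ ξ : ℝ, ⟪∑ k, 𝓕 (η k) ξ • y k, -Complex.I •
      bc Q (sqrtResSymb (((-(2 * Real.pi * ξ) : ℝ) : ℂ) + (((n : ℝ) + 1)⁻¹ : ℝ) * Complex.I))
        (∑ j, 𝓕 (χ j) ξ • x j)⟫_ℂ) Filter.atTop (nhds (hQ.corrForm η y χ x)) := by
  have h : Filter.Tendsto (fun n : ℕ => ∑ k, ∑ j, ∫ τ in Set.Ioi (0 : ℝ),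
      (Real.exp (-((n : ℝ) + 1)⁻¹ * τ) : ℂ) * ⟪y k, hQ.flow τ (x j)⟫_ℂ *
      crossCorr (η k) (χ j) τ) Filter.atTop (nhds (hQ.corrForm η y χ x)) :=
    tendsto_finsetSum _ fun k _ => tendsto_finsetSum _ fun j _ =>
      hQ.tendsto_damped (hη k).1 (hχ j).1 (x j) (y k)
  refine h.congr fun n => ?_
  exact (hQ.sum_damped hη hχ y x (ε := ((n : ℝ) + 1)⁻¹) (by positivity)).2

end IsRegularizer

/-! ### Time reversal and the two-sided form -/

theorem crossCorr_neg (η χ : ℝ → ℂ) (τ : ℝ) :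
    crossCorr η χ (-τ) = starRingEnd ℂ (crossCorr χ η τ) := by
  unfold crossCorr
  rw [← integral_conj, ← integral_sub_right_eq_self _ τ]
  refine integral_congr_ae (Filter.Eventually.of_forall fun t => ?_)
  simp [mul_comm]

namespace IsRegularizer
variable {Q : E →L[ℂ] E} (hQ : IsRegularizer Q)
variable {ι κ : Type*} [Fintype ι] [Fintype κ]

theorem integrable_smul_flow_neg {χ : ℝ → ℂ} (hχ : Integrable χ) (x : E) :
    Integrable fun t => χ t • hQ.flow (-t) x := by
  refine Integrable.mono' (hχ.norm.mul_const ‖x‖) (hχ.1.smul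
    ((hQ.continuous_flow_apply x).comp continuous_neg).aestronglyMeasurable)
    (Filter.Eventually.of_forall fun t => ?_)
  rw [norm_smul, LinearIsometry.norm_map]

theorem inner_integral_flow_neg {η χ : ℝ → ℂ} (hη : Integrable η) (hχ : Integrable χ) (x y : E) :
    ⟪∫ t, η t • hQ.flow (-t) y, ∫ t, χ t • hQ.flow (-t) x⟫_ℂ =
      ∫ τ, ⟪y, hQ.flow τ x⟫_ℂ * crossCorr η χ τ := by
  have hη' := hQ.integrable_smul_flow_neg hη y
  have hχ' := hQ.integrable_smul_flow_neg hχ x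
  have h1 : ∀ t, ⟪∫ t, η t • hQ.flow (-t) y, χ t • hQ.flow (-t) x⟫_ℂ =
      ∫ s, starRingEnd ℂ (η s) * χ t * ⟪y, hQ.flow (s - t) x⟫_ℂ := by
    intro t
    rw [← inner_conj_symm, ← integral_inner hη', ← integral_conj]
    refine integral_congr_ae (Filter.Eventually.of_forall fun s => ?_)
    simp only
    rw [inner_conj_symm, inner_smul_left, inner_smul_right, hQ.inner_flow_left, neg_neg,
      hQ.flow_add, mul_assoc, neg_add_eq_sub]
  have hprod : Integrable (fun p : ℝ × ℝ => starRingEnd ℂ (η p.2) * χ p.1 *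
      ⟪y, hQ.flow (p.2 - p.1) x⟫_ℂ) (volume.prod volume) := by
    have h2 : Integrable (fun p : ℝ × ℝ => starRingEnd ℂ (η p.2) * χ p.1)
        (volume.prod volume) := by
      have h3 : Integrable (fun t => starRingEnd ℂ (η t)) :=
        hη.congr' (Complex.continuous_conj.comp_aestronglyMeasurable hη.1)
          (Filter.Eventually.of_forall fun t => (RCLike.norm_conj _).symm)
      exact (h3.mul_prod hχ).swap
    exact h2.mul_bdd ((hQ.continuous_inner_flow x y).comp
      (continuous_snd.sub continuous_fst)).aestronglyMeasurable
      (Filter.Eventually.of_forall fun p => hQ.norm_inner_flow_le x y _)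
  have hprod' : Integrable (fun p : ℝ × ℝ => starRingEnd ℂ (η p.2) * χ (p.2 - p.1) *
      ⟪y, hQ.flow p.1 x⟫_ℂ) (volume.prod volume) :=
    (integrable_prod_crossCorr hη hχ).mul_bdd ((hQ.continuous_inner_flow x y).comp
      continuous_fst).aestronglyMeasurable
      (Filter.Eventually.of_forall fun p => hQ.norm_inner_flow_le x y _)
  calc _ = ∫ t, ∫ s, starRingEnd ℂ (η s) * χ t * ⟪y, hQ.flow (s - t) x⟫_ℂ := by
        rw [← integral_inner hχ']
        exact integral_congr_ae (Filter.Eventually.of_forall h1)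
    _ = ∫ s, ∫ t, starRingEnd ℂ (η s) * χ t * ⟪y, hQ.flow (s - t) x⟫_ℂ :=
        integral_integral_swap hprod
    _ = ∫ s, ∫ τ, starRingEnd ℂ (η s) * χ (s - τ) * ⟪y, hQ.flow τ x⟫_ℂ := by
        refine integral_congr_ae (Filter.Eventually.of_forall fun s => ?_)
        simp only
        rw [← integral_sub_left_eq_self _ volume s]
        simp only [sub_sub_cancel]
    _ = ∫ τ, ∫ s, starRingEnd ℂ (η s) * χ (s - τ) * ⟪y, hQ.flow τ x⟫_ℂ :=
        (integral_integral_swap hprod').symm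
    _ = _ := by
        refine integral_congr_ae (Filter.Eventually.of_forall fun τ => ?_)
        simp only
        rw [integral_mul_const, mul_comm]
        rfl

/-- The square is the correlation form over all real `τ`. Time reversal makes the part over `τ < 0`
the complex conjugate of the part over `τ > 0`. -/
theorem norm_integral_flow_sq {χ : ι → ℝ → ℂ} (hχ : ∀ j, IsNice (χ j)) (x : ι → E) :
    ‖∑ j, ∫ t, χ j t • hQ.flow (-t) (x j)‖ ^ 2 = 2 * (hQ.corrForm χ x χ x).re := by
  have hi := fun k j => hQ.integrable_flow_crossCorr (hχ k).1 (hχ j).1 (x j) (x k)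
  have hneg : ∀ k j, ∫ τ in Set.Iic (0 : ℝ), ⟪x k, hQ.flow τ (x j)⟫_ℂ * crossCorr (χ k) (χ j) τ =
      starRingEnd ℂ (∫ τ in Set.Ioi (0 : ℝ), ⟪x j, hQ.flow τ (x k)⟫_ℂ *
        crossCorr (χ j) (χ k) τ) := by
    intro k j
    rw [← neg_zero, ← integral_comp_neg_Ioi, neg_zero, ← integral_conj]
    refine integral_congr_ae (Filter.Eventually.of_forall fun τ => ?_)
    simp only
    rw [crossCorr_neg, map_mul, inner_conj_symm, hQ.inner_flow_left]
  have h1 : ((‖∑ j, ∫ t, χ j t • hQ.flow (-t) (x j)‖ ^ 2 : ℝ) : ℂ) =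
      hQ.corrForm χ x χ x + starRingEnd ℂ (hQ.corrForm χ x χ x) := by
    have h2 := ofReal_norm_sum_sq (fun _ => 1) fun j => ∫ t, χ j t • hQ.flow (-t) (x j)
    simp only [one_smul, map_one, one_mul] at h2
    rw [h2]
    unfold corrForm
    simp_rw [map_sum]
    rw [Finset.sum_comm (f := fun k j => starRingEnd ℂ (∫ τ in Set.Ioi (0 : ℝ),
      ⟪x k, hQ.flow τ (x j)⟫_ℂ * crossCorr (χ k) (χ j) τ)), ← Finset.sum_add_distrib]
    refine Finset.sum_congr rfl fun k _ => ?_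
    rw [← Finset.sum_add_distrib]
    refine Finset.sum_congr rfl fun j _ => ?_
    rw [hQ.inner_integral_flow_neg (hχ k).1 (hχ j).1, ← hneg,
      ← intervalIntegral.integral_Iic_add_Ioi (hi k j).integrableOn (hi k j).integrableOn, add_comm]
  rw [Complex.add_conj] at h1
  exact_mod_cast h1

end IsRegularizer

/-! ### Bounds for the forward correlation form -/

theorem IsRegularizer.im_inner_sqrtRes {Q : E →L[ℂ] E} (hQ : IsRegularizer Q) {z : ℂ}
    (hz : z.im ≠ 0) (w : E) :
    (⟪w, bc Q (sqrtResSymb z) w⟫_ℂ).im = z.im * ‖bc Q (sqrtResSymb z) w‖ ^ 2 := by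
  have hz' : (starRingEnd ℂ z).im ≠ 0 := by simpa using hz
  have hc := contOn_sqrtResSymb hz
  have hc' := contOn_sqrtResSymb hz'
  have hcs : ContinuousOn (fun q => starRingEnd ℂ (sqrtResSymb z q)) (Set.Icc 0 1) :=
    Complex.continuous_conj.comp_continuousOn hc
  have hcc : ContinuousOn (fun q => starRingEnd ℂ (sqrtResSymb z q) * sqrtResSymb z q)
    (Set.Icc 0 1) := hcs.mul hc
  have h4 : bc Q (sqrtResSymb z) - bc Q (sqrtResSymb (starRingEnd ℂ z)) =
      (2 * Complex.I * z.im) • bc Q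
        (fun q => starRingEnd ℂ (sqrtResSymb z q) * sqrtResSymb z q) := by
    rw [← hQ.bc_sub hc hc', ← hQ.bc_const_mul _ hcc]
    exact hQ.bc_congr fun q hq => sqrtResSymb_sub_conj hz hq
  have h5 : ⟪w, bc Q (sqrtResSymb z) w⟫_ℂ - starRingEnd ℂ ⟪w, bc Q (sqrtResSymb z) w⟫_ℂ =
      (2 * Complex.I * z.im) * ((‖bc Q (sqrtResSymb z) w‖ ^ 2 : ℝ) : ℂ) := by
    rw [inner_conj_symm, IsRegularizer.inner_bc_left, hQ.bc_congr fun q _ => conj_sqrtResSymb z q,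
      ← inner_sub_right, ← _root_.sub_apply, h4, _root_.smul_apply, inner_smul_right,
      ← hQ.inner_bc_bc hc hc, inner_self_eq_norm_sq_to_K]
    push_cast
    rfl
  rw [Complex.sub_conj, show ∀ r : ℝ, 2 * Complex.I * z.im * (r : ℂ) =
    ((2 * (z.im * r) : ℝ) : ℂ) * Complex.I by intro r; push_cast; ring] at h5
  have h6 := mul_right_cancel₀ Complex.I_ne_zero h5
  rw [Complex.ofReal_inj] at h6
  linarith

section
variable {Q : E →L[ℂ] E} {hQ : IsRegularizer Q} {A : E →ₗ.[ℂ] F} {a : ℝ}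
variable {ι κ : Type*} [Fintype ι] [Fintype κ]

theorem sum_smul_quarter (h : AdjDensityBound hQ A a) (c : ι → ℂ) (u : ι → A†.domain) :
    ∑ j, c j • h.quarter (u j) = h.quarter (∑ j, c j • u j) := by
  simp

theorem norm_sum_smul_domain (c : ι → ℂ) (u : ι → A†.domain) :
    ‖∑ j, c j • u j‖ = ‖∑ j, c j • (u j : F)‖ := by
  change ‖((∑ j, c j • u j : A†.domain) : F)‖ = _
  simp

-- On the diagonal the real part of `-i ⟪w, R(z) w⟫` is `Im z ‖R(z) w‖²`, which is at most `2 a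
-- ‖u‖²` at each frequency. The two half-lines together give `4 a`.
open FourierTransform in
theorem AdjDensityBound.norm_integral_flow_sq_le (h : AdjDensityBound hQ A a)
    {χ : ι → ℝ → ℂ} (hχ : ∀ j, IsNice (χ j)) (u : ι → A†.domain) :
    ‖∑ j, ∫ t, χ j t • hQ.flow (-t) (h.quarter (u j))‖ ^ 2 ≤
      4 * a * tensorSq χ fun j => (u j : F) := by
  rw [hQ.norm_integral_flow_sq hχ]
  have hlim := (Complex.continuous_re.tendsto _).comp
    (hQ.tendsto_corrForm hχ hχ (fun j => h.quarter (u j)) fun j => h.quarter (u j))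
  have hle : (hQ.corrForm χ (fun j => h.quarter (u j)) χ fun j => h.quarter (u j)).re ≤
      2 * a * tensorSq χ fun j => (u j : F) := by
    refine le_of_tendsto hlim (Filter.Eventually.of_forall fun n => ?_)
    simp only [Function.comp_apply]
    have hint := (hQ.sum_damped hχ hχ (fun j => h.quarter (u j)) (fun j => h.quarter (u j))
      (ε := ((n : ℝ) + 1)⁻¹) (by positivity)).1
    rw [← RCLike.re_eq_complex_re, ← integral_re hint, ← tensorSq_fourier hχ, tensorSq,
      ← integral_const_mul]
    refine integral_mono hint.re ((integrable_norm_sum_sq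
      (fun j => memLp_fourier (hχ j).1 (hχ j).2) _).const_mul _) fun ξ => ?_
    simp only
    have hz : ((((-(2 * Real.pi * ξ) : ℝ) : ℂ) + (((n : ℝ) + 1)⁻¹ : ℝ) * Complex.I)).im =
        ((n : ℝ) + 1)⁻¹ := by
      rw [Complex.add_im, Complex.ofReal_im, Complex.im_ofReal_mul, Complex.I_im, mul_one, zero_add]
    have hn : (0 : ℝ) < ((n : ℝ) + 1)⁻¹ := by positivity
    have hz0 : ((((-(2 * Real.pi * ξ) : ℝ) : ℂ) + (((n : ℝ) + 1)⁻¹ : ℝ) * Complex.I)).im ≠ 0 := by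
      rw [hz]; exact hn.ne'
    rw [sum_smul_quarter, ← norm_sum_smul_domain]
    set z := ((((-(2 * Real.pi * ξ) : ℝ) : ℂ) + (((n : ℝ) + 1)⁻¹ : ℝ) * Complex.I))
    have h1 := h.resolvent_quarter_le hz0 (∑ j, 𝓕 (χ j) ξ • u j)
    rw [hz, abs_of_pos hn, ← Submodule.coe_norm] at h1
    have h2 := hQ.im_inner_sqrtRes hz0 (h.quarter (∑ j, 𝓕 (χ j) ξ • u j))
    rw [hz] at h2
    rw [inner_smul_right, RCLike.re_eq_complex_re]
    simp only [Complex.mul_re, Complex.neg_re, Complex.I_re, Complex.neg_im, Complex.I_im]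
    linarith
  linarith

/-- The vector `w = T^{-1/4} A† u` satisfies the adjoint relation required by `inner_resolvent_le`;
polarization doubles the constant `6 a`. -/
theorem AdjCauchyBound.norm_inner_resolvent_quarter_le (h : AdjCauchyBound hQ A a)
    (hA : A.IsClosed) (hAd : Dense (A.domain : Set E)) {z : ℂ} (hz : z.im ≠ 0)
    (u v : A†.domain) :
    ‖⟪h.adjDensityBound.quarter v, bc Q (sqrtResSymb z) (h.adjDensityBound.quarter u)⟫_ℂ‖ ≤
      2 * (6 * a) * (‖(v : F)‖ * ‖(u : F)‖) := by
  refine norm_inner_le_of_quadratic h.adjDensityBound.quarter _ (fun u => ?_) u v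
  rw [mul_assoc]
  refine h.inner_resolvent_le hA hAd (fun x f y hx hy => ?_) hz
  obtain ⟨hf, rfl⟩ := apply_of_mem_graph hy
  rw [h.adjDensityBound.inner_quarter hx]
  exact inner_adjoint_apply hAd u ⟨f, hf⟩

theorem integral_norm_mul_norm_le {f : ℝ → F} {g : ℝ → F} (hf : MemLp f 2) (hg : MemLp g 2) :
    Integrable (fun t => ‖f t‖ * ‖g t‖) ∧
      ∫ t, ‖f t‖ * ‖g t‖ ≤ √(∫ t, ‖f t‖ ^ 2) * √(∫ t, ‖g t‖ ^ 2) := by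
  refine ⟨hf.norm.integrable_mul hg.norm, ?_⟩
  have h := integral_mul_norm_le_Lp_mul_Lq (μ := volume) (f := f) (g := g) (p := 2) (q := 2)
    (by norm_num [Real.holderConjugate_iff]) (by simpa using hf) (by simpa using hg)
  simpa [Real.sqrt_eq_rpow] using h

-- At each frequency the form is at most `12 a` times a product of norms; Cauchy–Schwarz in `ξ` and
-- Plancherel finish.
open FourierTransform in
theorem AdjCauchyBound.norm_corrForm_le (h : AdjCauchyBound hQ A a) (ha : 0 ≤ a)
    (hA : A.IsClosed) (hAd : Dense (A.domain : Set E)) {η : κ → ℝ → ℂ} {χ : ι → ℝ → ℂ}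
    (hη : ∀ k, IsNice (η k)) (hχ : ∀ j, IsNice (χ j)) (v : κ → A†.domain) (u : ι → A†.domain) :
    ‖hQ.corrForm η (fun k => h.adjDensityBound.quarter (v k)) χ
      fun j => h.adjDensityBound.quarter (u j)‖ ≤
      12 * a * (√(tensorSq η fun k => (v k : F)) * √(tensorSq χ fun j => (u j : F))) := by
  have hlim := (hQ.tendsto_corrForm hη hχ (fun k => h.adjDensityBound.quarter (v k))
    fun j => h.adjDensityBound.quarter (u j)).norm
  refine le_of_tendsto hlim (Filter.Eventually.of_forall fun n => ?_)
  have hη' := memLp_sum_smul (fun k => memLp_fourier (hη k).1 (hη k).2) fun k => (v k : F)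
  have hχ' := memLp_sum_smul (fun j => memLp_fourier (hχ j).1 (hχ j).2) fun j => (u j : F)
  have hcs := integral_norm_mul_norm_le hη' hχ'
  rw [← tensorSq_fourier hη, ← tensorSq_fourier hχ]
  refine le_trans ?_ (mul_le_mul_of_nonneg_left hcs.2 (by positivity))
  rw [← integral_const_mul]
  refine norm_integral_le_of_norm_le (hcs.1.const_mul _) (Filter.Eventually.of_forall fun ξ => ?_)
  have hz0 : ((((-(2 * Real.pi * ξ) : ℝ) : ℂ) + (((n : ℝ) + 1)⁻¹ : ℝ) * Complex.I)).im ≠ 0 := by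
    rw [Complex.add_im, Complex.ofReal_im, Complex.im_ofReal_mul, Complex.I_im, mul_one, zero_add]
    positivity
  rw [sum_smul_quarter, sum_smul_quarter, ← norm_sum_smul_domain, ← norm_sum_smul_domain,
    inner_smul_right, norm_mul, norm_neg, Complex.norm_I, one_mul]
  refine (h.norm_inner_resolvent_quarter_le hA hAd hz0 _ _).trans (le_of_eq ?_)
  rw [Submodule.coe_norm, Submodule.coe_norm]
  ring

end

end

section

universe uE uF

variable {E : Type uE} [NormedAddCommGroup E] [InnerProductSpace ℂ E] [CompleteSpace E]
variable {F : Type uF} [NormedAddCommGroup F] [InnerProductSpace ℂ F] [CompleteSpace F]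

/-! ### Representation of functionals on step functions -/

/-- A bounded functional on a vector space mapped to a Hilbert space is represented by a vector. -/
theorem exists_inner_eq_of_bound {V : Type*} [AddCommGroup V] [Module ℂ V] (e : V →ₗ[ℂ] F)
    (l : V →ₗ[ℂ] ℂ) {c : ℝ} (hc : 0 ≤ c) (h : ∀ x, ‖l x‖ ≤ c * ‖e x‖) :
    ∃ G : F, ‖G‖ ≤ c ∧ ∀ x, ⟪G, e x⟫_ℂ = l x := by
  let K := (LinearMap.range e).topologicalClosure
  have hKc : IsClosed (K : Set F) := (LinearMap.range e).isClosed_topologicalClosure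
  have : CompleteSpace K := hKc.completeSpace_coe
  let e' : V →ₗ[ℂ] K := e.codRestrict K fun x =>
    (LinearMap.range e).le_topologicalClosure (LinearMap.mem_range_self e x)
  have hd : DenseRange e' := by
    rintro ⟨y, hy⟩
    have hy' : y ∈ closure (LinearMap.range e : Set F) := hy
    rw [Metric.mem_closure_iff] at hy' ⊢
    intro ε hε
    obtain ⟨_, ⟨x, rfl⟩, hx⟩ := hy' ε hε
    exact ⟨e' x, ⟨x, rfl⟩, hx⟩
  have hb : ∀ x, ‖l x‖ ≤ c * ‖e' x‖ := h
  let f : K →L[ℂ] ℂ := l.extendOfNorm e'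
  have hf : ∀ x, f (e' x) = l x := fun x => LinearMap.extendOfNorm_eq hd ⟨c, hb⟩ x
  have hfn : ‖f‖ ≤ c := LinearMap.opNorm_extendOfNorm_le hd hc hb
  refine ⟨((InnerProductSpace.toDual ℂ K).symm f : K), ?_, fun x => ?_⟩
  · have h1 := (InnerProductSpace.toDual ℂ K).symm.norm_map f
    rw [← h1] at hfn
    exact hfn
  · have h1 := InnerProductSpace.toDual_symm_apply (𝕜 := ℂ) (x := e' x) (y := f)
    rw [hf] at h1
    exact h1

/-- Measurable sets of finite length. -/
def FinSet : Type := {S : Set ℝ // MeasurableSet S ∧ volume S ≠ ∞}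

theorem isNice_indicator (S : FinSet) (c : ℂ) : IsNice (S.1.indicator fun _ => c) :=
  ⟨memLp_one_iff_integrable.1 (memLp_indicator_const 1 S.2.1 c (Or.inr S.2.2)),
    memLp_indicator_const 2 S.2.1 c (Or.inr S.2.2)⟩

theorem norm_sum_indicatorConstLp {ι : Type*} [Fintype ι] (S : ι → FinSet) (α : ι → ℂ)
    (u : ι → F) : ‖∑ i, α i • indicatorConstLp 2 (S i).2.1 (S i).2.2 (u i)‖ =
      √(tensorSq (fun i => (S i).1.indicator fun _ => α i) u) := by
  have h1 := ofReal_tensorSq (fun i => (isNice_indicator (S i) (α i)).2) u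
  have h2 := ofReal_norm_sum_sq α fun i => indicatorConstLp 2 (S i).2.1 (S i).2.2 (u i)
  have h3 : ((‖∑ i, α i • indicatorConstLp 2 (S i).2.1 (S i).2.2 (u i)‖ ^ 2 : ℝ) : ℂ) =
      ((tensorSq (fun i => (S i).1.indicator fun _ => α i) u : ℝ) : ℂ) := by
    rw [h1, h2]
    refine Finset.sum_congr rfl fun i _ => Finset.sum_congr rfl fun j _ => ?_
    rw [L2.inner_indicatorConstLp_indicatorConstLp (𝕜 := ℂ) (S i).2.1 (S j).2.1 (S i).2.2 (S j).2.2]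
    have h4 : ∀ t, starRingEnd ℂ ((S i).1.indicator (fun _ => α i) t) *
        (S j).1.indicator (fun _ => α j) t =
        ((S i).1 ∩ (S j).1).indicator (fun _ => starRingEnd ℂ (α i) * α j) t := by
      intro t
      by_cases hi : t ∈ (S i).1 <;> by_cases hj : t ∈ (S j).1 <;> simp [hi, hj]
    simp_rw [h4]
    rw [integral_indicator_const _ ((S i).2.1.inter (S j).2.1), Complex.real_smul,
      Complex.real_smul]
    ring
  have h4 : ‖∑ i, α i • indicatorConstLp 2 (S i).2.1 (S i).2.2 (u i)‖ ^ 2 =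
      tensorSq (fun i => (S i).1.indicator fun _ => α i) u := by exact_mod_cast h3
  rw [← h4, Real.sqrt_sq (norm_nonneg _)]

/-- The functional is set up on formal combinations of pairs (set, vector), so well-definedness on
step functions is not checked separately: the bound forces it to factor through `L²`. The index
types live in `Type uF` because the supports of such combinations do. -/
theorem exists_lp_of_step_bound {D : Submodule ℂ F} (b : FinSet → D → ℂ) {c : ℝ} (hc : 0 ≤ c)
    (h : ∀ (ι : Type uF) [Fintype ι] (S : ι → FinSet) (α : ι → ℂ) (u : ι → D),
      ‖∑ i, α i * b (S i) (u i)‖ ≤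
        c * √(tensorSq (fun i => (S i).1.indicator fun _ => α i) fun i => (u i : F))) :
    ∃ G : Lp F 2 (volume : Measure ℝ), ‖G‖ ≤ c ∧
      ∀ (S : FinSet) (u : D), ∫ t in S.1, ⟪G t, (u : F)⟫_ℂ = b S u := by
  let e : (FinSet × D →₀ ℂ) →ₗ[ℂ] Lp F 2 (volume : Measure ℝ) :=
    Finsupp.linearCombination ℂ fun p => indicatorConstLp 2 p.1.2.1 p.1.2.2 (p.2 : F)
  let l : (FinSet × D →₀ ℂ) →ₗ[ℂ] ℂ := Finsupp.linearCombination ℂ fun p => b p.1 p.2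
  have hb : ∀ x, ‖l x‖ ≤ c * ‖e x‖ := by
    intro x
    have h1 := h x.support (fun p => p.1.1) (fun p => x p.1) (fun p => p.1.2)
    rw [← norm_sum_indicatorConstLp] at h1
    have e1 : l x = ∑ p : x.support, x p.1 * b p.1.1 p.1.2 := by
      rw [Finset.sum_coe_sort x.support fun p => x p * b p.1 p.2]
      rfl
    have e2 : e x = ∑ p : x.support, x p.1 • indicatorConstLp 2 p.1.1.2.1 p.1.1.2.2 (p.1.2 : F) := by
      rw [Finset.sum_coe_sort x.support fun p => x p • indicatorConstLp 2 p.1.2.1 p.1.2.2 (p.2 : F)]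
      rfl
    rw [e1, e2]
    exact h1
  obtain ⟨G, hG, hGe⟩ := exists_inner_eq_of_bound e l hc hb
  refine ⟨G, hG, fun S u => ?_⟩
  have h1 := hGe (Finsupp.single (S, u) 1)
  have e1 : e (Finsupp.single (S, u) 1) = indicatorConstLp 2 S.2.1 S.2.2 (u : F) := by
    simp [e, Finsupp.linearCombination_single]
  have e2 : l (Finsupp.single (S, u) 1) = b S u := by
    simp [l, Finsupp.linearCombination_single]
  rw [e1, e2, ← inner_conj_symm, L2.inner_indicatorConstLp_eq_setIntegral_inner ℂ G S.2.1 _ S.2.2,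
    ← integral_conj] at h1
  rw [← h1]
  exact integral_congr_ae (Filter.Eventually.of_forall fun t => (inner_conj_symm _ _).symm)

/-- A locally integrable function satisfying an operator equation in the weak sense satisfies it
almost everywhere. -/
theorem ae_mem_graph_of_integral {A : E →ₗ.[ℂ] F} (hA : A.IsClosed)
    (hAd : Dense (A.domain : Set E)) {f : ℝ → E} (hf : Continuous f) {G : ℝ → F}
    (hG : MemLp G 2) (h : ∀ (S : FinSet) (u : A†.domain),
      ∫ t in S.1, ⟪G t, (u : F)⟫_ℂ = ∫ t in S.1, ⟪f t, A† u⟫_ℂ) :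
    ∀ᵐ t, (f t, G t) ∈ A.graph := by
  have hfin : ∀ x y : ℝ, volume (Set.Ioc x y) ≠ ∞ := fun x y => by simp
  have hfi : ∀ x y : ℝ, IntegrableOn f (Set.Ioc x y) := fun x y =>
    (hf.integrableOn_Icc).mono_set Set.Ioc_subset_Icc_self
  have hGl : LocallyIntegrable G := hG.locallyIntegrable (by norm_num)
  have hGi : ∀ x y : ℝ, IntegrableOn G (Set.Ioc x y) := fun x y =>
    (hGl.integrableOn_isCompact isCompact_Icc).mono_set Set.Ioc_subset_Icc_self
  -- Integrating over intervals turns the weak equation into membership in the closed graph;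
  -- Lebesgue differentiation then recovers almost every point.
  have key : ∀ x y : ℝ, (∫ t in Set.Ioc x y, f t, ∫ t in Set.Ioc x y, G t) ∈ A.graph := by
    intro x y
    refine mem_graph_of_inner_adjoint hA hAd fun u => ?_
    have h1 := congrArg (starRingEnd ℂ) (h ⟨Set.Ioc x y, measurableSet_Ioc, hfin x y⟩ u)
    rw [← integral_conj, ← integral_conj] at h1
    simp only [inner_conj_symm] at h1
    rw [← integral_inner (hfi x y), ← integral_inner (hGi x y)]
    exact h1.symm
  have key' : ∀ x : ℝ, (∫ t in (0 : ℝ)..x, f t, ∫ t in (0 : ℝ)..x, G t) ∈ A.graph := by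
    intro x
    -- The interval integral is by definition the difference of these two integrals, whatever the
    -- order of the endpoints.
    have := A.graph.sub_mem (key 0 x) (key x 0)
    exact this
  filter_upwards [LocallyIntegrable.ae_hasDerivAt_integral hGl] with t ht
  have h1 := (ht 0).tendsto_slope
  have h2 := (intervalIntegral.integral_hasDerivAt_right (hf.intervalIntegrable 0 t)
    hf.stronglyMeasurable.stronglyMeasurableAtFilter hf.continuousAt).tendsto_slope
  have hcl : IsClosed (A.graph : Set (E × F)) := hA
  refine hcl.mem_of_tendsto (h2.prodMk_nhds h1) (Filter.Eventually.of_forall fun x => ?_)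
  simp only [slope, vsub_eq_sub]
  have h3 := A.graph.smul_of_tower_mem (x - t)⁻¹ (A.graph.sub_mem (key' x) (key' t))
  exact h3

/-! ### Square integrability along the flow -/

section
variable {Q : E →L[ℂ] E} {hQ : IsRegularizer Q} {A : E →ₗ.[ℂ] F} {a : ℝ}

namespace AdjDensityBound
variable (h : AdjDensityBound hQ A a)
include h

theorem gr_quarter_adjoint (u : A†.domain) : Gr Q (pw (1 / 4)) (h.quarter u) (A† u) := by
  refine hQ.gr_div (φ := pw (-(1 / 4))) (adm_pw (by norm_num) (by norm_num))
    (adm_pw (by norm_num) (by norm_num)) adm_one (fun μ hμ => ?_) (h.gr_quarter u) (hQ.gr_one _)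
  rw [pw_mul hμ]
  simp [pw]

/-- The power `T^{1/4}`, which commutes with the flow, is moved from `T^{-1/4} A† u` onto `v`. -/
theorem inner_flow_adjoint {v w : E} (hvw : Gr Q (pw (1 / 4)) v w) (t : ℝ) (u : A†.domain) :
    ⟪hQ.flow t v, A† u⟫_ℂ = ⟪hQ.flow t w, h.quarter u⟫_ℂ :=
  (hQ.gr_symm (adm_pw (by norm_num) (by norm_num)) (conj_pw _)
    (hQ.gr_flow_flow (adm_pw (by norm_num) (by norm_num)) t hvw) (h.gr_quarter_adjoint u)).symm

/-- Duality: against a step function the integral of `⟪exp (-i t √T) v, A† h(t)⟫` is the inner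
product of `w = T^{1/4} v` with the vector of `norm_integral_flow_sq_le`, whose norm is at most `2
√a ‖h‖`. Closedness of `A` identifies the representing function. -/
theorem exists_lp_flow (ha : 0 ≤ a) (hA : A.IsClosed) (hAd : Dense (A.domain : Set E)) {v w : E}
    (hvw : Gr Q (pw (1 / 4)) v w) : ∃ G : Lp F 2 (volume : Measure ℝ), ‖G‖ ≤ 2 * √a * ‖w‖ ∧
      ∀ᵐ t, (hQ.flow t v, G t) ∈ A.graph := by
  obtain ⟨G, hG, hGe⟩ := exists_lp_of_step_bound (D := A†.domain)
    (fun S u => ∫ t in S.1, ⟪hQ.flow t v, A† u⟫_ℂ) (c := 2 * √a * ‖w‖) (by positivity) (by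
    intro ι _ S α u
    have hn := fun i => isNice_indicator (S i) (α i)
    have e1 : ∑ i, α i * ∫ t in (S i).1, ⟪hQ.flow t v, A† (u i)⟫_ℂ =
        ⟪w, ∑ i, ∫ t, (S i).1.indicator (fun _ => α i) t • hQ.flow (-t) (h.quarter (u i))⟫_ℂ := by
      rw [inner_sum]
      refine Finset.sum_congr rfl fun i _ => ?_
      rw [← integral_inner (hQ.integrable_smul_flow_neg (hn i).1 _), ← integral_const_mul,
        ← integral_indicator (S i).2.1]
      refine integral_congr_ae (Filter.Eventually.of_forall fun t => ?_)
      simp only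
      by_cases ht : t ∈ (S i).1
      · rw [Set.indicator_of_mem ht, Set.indicator_of_mem ht, h.inner_flow_adjoint hvw,
          inner_smul_right, hQ.inner_flow_left]
      · rw [Set.indicator_of_notMem ht, Set.indicator_of_notMem ht, zero_smul, inner_zero_right]
    rw [e1]
    refine (norm_inner_le_norm _ _).trans ?_
    have h2 := h.norm_integral_flow_sq_le hn u
    have h3 := Real.le_sqrt_of_sq_le h2
    rw [Real.sqrt_mul (by positivity), Real.sqrt_mul (by norm_num),
      show (4 : ℝ) = 2 ^ 2 by norm_num, Real.sqrt_sq (by norm_num)] at h3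
    calc _ ≤ ‖w‖ * _ := mul_le_mul_of_nonneg_left h3 (norm_nonneg _)
      _ = _ := by ring)
  exact ⟨G, hG, ae_mem_graph_of_integral hA hAd (hQ.continuous_flow_apply v) (Lp.memLp G) hGe⟩

end AdjDensityBound

end

end

section

universe uE uF

variable {E : Type uE} [NormedAddCommGroup E] [InnerProductSpace ℂ E] [CompleteSpace E]
variable {F : Type uF} [NormedAddCommGroup F] [InnerProductSpace ℂ F] [CompleteSpace F]

/-! ### Convolution over a half-line -/

theorem integrable_conv_smul {χ : ℝ → ℂ} {Φ : ℝ → F} (hχ : MemLp χ 2) (hΦ : MemLp Φ 2) (t : ℝ) :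
    Integrable (fun τ => χ (t - τ) • Φ τ) ∧
      ∫ τ, ‖χ (t - τ) • Φ τ‖ ≤ (∫ τ, ‖χ τ‖ ^ 2) + ∫ τ, ‖Φ τ‖ ^ 2 := by
  have hm : MeasurePreserving (fun τ : ℝ => t - τ) volume volume :=
    Measure.measurePreserving_sub_left volume t
  have h1 : Integrable fun τ => ‖χ (t - τ)‖ ^ 2 :=
    (hχ.comp_measurePreserving hm).integrable_norm_pow (by norm_num)
  have h2 : Integrable fun τ => ‖Φ τ‖ ^ 2 := hΦ.integrable_norm_pow (by norm_num)
  have h3 : ∀ τ, ‖χ (t - τ) • Φ τ‖ ≤ ‖χ (t - τ)‖ ^ 2 + ‖Φ τ‖ ^ 2 := by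
    intro τ
    rw [norm_smul]
    nlinarith [sq_nonneg (‖χ (t - τ)‖ - ‖Φ τ‖), norm_nonneg (χ (t - τ)), norm_nonneg (Φ τ)]
  have h4 : Integrable fun τ => χ (t - τ) • Φ τ :=
    Integrable.mono' (h1.add h2) ((hχ.comp_measurePreserving hm).1.smul hΦ.1)
      (Filter.Eventually.of_forall h3)
  refine ⟨h4, (integral_mono h4.norm (h1.add h2) h3).trans (le_of_eq ?_)⟩
  refine (integral_add h1 h2).trans ?_
  rw [integral_sub_left_eq_self (fun τ => ‖χ τ‖ ^ 2) volume t]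

/-- A finite sum of convolutions over the half-line `P`. -/
def halfConv {ι : Type*} [Fintype ι] (P : Set ℝ) (χ : ι → ℝ → ℂ) (Φ : ι → ℝ → F) (t : ℝ) : F :=
  ∑ j, ∫ τ in P, χ j (t - τ) • Φ j τ

section
variable {ι : Type*} [Fintype ι] {P : Set ℝ} {χ : ι → ℝ → ℂ} {Φ : ι → ℝ → F}

theorem stronglyMeasurable_halfConv (hχ : ∀ j, StronglyMeasurable (χ j))
    (hΦ : ∀ j, StronglyMeasurable (Φ j)) : StronglyMeasurable (halfConv P χ Φ) := by
  unfold halfConv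
  refine Finset.stronglyMeasurable_fun_sum _ fun j _ => ?_
  refine StronglyMeasurable.integral_prod_right
    (f := fun t τ => χ j (t - τ) • Φ j τ) ?_
  exact ((hχ j).comp_measurable (measurable_fst.sub measurable_snd)).smul
    ((hΦ j).comp_measurable measurable_snd)

theorem norm_halfConv_le (hχ : ∀ j, MemLp (χ j) 2) (hΦ : ∀ j, MemLp (Φ j) 2) (t : ℝ) :
    ‖halfConv P χ Φ t‖ ≤ ∑ j, ((∫ τ, ‖χ j τ‖ ^ 2) + ∫ τ, ‖Φ j τ‖ ^ 2) := by
  refine (norm_sum_le _ _).trans (Finset.sum_le_sum fun j _ => ?_)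
  obtain ⟨h1, h2⟩ := integrable_conv_smul (hχ j) (hΦ j) t
  refine (norm_integral_le_integral_norm _).trans (le_trans ?_ h2)
  exact setIntegral_le_integral h1.norm (Filter.Eventually.of_forall fun τ => norm_nonneg _)

theorem inner_halfConv {g : ι → ℝ → ℂ} (hχ : ∀ j, MemLp (χ j) 2) (hΦ : ∀ j, MemLp (Φ j) 2) {v : F}
    (hg : ∀ j, ∀ᵐ τ, ⟪v, Φ j τ⟫_ℂ = g j τ) (t : ℝ) :
    ⟪v, halfConv P χ Φ t⟫_ℂ = ∑ j, ∫ τ in P, χ j (t - τ) * g j τ := by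
  unfold halfConv
  rw [inner_sum]
  refine Finset.sum_congr rfl fun j _ => ?_
  rw [← integral_inner (integrable_conv_smul (hχ j) (hΦ j) t).1.integrableOn]
  refine integral_congr_ae ?_
  filter_upwards [ae_restrict_of_ae (hg j)] with τ hτ
  rw [inner_smul_right, hτ]

/-- Fubini. The functions `Φ j` enter only through their pairings with `v`, which agree almost
everywhere with continuous bounded functions. -/
theorem integral_mul_inner_halfConv {g : ι → ℝ → ℂ} (hχ : ∀ j, IsNice (χ j))
    (hΦ : ∀ j, MemLp (Φ j) 2) {v : F} (hg : ∀ j, ∀ᵐ τ, ⟪v, Φ j τ⟫_ℂ = g j τ)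
    (hgc : ∀ j, Continuous (g j)) {C : ℝ} (hgb : ∀ j τ, ‖g j τ‖ ≤ C) {η : ℝ → ℂ}
    (hη : Integrable η) :
    ∫ t, starRingEnd ℂ (η t) * ⟪v, halfConv P χ Φ t⟫_ℂ =
      ∑ j, ∫ τ in P, g j τ * crossCorr η (χ j) τ := by
  have hp : ∀ j, Integrable (fun p : ℝ × ℝ => starRingEnd ℂ (η p.2) * χ j (p.2 - p.1) * g j p.1)
      ((volume.restrict P).prod volume) := by
    intro j
    have h1 : Integrable (fun p : ℝ × ℝ => starRingEnd ℂ (η p.2) * χ j (p.2 - p.1))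
        ((volume.restrict P).prod volume) := by
      have h2 := (integrable_prod_crossCorr hη (hχ j).1).restrict (s := P ×ˢ Set.univ)
      rwa [← Measure.prod_restrict, Measure.restrict_univ] at h2
    exact h1.mul_bdd ((hgc j).comp continuous_fst).aestronglyMeasurable
      (Filter.Eventually.of_forall fun p => hgb j p.1)
  have e1 : ∀ t, starRingEnd ℂ (η t) * ⟪v, halfConv P χ Φ t⟫_ℂ =
      ∑ j, ∫ τ in P, starRingEnd ℂ (η t) * χ j (t - τ) * g j τ := by
    intro t
    rw [inner_halfConv (fun j => (hχ j).2) hΦ hg, Finset.mul_sum]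
    refine Finset.sum_congr rfl fun j _ => ?_
    rw [← integral_const_mul]
    simp_rw [mul_assoc]
  simp_rw [e1]
  rw [integral_finsetSum _ fun j _ => (hp j).integral_prod_right]
  refine Finset.sum_congr rfl fun j _ => ?_
  rw [← integral_integral_swap (hp j)]
  refine integral_congr_ae (Filter.Eventually.of_forall fun τ => ?_)
  simp only
  rw [integral_mul_const, mul_comm]
  rfl

/-- The assumed bound represents the pairing with step functions by some `G` in `L²` of norm at most
`c`. Integrals over sets of finite measure, tested on the dense space `D`, identify `G` with the
convolution. -/
theorem eLpNorm_halfConv_le {D : Submodule ℂ F} (hD : Dense (D : Set F))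
    (hχm : ∀ j, StronglyMeasurable (χ j)) (hχ : ∀ j, IsNice (χ j))
    (hΦm : ∀ j, StronglyMeasurable (Φ j)) (hΦ : ∀ j, MemLp (Φ j) 2) {g : D → ι → ℝ → ℂ}
    (hg : ∀ (v : D) j, ∀ᵐ τ, ⟪(v : F), Φ j τ⟫_ℂ = g v j τ) (hgc : ∀ v j, Continuous (g v j))
    {C : D → ℝ} (hgb : ∀ v j τ, ‖g v j τ‖ ≤ C v) {c : ℝ} (hc : 0 ≤ c)
    (hb : ∀ (κ : Type uF) [Fintype κ] (η : κ → ℝ → ℂ) (_ : ∀ k, IsNice (η k)) (v : κ → D),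
      ‖∑ k, ∑ j, ∫ τ in P, g (v k) j τ * crossCorr (η k) (χ j) τ‖ ≤
        c * √(tensorSq η fun k => (v k : F))) :
    eLpNorm (halfConv P χ Φ) 2 volume ≤ ENNReal.ofReal c := by
  have hYm := stronglyMeasurable_halfConv (P := P) hχm hΦm
  have hYb := norm_halfConv_le (P := P) (fun j => (hχ j).2) hΦ
  have hYi : ∀ S : Set ℝ, volume S ≠ ∞ → IntegrableOn (halfConv P χ Φ) S := fun S hS =>
    Measure.integrableOn_of_bounded hS hYm.aestronglyMeasurable
      (Filter.Eventually.of_forall hYb)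
  obtain ⟨G, hG, hGe⟩ := exists_lp_of_step_bound (D := D)
    (fun S v => ∫ t in S.1, ⟪halfConv P χ Φ t, (v : F)⟫_ℂ) hc (by
    intro κ _ S α v
    have hn := fun k => isNice_indicator (S k) (α k)
    have e1 : starRingEnd ℂ (∑ k, α k * ∫ t in (S k).1, ⟪halfConv P χ Φ t, (v k : F)⟫_ℂ) =
        ∑ k, ∑ j, ∫ τ in P, g (v k) j τ *
          crossCorr ((S k).1.indicator fun _ => α k) (χ j) τ := by
      rw [map_sum]
      refine Finset.sum_congr rfl fun k _ => ?_
      rw [← integral_mul_inner_halfConv hχ hΦ (hg (v k)) (hgc (v k)) (hgb (v k)) (hn k).1,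
        map_mul, ← integral_conj, ← integral_const_mul, ← integral_indicator (S k).2.1]
      refine integral_congr_ae (Filter.Eventually.of_forall fun t => ?_)
      simp only
      by_cases ht : t ∈ (S k).1
      · rw [Set.indicator_of_mem ht, Set.indicator_of_mem ht, inner_conj_symm]
      · rw [Set.indicator_of_notMem ht, Set.indicator_of_notMem ht, map_zero, zero_mul]
    rw [← RCLike.norm_conj, e1]
    exact hb κ _ hn v)
  have hGi : ∀ S : Set ℝ, volume S ≠ ∞ → IntegrableOn G S := fun S hS =>
    integrableOn_Lp_of_measure_ne_top G fact_one_le_two_ennreal.elim hS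
  have hae : (fun t => halfConv P χ Φ t - G t) =ᵐ[volume] 0 := by
    refine ae_eq_zero_of_forall_setIntegral_eq_of_sigmaFinite
      (fun S _ hS => (hYi S hS.ne).sub (hGi S hS.ne)) fun S hSm hS => ?_
    rw [integral_sub (hYi S hS.ne) (hGi S hS.ne)]
    refine hD.eq_zero_of_inner_left ℂ fun v hv => ?_
    rw [inner_sub_left, sub_eq_zero, ← inner_conj_symm, ← integral_inner (hYi S hS.ne),
      ← inner_conj_symm _ v, ← integral_inner (hGi S hS.ne), ← integral_conj, ← integral_conj]
    simp only [inner_conj_symm]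
    exact (hGe ⟨S, hSm, hS.ne⟩ ⟨v, hv⟩).symm
  have hae' : halfConv P χ Φ =ᵐ[volume] G := by
    filter_upwards [hae] with t ht
    exact sub_eq_zero.1 ht
  rw [eLpNorm_congr_ae hae', ← ENNReal.ofReal_toReal (Lp.eLpNorm_ne_top G), ← Lp.norm_def]
  exact ENNReal.ofReal_le_ofReal hG

end

/-! ### The inhomogeneous problem -/

/-- Substitution `τ = t - s`: the condition `0 < s ≤ t` becomes `s > 0, τ ≥ 0`, and `t < s ≤ 0`
becomes `s ≤ 0, τ < 0`. Each is a half-line convolution with a truncated source. -/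
theorem intervalIntegral_eq_halfConv {ι : Type*} [Fintype ι] {χ : ι → ℝ → ℂ} {Φ : ι → ℝ → F}
    (hχ : ∀ j, MemLp (χ j) 2) (hΦ : ∀ j, MemLp (Φ j) 2) (t : ℝ) :
    (∀ s₁ s₂, IntervalIntegrable (fun s => ∑ j, χ j s • Φ j (t - s)) volume s₁ s₂) ∧
    (∫ s in Set.Ioc 0 t, ∑ j, χ j s • Φ j (t - s) =
      halfConv (Set.Ici 0) (fun j => (Set.Ioi 0).indicator (χ j)) Φ t) ∧
    ∫ s in Set.Ioc t 0, ∑ j, χ j s • Φ j (t - s) =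
      halfConv (Set.Iio 0) (fun j => (Set.Iic 0).indicator (χ j)) Φ t := by
  have hi : ∀ j, Integrable fun s => χ j s • Φ j (t - s) := by
    intro j
    have h1 := (integrable_conv_smul (hχ j) (hΦ j) t).1.comp_sub_left t
    simpa using h1
  refine ⟨fun s₁ s₂ => (integrable_finsetSum _ fun j _ => hi j).intervalIntegrable, ?_, ?_⟩
  · rw [integral_finsetSum _ fun j _ => (hi j).integrableOn]
    refine Finset.sum_congr rfl fun j _ => ?_
    rw [← integral_indicator measurableSet_Ioc, ← integral_indicator measurableSet_Ici,
      ← integral_sub_left_eq_self _ volume t]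
    refine integral_congr_ae (Filter.Eventually.of_forall fun τ => ?_)
    simp only [Set.indicator_apply, Set.mem_Ioc, Set.mem_Ici, Set.mem_Ioi, sub_sub_cancel]
    by_cases h1 : 0 < t - τ <;> by_cases h2 : 0 ≤ τ <;> simp [h1, h2]
  · rw [integral_finsetSum _ fun j _ => (hi j).integrableOn]
    refine Finset.sum_congr rfl fun j _ => ?_
    rw [← integral_indicator measurableSet_Ioc, ← integral_indicator measurableSet_Iio,
      ← integral_sub_left_eq_self _ volume t]
    refine integral_congr_ae (Filter.Eventually.of_forall fun τ => ?_)
    simp only [Set.indicator_apply, Set.mem_Ioc, Set.mem_Iic, Set.mem_Iio, sub_sub_cancel]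
    have h3 : t < t - τ ↔ τ < 0 := by constructor <;> intro <;> linarith
    by_cases h1 : t - τ ≤ 0 <;> by_cases h2 : τ < 0 <;> simp [h1, h2, h3]

theorem eLpNorm_two_sq (f : ℝ → F) : eLpNorm f 2 volume ^ 2 = ∫⁻ t, ‖f t‖ₑ ^ 2 := by
  have h := eLpNorm_nnreal_pow_eq_lintegral (μ := (volume : Measure ℝ)) (f := f) (p := 2) two_ne_zero
  simp only [NNReal.coe_ofNat, ENNReal.coe_ofNat, ENNReal.rpow_ofNat] at h
  exact h

/-- At each `t` at most one of the two pieces is nonzero, so squared norms add without a cross term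
and the split costs no factor. -/
theorem eLpNorm_two_le_of_split {y y₁ y₂ : ℝ → F} (h1m : StronglyMeasurable y₁)
    (h : ∀ t, (y t = y₁ t ∧ y₂ t = 0) ∨ (y t = -y₂ t ∧ y₁ t = 0)) {c c₁ c₂ : ℝ} (hc : 0 ≤ c)
    (hc₁ : 0 ≤ c₁) (hc₂ : 0 ≤ c₂)
    (h1 : eLpNorm y₁ 2 volume ≤ ENNReal.ofReal c₁) (h2 : eLpNorm y₂ 2 volume ≤ ENNReal.ofReal c₂)
    (hcc : c₁ ^ 2 + c₂ ^ 2 ≤ c ^ 2) : eLpNorm y 2 volume ≤ ENNReal.ofReal c := by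
  rw [← ENNReal.pow_le_pow_left_iff two_ne_zero, eLpNorm_two_sq]
  have e : ∀ t, ‖y t‖ₑ ^ 2 = ‖y₁ t‖ₑ ^ 2 + ‖y₂ t‖ₑ ^ 2 := by
    intro t
    rcases h t with ⟨e1, e2⟩ | ⟨e1, e2⟩ <;> simp [e1, e2]
  simp_rw [e]
  rw [lintegral_add_left (h1m.enorm.pow_const 2), ← eLpNorm_two_sq, ← eLpNorm_two_sq,
    ← ENNReal.ofReal_pow hc]
  refine le_trans ?_ (ENNReal.ofReal_le_ofReal hcc)
  rw [ENNReal.ofReal_add (by positivity) (by positivity), ENNReal.ofReal_pow hc₁,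
    ENNReal.ofReal_pow hc₂]
  gcongr

section
variable {Q : E →L[ℂ] E} {hQ : IsRegularizer Q} {A : E →ₗ.[ℂ] F} {a : ℝ}

namespace AdjCauchyBound
variable (h : AdjCauchyBound hQ A a)
include h

/-- The second relation makes `T^{-1/2} A† u` an admissible initial vector for the homogeneous
estimate. -/
theorem exists_gr_half (u : A†.domain) : ∃ k, Gr Q (pw (-(1 / 2))) (A† u) k ∧
    Gr Q (pw (1 / 4)) k (h.adjDensityBound.quarter u) := by
  have hm : MemLp (fun s => pw (-(1 / 2)) (s ^ 2)) 2 (hQ.meas (A† u)) := by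
    refine (memLp_congr_ae ?_).2 (h u).memLp_inv
    filter_upwards [(h u).pos] with s hs
    rw [pw_sq hs]
    norm_num
    rw [Real.rpow_neg_one, Complex.ofReal_inv]
  have h1 : Gr Q (pw (-(1 / 2))) (A† u) (hQ.vec (A† u) fun s => pw (-(1 / 2)) (s ^ 2)) :=
    hQ.gr_self_vec (adm_pw (by norm_num) (by norm_num)) hm fun _ _ => rfl
  refine ⟨_, h1, hQ.gr_div (φ := pw (-(1 / 2))) (adm_pw (by norm_num) (by norm_num))
    (adm_pw (by norm_num) (by norm_num)) (adm_pw (by norm_num) (by norm_num)) (fun μ hμ => ?_) h1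
    (h.adjDensityBound.gr_quarter u)⟩
  rw [pw_mul hμ]
  norm_num

/-- The function `A exp (-i τ √T) T^{-1/2} A† u`. -/
theorem exists_propagator (ha : 0 ≤ a) (hA : A.IsClosed) (hAd : Dense (A.domain : Set E))
    (u : A†.domain) : ∃ (k : E) (Φ : ℝ → F), Gr Q (pw (-(1 / 2))) (A† u) k ∧
      StronglyMeasurable Φ ∧ MemLp Φ 2 ∧ (∀ᵐ τ, (hQ.flow τ k, Φ τ) ∈ A.graph) ∧
      ∀ v : A†.domain, ∀ᵐ τ, ⟪(v : F), Φ τ⟫_ℂ =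
        ⟪h.adjDensityBound.quarter v, hQ.flow τ (h.adjDensityBound.quarter u)⟫_ℂ := by
  obtain ⟨k, hk, hk'⟩ := h.exists_gr_half u
  obtain ⟨G, -, hG⟩ := h.adjDensityBound.exists_lp_flow ha hA hAd hk'
  refine ⟨k, G, hk, Lp.stronglyMeasurable G, Lp.memLp G, hG, fun v => ?_⟩
  filter_upwards [hG] with τ hτ
  obtain ⟨hx, e⟩ := apply_of_mem_graph hτ
  rw [← e, ← inner_adjoint_apply hAd v ⟨_, hx⟩, ← inner_conj_symm,
    h.adjDensityBound.inner_flow_adjoint hk', inner_conj_symm]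

/-- For `t > 0` only the source on `s > 0` matters, for `t < 0` only that on `s ≤ 0`. Each half is
bounded by `12 a` times its own norm, and the squares recombine exactly. -/
theorem eLpNorm_duhamel_le (ha : 0 ≤ a) (hA : A.IsClosed) (hAd : Dense (A.domain : Set E))
    {ι : Type*} [Fintype ι] {χ : ι → ℝ → ℂ} (hχm : ∀ j, StronglyMeasurable (χ j))
    (hχ : ∀ j, IsNice (χ j)) (u : ι → A†.domain) {Φ : ι → ℝ → F}
    (hΦm : ∀ j, StronglyMeasurable (Φ j)) (hΦ : ∀ j, MemLp (Φ j) 2)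
    (hg : ∀ (v : A†.domain) j, ∀ᵐ τ, ⟪(v : F), Φ j τ⟫_ℂ =
      ⟪h.adjDensityBound.quarter v, hQ.flow τ (h.adjDensityBound.quarter (u j))⟫_ℂ) :
    StronglyMeasurable (fun t => ∫ s in (0 : ℝ)..t, ∑ j, χ j s • Φ j (t - s)) ∧
      eLpNorm (fun t => ∫ s in (0 : ℝ)..t, ∑ j, χ j s • Φ j (t - s)) 2 volume ≤
        ENNReal.ofReal (12 * a * √(tensorSq χ fun j => (u j : F))) := by
  set W := h.adjDensityBound.quarter
  have hD := dense_adjoint_domain hA hAd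
  have hnice : ∀ S : Set ℝ, MeasurableSet S → ∀ j, IsNice (S.indicator (χ j)) := fun S hS j =>
    ⟨(hχ j).1.indicator hS, (hχ j).2.indicator hS⟩
  have hmeas : ∀ S : Set ℝ, MeasurableSet S → ∀ j, StronglyMeasurable (S.indicator (χ j)) :=
    fun S hS j => (hχm j).indicator hS
  have hgc : ∀ (v : A†.domain) (j : ι), Continuous fun τ => ⟪W v, hQ.flow τ (W (u j))⟫_ℂ :=
    fun v j => hQ.continuous_inner_flow _ _
  have hgb : ∀ (v : A†.domain) (j : ι) τ, ‖⟪W v, hQ.flow τ (W (u j))⟫_ℂ‖ ≤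
      ‖W v‖ * ∑ j, ‖W (u j)‖ := fun v j τ =>
    (hQ.norm_inner_flow_le _ _ τ).trans (mul_le_mul_of_nonneg_left
      (Finset.single_le_sum (f := fun j => ‖W (u j)‖) (fun _ _ => norm_nonneg _)
        (Finset.mem_univ j)) (norm_nonneg _))
  have hp : ∀ χ' : ι → ℝ → ℂ, (∀ j, StronglyMeasurable (χ' j)) → (∀ j, IsNice (χ' j)) →
      eLpNorm (halfConv (Set.Ici 0) χ' Φ) 2 volume ≤
        ENNReal.ofReal (12 * a * √(tensorSq χ' fun j => (u j : F))) := by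
    intro χ' hm hn
    refine eLpNorm_halfConv_le hD hm hn hΦm hΦ hg hgc hgb (by positivity) fun κ _ η hη v => ?_
    have h1 := h.norm_corrForm_le ha hA hAd hη hn v u
    unfold IsRegularizer.corrForm at h1
    simp_rw [integral_Ici_eq_integral_Ioi]
    refine h1.trans (le_of_eq ?_)
    ring
  have hm : ∀ χ' : ι → ℝ → ℂ, (∀ j, StronglyMeasurable (χ' j)) → (∀ j, IsNice (χ' j)) →
      eLpNorm (halfConv (Set.Iio 0) χ' Φ) 2 volume ≤
        ENNReal.ofReal (12 * a * √(tensorSq χ' fun j => (u j : F))) := by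
    intro χ' hm hn
    refine eLpNorm_halfConv_le hD hm hn hΦm hΦ hg hgc hgb (by positivity) fun κ _ η hη v => ?_
    have h1 := h.norm_corrForm_le ha hA hAd hn hη u v
    -- Time reversal turns the form over negative `τ` into the conjugate of the forward form with
    -- the two arguments exchanged.
    have e1 : ∑ k, ∑ j, ∫ τ in Set.Iio (0 : ℝ), ⟪W (v k), hQ.flow τ (W (u j))⟫_ℂ *
        crossCorr (η k) (χ' j) τ = starRingEnd ℂ (hQ.corrForm χ' (fun j => W (u j)) η
          fun k => W (v k)) := by
      unfold IsRegularizer.corrForm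
      rw [Finset.sum_comm, map_sum]
      refine Finset.sum_congr rfl fun j _ => ?_
      rw [map_sum]
      refine Finset.sum_congr rfl fun k _ => ?_
      rw [← integral_Iic_eq_integral_Iio, ← neg_zero, ← integral_comp_neg_Ioi, neg_zero,
        ← integral_conj]
      refine integral_congr_ae (Filter.Eventually.of_forall fun τ => ?_)
      simp only
      rw [crossCorr_neg, map_mul, inner_conj_symm, hQ.inner_flow_left]
    rw [e1, RCLike.norm_conj]
    refine h1.trans (le_of_eq ?_)
    ring
  have hconv := intervalIntegral_eq_halfConv (fun j => (hχ j).2) hΦ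
  have hy : (fun t => ∫ s in (0 : ℝ)..t, ∑ j, χ j s • Φ j (t - s)) = fun t =>
      halfConv (Set.Ici 0) (fun j => (Set.Ioi 0).indicator (χ j)) Φ t -
        halfConv (Set.Iio 0) (fun j => (Set.Iic 0).indicator (χ j)) Φ t := by
    funext t
    rw [← (hconv t).2.1, ← (hconv t).2.2]
    rfl
  have hm1 := stronglyMeasurable_halfConv (P := Set.Ici 0) (hmeas (Set.Ioi 0) measurableSet_Ioi) hΦm
  have hm2 := stronglyMeasurable_halfConv (P := Set.Iio 0) (hmeas (Set.Iic 0) measurableSet_Iic) hΦm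
  refine ⟨by rw [hy]; exact hm1.sub hm2, ?_⟩
  refine eLpNorm_two_le_of_split hm1 (fun t => ?_) (by positivity) (by positivity) (by positivity)
    (hp _ (hmeas _ measurableSet_Ioi) (hnice _ measurableSet_Ioi))
    (hm _ (hmeas (Set.Iic 0) measurableSet_Iic) (hnice (Set.Iic 0) measurableSet_Iic)) ?_
  · rcases le_or_gt 0 t with ht | ht
    · have h2 : halfConv (Set.Iio 0) (fun j => (Set.Iic 0).indicator (χ j)) Φ t = 0 := by
        rw [← (hconv t).2.2, Set.Ioc_eq_empty (not_lt.2 ht), setIntegral_empty]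
      left
      exact ⟨by rw [congrFun hy t, h2, sub_zero], h2⟩
    · have h2 : halfConv (Set.Ici 0) (fun j => (Set.Ioi 0).indicator (χ j)) Φ t = 0 := by
        rw [← (hconv t).2.1, Set.Ioc_eq_empty (not_lt.2 ht.le), setIntegral_empty]
      right
      exact ⟨by rw [congrFun hy t, h2, zero_sub], h2⟩
  · have hnn : ∀ χ' : ι → ℝ → ℂ, 0 ≤ tensorSq χ' fun j => (u j : F) := fun χ' =>
      integral_nonneg fun t => by positivity
    rw [mul_pow, mul_pow (12 * a), mul_pow (12 * a), Real.sq_sqrt (hnn _), Real.sq_sqrt (hnn _),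
      Real.sq_sqrt (hnn _), ← mul_add]
    refine le_of_eq (congrArg _ ?_)
    have hint := integrable_norm_sum_sq (fun j => (hχ j).2) fun j => (u j : F)
    unfold tensorSq
    rw [← integral_add_compl (measurableSet_Ioi (a := (0 : ℝ))) hint,
      ← integral_indicator measurableSet_Ioi, ← integral_indicator measurableSet_Ioi.compl]
    congr 1
    all_goals
      refine integral_congr_ae (Filter.Eventually.of_forall fun t => ?_)
      simp only [Set.indicator_apply, Set.mem_Ioi, Set.mem_Iic, Set.mem_compl_iff, not_lt]
      split_ifs <;> simp

end AdjCauchyBound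

end

end

section

universe uE uF

variable {E : Type uE} [NormedAddCommGroup E] [InnerProductSpace ℂ E] [CompleteSpace E]
variable {F : Type uF} [NormedAddCommGroup F] [InnerProductSpace ℂ F] [CompleteSpace F]

/-! ### Estimates for the flow in terms of the functional calculus -/

theorem pval_of_mem_graph {V V' : Type*} [AddCommGroup V] [Module ℂ V] [AddCommGroup V']
    [Module ℂ V'] {f : V →ₗ.[ℂ] V'} {x : V} {y : V'} (h : (x, y) ∈ f.graph) :
    x ∈ f.domain ∧ pval f x = y := by
  obtain ⟨p, h1, h2⟩ := (LinearPMap.mem_graph_iff f).1 h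
  have h3 : x ∈ f.domain := by
    have := p.2
    rwa [show (p : V) = x from h1] at this
  refine ⟨h3, ?_⟩
  unfold pval
  rw [dif_pos h3]
  exact (congrArg f (Subtype.ext h1.symm)).trans h2

theorem pval_zero {V V' : Type*} [AddCommGroup V] [Module ℂ V] [AddCommGroup V']
    [Module ℂ V'] (f : V →ₗ.[ℂ] V') : (0 : V) ∈ f.domain ∧ pval f 0 = 0 :=
  pval_of_mem_graph f.graph.zero_mem

/-- A bound with a negative constant is only possible for the trivial space. -/
theorem subsingleton_of_neg {D : Submodule ℂ F} (hD : Dense (D : Set F)) {a : ℝ} (ha : a < 0)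
    (h : ∀ v : D, 0 ≤ a * ‖(v : F)‖ ^ 2) : Subsingleton F := by
  have h0 : ∀ v ∈ D, v = 0 := by
    intro v hv
    have h1 := h ⟨v, hv⟩
    simp only at h1
    by_contra hne
    have := norm_pos_iff.2 hne
    nlinarith [pow_pos this 2]
  have h1 : D = ⊥ := (Submodule.eq_bot_iff D).2 h0
  refine subsingleton_of_forall_eq 0 fun x => ?_
  have h2 := hD x
  rw [h1] at h2
  simpa using h2

section
variable {T : E →ₗ.[ℂ] E} (hT : IsSelfAdjoint T) (hpos : IsNonneg T)
  (hinj : Function.Injective T) {A : E →ₗ.[ℂ] F} {a : ℝ}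

theorem AdjDensityBound.flow_estimate
    (h : AdjDensityBound (isRegularizer_res hT hpos hinj) A a) (ha : 0 ≤ a) (hA : A.IsClosed)
    (hAd : Dense (A.domain : Set E)) (v : (fracPow T (1 / 4)).domain) :
    (∀ᵐ t : ℝ, (v : E) ∈ (A ∘ₚ sqrtFlow T t).domain) ∧
      AEStronglyMeasurable (fun t : ℝ => pval (A ∘ₚ sqrtFlow T t) v) volume ∧
      eLpNorm (fun t : ℝ => pval (A ∘ₚ sqrtFlow T t) v) 2 volume ≤
        ENNReal.ofReal (2 * √a * ‖fracPow T (1 / 4) v‖) := by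
  have hv := (mem_fracPow_graph hT hpos hinj).1 ((fracPow T (1 / 4)).mem_graph v)
  obtain ⟨G, hG, hGe⟩ := h.exists_lp_flow ha hA hAd hv
  have key : ∀ᵐ t : ℝ, (v : E) ∈ (A ∘ₚ sqrtFlow T t).domain ∧
      pval (A ∘ₚ sqrtFlow T t) v = G t := by
    filter_upwards [hGe] with t ht
    exact pval_of_mem_graph
      (mem_pcomp_graph.2 ⟨_, (sqrtFlow_graph hT hpos hinj t _ _).2 rfl, ht⟩)
  have hae : (fun t : ℝ => pval (A ∘ₚ sqrtFlow T t) v) =ᵐ[volume] G := by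
    filter_upwards [key] with t ht
    exact ht.2
  refine ⟨key.mono fun t ht => ht.1, (Lp.aestronglyMeasurable G).congr hae.symm, ?_⟩
  rw [eLpNorm_congr_ae hae, ← ENNReal.ofReal_toReal (Lp.eLpNorm_ne_top G), ← Lp.norm_def]
  exact ENNReal.ofReal_le_ofReal hG

/-- The sum runs over the nonzero values with the indicators of their level sets. The last clause
records that at most one summand is nonzero at each point, so statements about `h s` reduce to a
single vector. -/
theorem IsStep.exists_tensor {D : Submodule ℂ F} {h : ℝ → F} (hh : IsStep h)
    (hD : ∀ s, h s ∈ D) : ∃ (ι : Type uF) (_ : Fintype ι) (χ : ι → ℝ → ℂ) (u : ι → D),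
      (∀ j, StronglyMeasurable (χ j)) ∧ (∀ j, IsNice (χ j)) ∧
      (∀ s, ∑ j, χ j s • (u j : F) = h s) ∧
      ∀ s, (∀ j, χ j s = 0) ∧ h s = 0 ∨
        ∃ j, (u j : F) = h s ∧ χ j s = 1 ∧ ∀ j' ≠ j, χ j' s = 0 := by
  classical
  -- Without the value `0`, every level set lies in the bounded support and has finite measure.
  let R : Set F := Set.range h \ {0}
  have hR : R.Finite := hh.finite_range.subset Set.sdiff_subset
  have : Fintype R := hR.fintype
  have hRD : ∀ j : R, (j : F) ∈ D := by
    rintro ⟨_, ⟨s, rfl⟩, -⟩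
    exact hD s
  have hS : ∀ j : R, MeasurableSet (h ⁻¹' {(j : F)}) ∧ volume (h ⁻¹' {(j : F)}) ≠ ∞ := by
    refine fun j => ⟨hh.measurable.measurableSet_eq_fun stronglyMeasurable_const, ?_⟩
    refine (hh.bounded_support.subset fun s hs => ?_).measure_lt_top.ne
    rw [Function.mem_support, show h s = j from hs]
    exact j.2.2
  let χ : R → ℝ → ℂ := fun j => (h ⁻¹' {(j : F)}).indicator fun _ => 1
  have hcase : ∀ s, (∀ j, χ j s = 0) ∧ h s = 0 ∨
      ∃ j : R, (j : F) = h s ∧ χ j s = 1 ∧ ∀ j' ≠ j, χ j' s = 0 := by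
    intro s
    by_cases h0 : h s = 0
    · refine Or.inl ⟨fun j => Set.indicator_of_notMem (fun hs => ?_) _, h0⟩
      exact j.2.2 ((show h s = j from hs).symm.trans h0)
    · refine Or.inr ⟨⟨h s, ⟨s, rfl⟩, h0⟩, rfl, ?_, fun j' hj' => ?_⟩
      · exact Set.indicator_of_mem (show s ∈ h ⁻¹' {h s} from rfl) _
      · have hs : s ∉ h ⁻¹' {(j' : F)} := fun hs =>
          hj' (Subtype.ext (show h s = j' from hs).symm)
        exact Set.indicator_of_notMem hs _
  refine ⟨R, this, χ, fun j => ⟨j, hRD j⟩,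
    fun j => stronglyMeasurable_const.indicator (hS j).1,
    fun j => isNice_indicator ⟨_, hS j⟩ 1, fun s => ?_, hcase⟩
  rcases hcase s with ⟨h1, h2⟩ | ⟨j, h1, h2, h3⟩
  · simp [h1, h2]
  · rw [Finset.sum_eq_single j (fun j' _ hj' => by rw [h3 j' hj', zero_smul]) (by simp), h2,
      one_smul, h1]

theorem AdjCauchyBound.duhamel_estimate
    (hb : AdjCauchyBound (isRegularizer_res hT hpos hinj) A a) (ha : 0 ≤ a) (hA : A.IsClosed)
    (hAd : Dense (A.domain : Set E)) {h : ℝ → F} (hh : IsStep h)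
    (hD : ∀ s, h s ∈ A†.domain) :
    (∀ t : ℝ,
      (∀ᵐ s : ℝ, h s ∈ (A ∘ₚ sqrtFlow T (t - s) ∘ₚ fracPow T (-(1 / 2)) ∘ₚ A†).domain) ∧
      IntervalIntegrable (fun s => pval (A ∘ₚ sqrtFlow T (t - s) ∘ₚ
        fracPow T (-(1 / 2)) ∘ₚ A†) (h s)) volume 0 t) ∧
    AEStronglyMeasurable (fun t : ℝ => ∫ s in (0 : ℝ)..t,
      pval (A ∘ₚ sqrtFlow T (t - s) ∘ₚ fracPow T (-(1 / 2)) ∘ₚ A†) (h s)) volume ∧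
    eLpNorm (fun t : ℝ => ∫ s in (0 : ℝ)..t,
      pval (A ∘ₚ sqrtFlow T (t - s) ∘ₚ fracPow T (-(1 / 2)) ∘ₚ A†) (h s)) 2 volume ≤
      ENNReal.ofReal (12 * a) * eLpNorm h 2 volume := by
  obtain ⟨ι, _, χ, u, hχm, hχ, hsum, hcase⟩ := hh.exists_tensor hD
  choose k Φ hk hΦm hΦ hΦg hΦi using fun j => hb.exists_propagator ha hA hAd (u j)
  have key : ∀ t : ℝ, ∀ᵐ s : ℝ,
      h s ∈ (A ∘ₚ sqrtFlow T (t - s) ∘ₚ fracPow T (-(1 / 2)) ∘ₚ A†).domain ∧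
      pval (A ∘ₚ sqrtFlow T (t - s) ∘ₚ fracPow T (-(1 / 2)) ∘ₚ A†) (h s) =
        ∑ j, χ j s • Φ j (t - s) := by
    intro t
    have h1 : ∀ᵐ s : ℝ, ∀ j, ((isRegularizer_res hT hpos hinj).flow (t - s) (k j), Φ j (t - s)) ∈
        A.graph := by
      refine ae_all_iff.2 fun j => ?_
      -- The reflection `s ↦ t - s` pulls null sets back to null sets, so a statement for almost
      -- every `τ` holds at `τ = t - s` for almost every `s`.
      exact (Measure.measurePreserving_sub_left volume t).quasiMeasurePreserving.ae (hΦg j)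
    filter_upwards [h1] with s hs
    rcases hcase s with ⟨h2, h3⟩ | ⟨j, h2, h3, h4⟩
    · rw [h3]
      have := pval_zero (A ∘ₚ sqrtFlow T (t - s) ∘ₚ fracPow T (-(1 / 2)) ∘ₚ A†)
      simpa [h2] using this
    · have h5 : ∑ j, χ j s • Φ j (t - s) = Φ j (t - s) := by
        rw [Finset.sum_eq_single j (fun j' _ hj' => by rw [h4 j' hj', zero_smul]) (by simp), h3,
          one_smul]
      rw [h5, ← h2]
      refine pval_of_mem_graph (mem_pcomp_graph.2 ⟨_, mem_pcomp_graph.2 ⟨k j,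
        mem_pcomp_graph.2 ⟨A† (u j), A†.mem_graph (u j), ?_⟩,
        (sqrtFlow_graph hT hpos hinj (t - s) _ _).2 rfl⟩, hs j⟩)
      exact (mem_fracPow_graph hT hpos hinj).2 (hk j)
  have hI : (fun t : ℝ => ∫ s in (0 : ℝ)..t,
      pval (A ∘ₚ sqrtFlow T (t - s) ∘ₚ fracPow T (-(1 / 2)) ∘ₚ A†) (h s)) =
      fun t => ∫ s in (0 : ℝ)..t, ∑ j, χ j s • Φ j (t - s) := by
    funext t
    refine intervalIntegral.integral_congr_ae ((key t).mono fun s hs _ => hs.2)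
  obtain ⟨hm, hle⟩ := hb.eLpNorm_duhamel_le ha hA hAd hχm hχ u hΦm hΦ fun v j => hΦi j v
  refine ⟨fun t => ⟨(key t).mono fun s hs => hs.1, ?_⟩, ?_, ?_⟩
  · refine ((intervalIntegral_eq_halfConv (fun j => (hχ j).2) hΦ t).1 0 t).congr_ae ?_
    exact ae_restrict_of_ae ((key t).mono fun s hs => hs.2.symm)
  · rw [hI]
    exact hm.aestronglyMeasurable
  · rw [hI]
    refine hle.trans (le_of_eq ?_)
    have h2 : MemLp h 2 := by
      have h3 := memLp_sum_smul (fun j => (hχ j).2) fun j => (u j : F)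
      simpa only [hsum] using h3
    rw [ENNReal.ofReal_mul (by positivity)]
    congr 1
    unfold tensorSq
    simp_rw [hsum]
    rw [h2.eLpNorm_eq_integral_rpow_norm two_ne_zero ENNReal.ofNat_ne_top, Real.sqrt_eq_rpow]
    simp

/-- If `a < 0`, density of `D(A†)` forces `F` to be trivial, and the bound holds with `0`. This
allows `√a` and multiplication by `a` in the later estimates. -/
theorem AdjDensityBound.max_zero (h : AdjDensityBound (isRegularizer_res hT hpos hinj) A a)
    (hA : A.IsClosed) (hAd : Dense (A.domain : Set E)) :
    AdjDensityBound (isRegularizer_res hT hpos hinj) A (max a 0) := by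
  rcases le_or_gt 0 a with ha | ha
  · rwa [max_eq_left ha]
  · have := subsingleton_of_neg (dense_adjoint_domain hA hAd) ha fun u => (h u).nonneg
    intro u
    have h1 := h u
    rw [Subsingleton.elim (u : F) 0, norm_zero] at h1 ⊢
    simpa using h1

theorem AdjCauchyBound.max_zero (h : AdjCauchyBound (isRegularizer_res hT hpos hinj) A a)
    (hA : A.IsClosed) (hAd : Dense (A.domain : Set E)) :
    AdjCauchyBound (isRegularizer_res hT hpos hinj) A (max a 0) := by
  rcases le_or_gt 0 a with ha | ha
  · rwa [max_eq_left ha]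
  · have := subsingleton_of_neg (dense_adjoint_domain hA hAd) ha fun u => (h u).nonneg
    intro u
    have h1 := h u
    rw [Subsingleton.elim (u : F) 0, norm_zero] at h1 ⊢
    simpa using h1

end

end

end KatoSmoothing

end

/-! ### The theorem -/

open KatoSmoothing in
theorem theorem2p3 {E F : Type*}
    [NormedAddCommGroup E] [InnerProductSpace ℂ E] [CompleteSpace E]
    [NormedAddCommGroup F] [InnerProductSpace ℂ F] [CompleteSpace F]
    (H : E →ₗ.[ℂ] E) (hH : IsSelfAdjoint H) (ν : ℝ)
    (hpos : IsNonneg (shift H ν)) (hinj : Function.Injective (shift H ν))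
    (A : E →ₗ.[ℂ] F) (hA : A.IsClosed) (hAd : Dense (A.domain : Set E))
    (hB : (A ∘ₚ fracPow (shift H ν) (-(1 / 4))).IsClosed)
    (hBd : Dense ((A ∘ₚ fracPow (shift H ν) (-(1 / 4))).domain : Set E)) (a : ℝ) :
    (IsSmooth H A a →
      IsSmooth (fracPow (shift H ν) (1 / 2)) (A ∘ₚ fracPow (shift H ν) (-(1 / 4)))
        ((Real.pi + 3) * a) ∧
      ∀ v : (fracPow (shift H ν) (1 / 4)).domain,
        (∀ᵐ t : ℝ, (v : E) ∈ (A ∘ₚ sqrtFlow (shift H ν) t).domain) ∧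
        AEStronglyMeasurable (fun t : ℝ => pval (A ∘ₚ sqrtFlow (shift H ν) t) v) volume ∧
        eLpNorm (fun t : ℝ => pval (A ∘ₚ sqrtFlow (shift H ν) t) v) 2 volume ≤
          ENNReal.ofReal (2 * √((Real.pi + 3) * a) * ‖fracPow (shift H ν) (1 / 4) v‖)) ∧
    (IsSupersmooth H A a →
      IsSupersmooth (fracPow (shift H ν) (1 / 2)) (A ∘ₚ fracPow (shift H ν) (-(1 / 4)))
        ((Real.pi + 3) * a) ∧
      ∀ h : ℝ → F, IsStep h → (∀ s, h s ∈ (fracPow (shift H ν) (-(1 / 4)) ∘ₚ A†).domain) →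
        (∀ t : ℝ,
          (∀ᵐ s : ℝ, h s ∈
            (A ∘ₚ sqrtFlow (shift H ν) (t - s) ∘ₚ fracPow (shift H ν) (-(1 / 2)) ∘ₚ A†).domain) ∧
          IntervalIntegrable (fun s => pval (A ∘ₚ sqrtFlow (shift H ν) (t - s) ∘ₚ
            fracPow (shift H ν) (-(1 / 2)) ∘ₚ A†) (h s)) volume 0 t) ∧
        AEStronglyMeasurable (fun t : ℝ => ∫ s in (0 : ℝ)..t,
          pval (A ∘ₚ sqrtFlow (shift H ν) (t - s) ∘ₚ
            fracPow (shift H ν) (-(1 / 2)) ∘ₚ A†) (h s)) volume ∧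
        eLpNorm (fun t : ℝ => ∫ s in (0 : ℝ)..t,
          pval (A ∘ₚ sqrtFlow (shift H ν) (t - s) ∘ₚ
            fracPow (shift H ν) (-(1 / 2)) ∘ₚ A†) (h s)) 2 volume ≤
          ENNReal.ofReal (2 * (Real.pi + 3) * a) * eLpNorm h 2 volume) := by
  have hT := isSelfAdjoint_shift hH ν
  constructor
  · intro hs
    have hd := hs.adjDensityBound hT hpos hinj
    refine ⟨isSmooth_sqrt hT hpos hinj hA hAd hB hBd hd, fun v => ?_⟩
    obtain ⟨h1, h2, h3⟩ := (hd.max_zero hT hpos hinj hA hAd).flow_estimate hT hpos hinj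
      (le_max_right a 0) hA hAd v
    refine ⟨h1, h2, h3.trans (ENNReal.ofReal_le_ofReal ?_)⟩
    -- For `a ≤ 0` both sides vanish, the right one by the convention for square roots of negative
    -- numbers.
    have hle : √(max a 0) ≤ √((Real.pi + 3) * a) := by
      rcases le_total 0 a with ha | ha
      · rw [max_eq_left ha]
        exact Real.sqrt_le_sqrt (by nlinarith [Real.pi_pos])
      · rw [max_eq_right ha, Real.sqrt_zero]
        exact Real.sqrt_nonneg _
    gcongr
  · intro hs
    have hb := hs.adjCauchyBound hT hpos hinj
    refine ⟨isSupersmooth_sqrt hT hpos hinj hA hAd hB hBd hb, fun h hh hD => ?_⟩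
    obtain ⟨h1, h2, h3⟩ := (hb.max_zero hT hpos hinj hA hAd).duhamel_estimate hT hpos hinj
      (le_max_right a 0) hA hAd hh fun s => ((mem_pcomp_domain _ _ _).1 (hD s)).1
    refine ⟨h1, h2, h3.trans (mul_le_mul_left ?_ _)⟩
    rcases le_total 0 a with ha | ha
    · rw [max_eq_left ha]
      -- `12 ≤ 2 (π + 3)`.
      exact ENNReal.ofReal_le_ofReal (by nlinarith [Real.pi_gt_three])
    · rw [max_eq_right ha, mul_zero, ENNReal.ofReal_zero]
      exact zero_le
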